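/- **Setting.** Let $(L,R)$ be a random vector with $L,R\ge 0$ almost surely and $\mathbb P\{L>0\}+\mathbb P\{R>0\}>1$. Let $1\le\alpha<2$ and $p>2$ be such that $$\mathbb E[L^\alpha+R^\alpha]=1,\qquad \mathbb E[L^p+R^p]<1 .$$ For $s>0$ put $\mathcal S(s)=\mathbb E[L^s+R^s]-1\in[-1,\infty]$, $\varphi(s)=\mathcal S(s)/s$ and $K_2(p)=\max\{\varphi(2),\varphi(p)\}$. For a probability measure $\mu$ on $\mathbb R$ write $\hat\mu(\xi)=\int e^{i\xi v}\mu(dv)$. **Solution.** Let $\bar\mu_0$ be a probability measure on $\mathbb R$ with distribution function $F_0$, and let $(\mu_t)_{t\ge 0}$ be the solution of the kinetic equation $\partial_t\mu_t+\mu_t=Q^+(\mu_t,\mu_t)$ with initial datum $\bar\mu_0$. That is, the $\mu_t$ are probability measures, $\mu_0=\bar\mu_0$, and for every $\xi\in\mathbb R$ the function $t\mapsto\hat\mu_t(\xi)$ is continuous at $t=0$ and satisfies $$\partial_t\hat\mu_t(\xi)+\hat\mu_t(\xi)=\mathbb E[\hat\mu_t(L\xi)\hat\mu_t(R\xi)]\qquad(t>0).$$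 **Steady state.** Let $\nu_\alpha$ be the unique probability measure on $[0,\infty)$ with $\int v\,\nu_\alpha(dv)=1$ and $\hat\nu_\alpha(\xi)=\mathbb E[\hat\nu_\alpha(L^\alpha\xi)\hat\nu_\alpha(R^\alpha\xi)]$ for all $\xi\in\mathbb R$. Suppose that one of the following holds. * $\alpha=1$, and there are $c_0\in[0,\infty)$ and $\gamma_0\in\mathbb R$ with $$\lim_{x\to-\infty}|x|F_0(x)=\lim_{x\to+\infty}x\,(1-F_0(x))=c_0,\qquad \lim_{r\to+\infty}\int_{(-r,r)}x\,dF_0(x)=\gamma_0 .$$ In this case $\mu_\infty$ is the probability measure with $\hat\mu_\infty(\xi)=\int e^{m(i\gamma_0\xi-c_0\pi|\xi|)}\,\nu_1(dm)$. * $1<\alpha<2$, $\int v\,\bar\mu_0(dv)=0$, and there are real numbers $c_0^{\pm}$ with $$\lim_{x\to+\infty}x^\alpha(1-F_0(x))=c_0^+,\qquad \lim_{x\to-\infty}|x|^\alpha F_0(x)=c_0^- .$$ In this case $\mu_\infty$ is the probability measure with $$\hat\mu_\infty(\xi)=\int \exp\{-\lambda m|\xi|^\alpha(1-i\beta\tan(\tfrac{\pi\alpha}2)\,\mathrm{sign}\,\xi)\}\,\nu_\alpha(dm),$$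 where $\lambda=\frac{(c_0^++c_0^-)\pi}{2\Gamma(\alpha)\sin(\pi\alpha/2)}$ and $\beta=\frac{c_0^+-c_0^-}{c_0^++c_0^-}$ (with $\beta=0$ if $c_0^++c_0^-=0$). **Distance.** For $q>0$ let $$d_q(\mu,\mu')=\inf_m\Big(\int|x-y|^q\,m(dx\,dy)\Big)^{\min\{1,1/q\}}\in[0,\infty],$$ the infimum being over all probability measures $m$ on $\mathbb R^2$ with marginals $\mu$ and $\mu'$. **Theorem.** If $d_p(\bar\mu_0,\mu_\infty)<\infty$, then there is a finite constant $C_p$, depending on $\bar\mu_0$, $p$ and the law of $(L,R)$ but not on $t$, such that for every $t\ge 0$ $$d_p(\mu_t,\mu_\infty)\le\begin{cases} C_p\,e^{-t|K_2(p)|} & \text{if }\varphi(p)\ne\varphi(2),\\ C_p\,\max\{1,t\}\,e^{-t|K_2(p)|} & \text{if }\varphi(p)=\varphi(2).\end{cases}$$ -/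

import Mathlib

open MeasureTheory ProbabilityTheory Filter Topology Set

namespace KineticEq

noncomputable section

/-- The moment `E[L^s + R^s]` in `[0, ∞]` (used for `s > 0` and `L, R ≥ 0`). -/
def momentSum {Ω : Type*} [MeasurableSpace Ω] (P : Measure Ω) (L R : Ω → ℝ) (s : ℝ) : ENNReal :=
  ∫⁻ ω, (ENNReal.ofReal (L ω ^ s) + ENNReal.ofReal (R ω ^ s)) ∂P

/-- The convex function `𝒮(s) = E[L^s + R^s] - 1` with values in `[-1, ∞]`, for `s > 0`. -/
def convexS {Ω : Type*} [MeasurableSpace Ω] (P : Measure Ω) (L R : Ω → ℝ) (s : ℝ) : EReal :=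
  (momentSum P L R s : EReal) - 1

/-- The spectral function `φ(q) = 𝒮(q) / q`, for `q > 0`. -/
def spectral {Ω : Type*} [MeasurableSpace Ω] (P : Measure Ω) (L R : Ω → ℝ) (q : ℝ) : EReal :=
  convexS P L R q / (q : EReal)

/-- `K₂(q) = max {φ(2), φ(q)}`, for `q ≥ 2`. -/
def rateK2 {Ω : Type*} [MeasurableSpace Ω] (P : Measure Ω) (L R : Ω → ℝ) (q : ℝ) : EReal :=
  max (spectral P L R 2) (spectral P L R q)

/-- Assumption `(H₀)` on the random vector `(L, R)`, with exponents `α` and `p`. -/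
structure AssumptionH0 {Ω : Type*} [MeasurableSpace Ω] (P : Measure Ω) (L R : Ω → ℝ)
    (α p : ℝ) : Prop where
  measurable_L : Measurable L
  measurable_R : Measurable R
  nonneg_L : ∀ᵐ ω ∂P, 0 ≤ L ω
  nonneg_R : ∀ᵐ ω ∂P, 0 ≤ R ω
  pos : 1 < P {ω | 0 < L ω} + P {ω | 0 < R ω}
  alpha_pos : 0 < α
  alpha_le : α ≤ 2
  p_pos : 0 < p
  moment_alpha : momentSum P L R α = 1
  moment_p : momentSum P L R p < 1

/-- The bilinear operator `(f, g) ↦ E[f(A ξ) g(B ξ)]` on characteristic functions. -/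
def Qhat {Ω : Type*} [MeasurableSpace Ω] (P : Measure Ω) (A B : Ω → ℝ) (f g : ℝ → ℂ)
    (ξ : ℝ) : ℂ :=
  ∫ ω, f (A ω * ξ) * g (B ω * ξ) ∂P

/-- `(μ_t)_{t ≥ 0}` is the weak solution of `∂_t μ_t + μ_t = Q⁺(μ_t, μ_t)` with initial
condition `μ₀`: a family of probability measures whose Fourier-Stieltjes transform solves the
Cauchy problem (the initial value being attained continuously). -/
structure IsSolution {Ω : Type*} [MeasurableSpace Ω] (P : Measure Ω) (L R : Ω → ℝ)
    (μ₀ : Measure ℝ) (μ : ℝ → Measure ℝ) : Prop where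
  prob : ∀ t, 0 ≤ t → IsProbabilityMeasure (μ t)
  init : μ 0 = μ₀
  cont : ∀ ξ : ℝ, ContinuousWithinAt (fun t => charFun (μ t) ξ) (Ici 0) 0
  deriv : ∀ ξ t : ℝ, 0 < t →
    HasDerivAt (fun s => charFun (μ s) ξ)
      (Qhat P L R (charFun (μ t)) (charFun (μ t)) ξ - charFun (μ t) ξ) t

/-- `ν` is the mixing law `ν_α`: the probability measure on `[0, ∞)` with mean `1` such that
`ν̂(ξ) = E[ν̂(L^α ξ) ν̂(R^α ξ)]` for every real `ξ`. -/
structure IsMixingLaw {Ω : Type*} [MeasurableSpace Ω] (P : Measure Ω) (L R : Ω → ℝ)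
    (α : ℝ) (ν : Measure ℝ) : Prop where
  prob : IsProbabilityMeasure ν
  supp : ν (Iio 0) = 0
  mean : ∫ v, v ∂ν = 1
  fixed : ∀ ξ : ℝ,
    charFun ν ξ = Qhat P (fun ω => L ω ^ α) (fun ω => R ω ^ α) (charFun ν) (charFun ν) ξ

/-- Conditions on the initial datum when `α ≠ 1`: `x^α (1 - F₀(x)) → c⁺` as `x → +∞`,
`|x|^α F₀(x) → c⁻` as `x → -∞`, and `∫ v dμ₀ = 0` if `α > 1`. -/
structure StableDatum (α : ℝ) (μ₀ : Measure ℝ) (cp cm : ℝ) : Prop where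
  right : Tendsto (fun x : ℝ => x ^ α * (1 - cdf μ₀ x)) atTop (𝓝 cp)
  left : Tendsto (fun x : ℝ => |x| ^ α * cdf μ₀ x) atBot (𝓝 cm)
  centered : 1 < α → Integrable (fun v : ℝ => v) μ₀ ∧ ∫ v, v ∂μ₀ = 0

/-- The scale parameter `λ = (c⁺ + c⁻) π / (2 Γ(α) sin(π α / 2))` of the stable law. -/
def stableScale (α cp cm : ℝ) : ℝ :=
  (cp + cm) * Real.pi / (2 * Real.Gamma α * Real.sin (Real.pi * α / 2))

/-- The skewness `β = (c⁺ - c⁻) / (c⁺ + c⁻)`, equal to `0` if `c⁺ + c⁻ = 0`. -/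
def stableSkew (cp cm : ℝ) : ℝ := (cp - cm) / (cp + cm)

/-- The steady state when `α ≠ 1` (`α < 2`): the mixture of centered `α`-stable laws with
`μ̂_∞(ξ) = ∫ exp(-λ m |ξ|^α (1 - i β tan(π α / 2) sign ξ)) ν(dm)`. -/
structure IsStableSteadyState (α cp cm : ℝ) (ν μinf : Measure ℝ) : Prop where
  prob : IsProbabilityMeasure μinf
  charFun_eq : ∀ ξ : ℝ, charFun μinf ξ =
    ∫ m : ℝ, Complex.exp (-((stableScale α cp cm * m * |ξ| ^ α : ℝ) : ℂ) *
      (1 - Complex.I *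
        ((stableSkew cp cm * Real.tan (α * (Real.pi / 2)) * Real.sign ξ : ℝ) : ℂ))) ∂ν

/-- Conditions on the initial datum when `α = 1`: `|x| F₀(x) → c₀` as `x → -∞`,
`x (1 - F₀(x)) → c₀` as `x → +∞`, and `∫_{(-r, r)} x dF₀(x) → γ₀` as `r → +∞`. -/
structure CauchyDatum (μ₀ : Measure ℝ) (c₀ γ₀ : ℝ) : Prop where
  nonneg : 0 ≤ c₀
  left : Tendsto (fun x : ℝ => |x| * cdf μ₀ x) atBot (𝓝 c₀)
  right : Tendsto (fun x : ℝ => x * (1 - cdf μ₀ x)) atTop (𝓝 c₀)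
  principal : Tendsto (fun r : ℝ => ∫ x in Ioo (-r) r, x ∂μ₀) atTop (𝓝 γ₀)

/-- The steady state when `α = 1`: the mixture of Cauchy laws with
`μ̂_∞(ξ) = ∫ exp(m (i γ₀ ξ - c₀ π |ξ|)) ν(dm)`. -/
structure IsCauchySteadyState (c₀ γ₀ : ℝ) (ν μinf : Measure ℝ) : Prop where
  prob : IsProbabilityMeasure μinf
  charFun_eq : ∀ ξ : ℝ, charFun μinf ξ =
    ∫ m : ℝ, Complex.exp ((m : ℂ) *
      (Complex.I * ((γ₀ * ξ : ℝ) : ℂ) - ((c₀ * Real.pi * |ξ| : ℝ) : ℂ))) ∂ν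

/-- The probability measures on `ℝ × ℝ` with marginals `μ₁` and `μ₂`. -/
def couplings (μ₁ μ₂ : Measure ℝ) : Set (Measure (ℝ × ℝ)) :=
  {m | IsProbabilityMeasure m ∧ m.map Prod.fst = μ₁ ∧ m.map Prod.snd = μ₂}

/-- The Kantorovich-Wasserstein distance of order `p > 0`, with values in `[0, ∞]`. -/
def wasserstein (p : ℝ) (μ₁ μ₂ : Measure ℝ) : ENNReal :=
  ⨅ m ∈ couplings μ₁ μ₂, (∫⁻ z, ENNReal.ofReal (|z.1 - z.2| ^ p) ∂m) ^ (min 1 (1 / p))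

end

end KineticEq

open KineticEq

/-! The solution is the Wild series `wildSum`, a mixture with geometric weights of laws built from
the initial law by iterated collisions. This construction makes sense over any Euclidean space and
commutes with linear maps (`map_wildSum`). Take a coupling `m` of the initial datum and the steady
state with finite cost of order `p`, and run the Wild series on the plane, so that both coordinates
undergo the same collisions. Projecting to the first coordinate gives the solution
(`IsSolution.eq_wildSum`). Projecting to the second gives the steady state, which the collision
operator fixes (`IsMixtureOfExp.collide_eq`). The law of the difference of the coordinates is the
Wild series started from the law `ρ` of the initial difference. Hence the `p`-th power of the
distance at time `t` is at most the `p`-th absolute moment of the Wild series of `ρ`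
(`wasserstein_solution_le`).

The law `ρ` is centered, although for `α = 1` the marginals may have no mean. The difference is
integrable, and Lipschitz truncations of the identity have the same limiting integral under both
marginals (`integral_sub_eq_zero_of_tendsto`). For `α > 1` the truncation is `sin (ε x) / ε`. For `α
= 1` it is `x / (1 + (ε x)²)`, which is an absolutely convergent superposition of hard truncations,
controlled by the principal value of the datum, and also a Laplace average of sines, controlled by
the characteristic function of the steady state.

For centered laws the second moment of the Wild series decays like `e^{(s₂ - 1) t}`, where `s₂ =
E[L² + R²]`. In the second order expansion of `|a + b|^p` (`exists_abs_add_rpow_le`) the terms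
linear in one variable average to zero, so with `s_p = E[L^p + R^p]` the `p`-th moment `f` satisfies
`f' ≤ (s_p - 1) f + const · e^{(s₂ - 1) t} f^{(p - 2)/p}`. Writing `f = w^{p/2}` turns this into a
linear inequality for `w` with exponents `2 φ(p)` and `2 φ(2)`. Supersolutions of it bound `w`,
whose square root bounds the distance; equality of the exponents is the resonant case, which costs a
factor in `t`. -/

set_option linter.unusedSectionVars false

namespace KineticEq

noncomputable section

/-! ### The Wild series over a normed space -/

section WildDef

variable {Ω : Type*} [MeasurableSpace Ω] (P : Measure Ω) (L R : Ω → ℝ)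
variable {E : Type*} [NormedAddCommGroup E] [NormedSpace ℝ E] [MeasurableSpace E]

/-- The collision operator `Q⁺`: the law of `L • X + R • Y` for independent `(L, R)`, `X ∼ m₁`,
`Y ∼ m₂`. -/
def collide (m₁ m₂ : Measure E) : Measure E :=
  (P.prod (m₁.prod m₂)).map (fun z => L z.1 • z.2.1 + R z.1 • z.2.2)

/-- The Wild sequence `q₀ = m`, `q_{n+1} = (n + 1)⁻¹ ∑_{j ≤ n} Q⁺(q_j, q_{n-j})`. -/
def wild (m : Measure E) : ℕ → Measure E
  | 0 => m
  | n + 1 => ((n + 1 : ℕ) : ENNReal)⁻¹ •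
      ∑ j : Fin (n + 1), collide P L R (wild m j) (wild m (n - j))
  decreasing_by all_goals omega

/-- The weights `e^{-t} (1 - e^{-t})^n` of the Wild sum. -/
def wildWeight (t : ℝ) (n : ℕ) : ℝ := Real.exp (-t) * (1 - Real.exp (-t)) ^ n

/-- The Wild sum `∑ₙ e^{-t} (1 - e^{-t})^n qₙ`. -/
def wildSum (m : Measure E) (t : ℝ) : Measure E :=
  Measure.sum fun n => ENNReal.ofReal (wildWeight t n) • wild P L R m n

@[simp] lemma wild_zero (m : Measure E) : wild P L R m 0 = m := by
  rw [wild]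

lemma wild_succ (m : Measure E) (n : ℕ) : wild P L R m (n + 1) =
    ((n + 1 : ℕ) : ENNReal)⁻¹ •
      ∑ x ∈ Finset.HasAntidiagonal.antidiagonal n, collide P L R (wild P L R m x.1) (wild P L R m x.2) := by
  rw [wild, Finset.Nat.sum_antidiagonal_eq_sum_range_succ_mk,
    ← Fin.sum_univ_eq_sum_range
      (fun k => collide P L R (wild P L R m k) (wild P L R m (n - k)))]

end WildDef

/-! ### Geometric weights: summability, time derivative, Cauchy product -/

section Weights

lemma one_sub_exp_neg_nonneg {t : ℝ} (ht : 0 ≤ t) : 0 ≤ 1 - Real.exp (-t) := by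
  have : Real.exp (-t) ≤ 1 := Real.exp_le_one_iff.mpr (by linarith)
  linarith

lemma one_sub_exp_neg_lt_one (t : ℝ) : 1 - Real.exp (-t) < 1 := by
  have := Real.exp_pos (-t)
  linarith

lemma wildWeight_nonneg {t : ℝ} (ht : 0 ≤ t) (n : ℕ) : 0 ≤ wildWeight t n :=
  mul_nonneg (Real.exp_pos _).le (pow_nonneg (one_sub_exp_neg_nonneg ht) n)

lemma hasSum_wildWeight {t : ℝ} (ht : 0 ≤ t) : HasSum (wildWeight t) 1 := by
  have h := (hasSum_geometric_of_lt_one (one_sub_exp_neg_nonneg ht)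
    (one_sub_exp_neg_lt_one t)).mul_left (Real.exp (-t))
  have : Real.exp (-t) * (1 - (1 - Real.exp (-t)))⁻¹ = 1 := by
    rw [sub_sub_cancel, mul_inv_cancel₀ (Real.exp_pos _).ne']
  rwa [this] at h

lemma wildWeight_zero (n : ℕ) : wildWeight 0 n = if n = 0 then 1 else 0 := by
  cases n <;> simp [wildWeight]

lemma summable_wildWeight_mul {t : ℝ} (ht : 0 ≤ t) {c : ℕ → ℝ} {B : ℝ} (hc : ∀ n, |c n| ≤ B) :
    Summable fun n => wildWeight t n * c n := by
  refine Summable.of_norm_bounded ((hasSum_wildWeight ht).summable.mul_right B) fun n => ?_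
  rw [norm_mul, Real.norm_of_nonneg (wildWeight_nonneg ht n)]
  exact mul_le_mul_of_nonneg_left (hc n) (wildWeight_nonneg ht n)

/-- The factor `n + 1` appears when the Wild recursion is cleared of its denominator; geometric
decay absorbs it. -/
lemma summable_wildWeight_mul_succ {t : ℝ} (ht : 0 ≤ t) {c : ℕ → ℝ} {B : ℝ}
    (hc : ∀ n, |c n| ≤ B) : Summable fun n : ℕ => wildWeight t n * ((n + 1) * c n) := by
  have hx : ‖1 - Real.exp (-t)‖ < 1 := by
    rw [Real.norm_of_nonneg (one_sub_exp_neg_nonneg ht)]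
    exact one_sub_exp_neg_lt_one t
  have h1 := summable_pow_mul_geometric_of_norm_lt_one 1 (r := 1 - Real.exp (-t)) hx
  have h2 := summable_geometric_of_norm_lt_one hx
  refine Summable.of_norm_bounded (((h1.add h2).mul_left (Real.exp (-t))).mul_right B) fun n => ?_
  rw [norm_mul, norm_mul, Real.norm_of_nonneg (wildWeight_nonneg ht n),
    Real.norm_of_nonneg (show (0 : ℝ) ≤ n + 1 by positivity), Real.norm_eq_abs]
  have := mul_le_mul_of_nonneg_left (hc n)
    (mul_nonneg (wildWeight_nonneg ht n) (show (0 : ℝ) ≤ n + 1 by positivity))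
  rw [← mul_assoc]
  refine this.trans (le_of_eq ?_)
  simp only [wildWeight, pow_one]
  ring

variable {F : Type*} [NormedAddCommGroup F] [NormedSpace ℝ F]

lemma summable_wildWeight_smul {t : ℝ} (ht : 0 ≤ t) {c : ℕ → F} {B : ℝ}
    (hc : ∀ n, ‖c n‖ ≤ B) : Summable fun n => ‖wildWeight t n • c n‖ := by
  refine Summable.of_nonneg_of_le (fun _ => norm_nonneg _) (fun n => ?_)
    ((hasSum_wildWeight ht).summable.mul_right B)
  rw [norm_smul, Real.norm_of_nonneg (wildWeight_nonneg ht n)]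
  exact mul_le_mul_of_nonneg_left (hc n) (wildWeight_nonneg ht n)

lemma hasDerivAt_tsum_pow_smul [CompleteSpace F] {c : ℕ → F} {B : ℝ} (hc : ∀ n, ‖c n‖ ≤ B) {x : ℝ}
    (hx : |x| < 1) :
    HasDerivAt (fun y : ℝ => ∑' n, y ^ n • c n) (∑' n : ℕ, x ^ n • ((n + 1 : ℝ) • c (n + 1))) x := by
  obtain ⟨r, hxr, hr⟩ := exists_between hx
  have hr0 : 0 < r := (abs_nonneg x).trans_lt hxr
  have hB : 0 ≤ B := (norm_nonneg _).trans (hc 0)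
  have hsum : Summable fun n : ℕ => (n : ℝ) * r ^ (n - 1) * B := by
    refine Summable.mul_right _ ((summable_nat_add_iff 1).mp ?_)
    have h1 := summable_pow_mul_geometric_of_norm_lt_one 1 (r := r)
      (by rwa [Real.norm_of_nonneg hr0.le])
    have h2 := summable_geometric_of_lt_one hr0.le hr
    refine (h1.add h2).congr fun n => ?_
    simp
    ring
  have key := hasDerivAt_tsum_of_isPreconnected (t := Ioo (-r) r)
    (g := fun n (y : ℝ) => y ^ n • c n) (g' := fun n y => ((n : ℝ) * y ^ (n - 1)) • c n)
    (y₀ := 0) (y := x) hsum isOpen_Ioo isPreconnected_Ioo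
    (fun n y _ => (hasDerivAt_pow n y).smul_const _)
    (fun n y hy => by
      have hy' : |y| ≤ r := (abs_lt.mpr ⟨hy.1, hy.2⟩).le
      rw [norm_smul, norm_mul, norm_pow, Real.norm_natCast]
      gcongr
      · exact hy'
      · exact hc n)
    ⟨by linarith, hr0⟩
    -- At the base point `0` only the term `n = 0` survives.
    (summable_of_ne_finset_zero (s := {0}) fun n hn => by
      simp [zero_pow (by simpa using hn : n ≠ 0)])
    (abs_lt.mp hxr)
  convert key using 1
  have hs : Summable fun n : ℕ => ((n : ℝ) * x ^ (n - 1)) • c n := by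
    refine Summable.of_norm_bounded hsum fun n => ?_
    rw [norm_smul, norm_mul, norm_pow, Real.norm_natCast]
    gcongr
    · exact hxr.le
    · exact hc n
  rw [hs.tsum_eq_zero_add]
  simp [smul_smul, mul_comm]

/-- The derivative in time of a Wild series with bounded coefficients. -/
lemma hasDerivAt_tsum_wildWeight [CompleteSpace F] {c : ℕ → F} {B : ℝ} (hc : ∀ n, ‖c n‖ ≤ B) {t : ℝ}
    (ht : 0 ≤ t) :
    HasDerivAt (fun s : ℝ => ∑' n, wildWeight s n • c n)
      (Real.exp (-t) • ∑' n : ℕ, wildWeight t n • ((n + 1 : ℝ) • c (n + 1))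
        - ∑' n, wildWeight t n • c n) t := by
  have hx : |1 - Real.exp (-t)| < 1 := by
    -- The series is `e^{-s}` times a power series in `1 - e^{-s}`. The inner derivative is again
    -- `e^{-s}`, and differentiating the prefactor gives minus the series.
    rw [abs_of_nonneg (one_sub_exp_neg_nonneg ht)]
    exact one_sub_exp_neg_lt_one t
  have he : HasDerivAt (fun s : ℝ => Real.exp (-s)) (-Real.exp (-t)) t := by
    simpa using (hasDerivAt_neg t).exp
  have hy : HasDerivAt (fun s : ℝ => 1 - Real.exp (-s)) (Real.exp (-t)) t := by
    simpa using he.const_sub 1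
  have h1 := (hasDerivAt_tsum_pow_smul hc hx).scomp t hy
  have h2 := he.smul h1
  have e : ∀ (s : ℝ) (d : ℕ → F), ∑' n, wildWeight s n • d n =
      Real.exp (-s) • ∑' n, (1 - Real.exp (-s)) ^ n • d n := by
    intro s d
    rw [← tsum_const_smul'']
    simp [wildWeight, smul_smul]
  have h3 : (fun s : ℝ => ∑' n, wildWeight s n • c n) =
      (fun s : ℝ => Real.exp (-s)) •
        ((fun y : ℝ => ∑' n, y ^ n • c n) ∘ fun s : ℝ => 1 - Real.exp (-s)) := by
    funext s
    exact e s c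
  rw [h3]
  convert h2 using 1
  rw [e, e]
  simp only [Function.comp, neg_smul]
  abel

/-- Cauchy product of two Wild series. -/
lemma tsum_wildWeight_antidiagonal {A : Type*} [NormedRing A] [NormedAlgebra ℝ A]
    [CompleteSpace A] {u v : ℕ → A} {B D : ℝ} (hu : ∀ n, ‖u n‖ ≤ B) (hv : ∀ n, ‖v n‖ ≤ D)
    {t : ℝ} (ht : 0 ≤ t) :
    Real.exp (-t) • ∑' n : ℕ, wildWeight t n • ∑ x ∈ Finset.HasAntidiagonal.antidiagonal n, u x.1 * v x.2 =
      (∑' n, wildWeight t n • u n) * ∑' n, wildWeight t n • v n := by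
  have h1 := tsum_mul_tsum_eq_tsum_sum_antidiagonal_of_summable_norm
    (f := fun n => wildWeight t n • u n) (g := fun n => wildWeight t n • v n)
    (summable_wildWeight_smul ht hu) (summable_wildWeight_smul ht hv)
  rw [h1]
  have h2 := tsum_const_smul'' (γ := ℝ) (α := A) (L := SummationFilter.unconditional ℕ) (Real.exp (-t)) (f := fun n : ℕ =>
    wildWeight t n • ∑ x ∈ Finset.HasAntidiagonal.antidiagonal n, u x.1 * v x.2)
  rw [← h2]
  refine tsum_congr fun n => ?_
  rw [smul_smul, Finset.smul_sum]
  refine Finset.sum_congr rfl fun x hx => ?_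
  -- The product of the weights of index `i` and `j` is `e^{-t}` times the weight of index `i + j`.
  rw [smul_mul_smul_comm, ← Finset.HasAntidiagonal.mem_antidiagonal.mp hx]
  congr 1
  simp only [wildWeight, pow_add]
  ring

end Weights

/-! ### Collisions, linear images and fixed points -/

section Collide

variable {Ω : Type*} [MeasurableSpace Ω] {P : Measure Ω} [IsProbabilityMeasure P] {L R : Ω → ℝ}
variable {E : Type*} [NormedAddCommGroup E] [NormedSpace ℝ E] [MeasurableSpace E] [BorelSpace E]
  [SecondCountableTopology E]
variable {G : Type*} [NormedAddCommGroup G] [NormedSpace ℝ G] [MeasurableSpace G] [BorelSpace G]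
  [SecondCountableTopology G]

lemma measurable_collide_map (hL : Measurable L) (hR : Measurable R) :
    Measurable (fun z : Ω × E × E => L z.1 • z.2.1 + R z.1 • z.2.2) := by
  fun_prop

lemma isProbabilityMeasure_collide (hL : Measurable L) (hR : Measurable R) (m₁ m₂ : Measure E)
    [IsProbabilityMeasure m₁] [IsProbabilityMeasure m₂] :
    IsProbabilityMeasure (collide P L R m₁ m₂) :=
  Measure.isProbabilityMeasure_map (measurable_collide_map hL hR).aemeasurable

/-- A collision only uses the linear structure. This is what lets a coupling be evolved on the plane
and then projected to its marginals or to the difference of its coordinates. -/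
lemma map_collide (hL : Measurable L) (hR : Measurable R) (T : E →L[ℝ] G) (m₁ m₂ : Measure E)
    [IsProbabilityMeasure m₁] [IsProbabilityMeasure m₂] :
    (collide P L R m₁ m₂).map T = collide P L R (m₁.map T) (m₂.map T) := by
  have hT : Measurable T := T.continuous.measurable
  have h1 : P.prod ((m₁.map T).prod (m₂.map T)) =
      (P.prod (m₁.prod m₂)).map (Prod.map id (Prod.map T T)) := by
    rw [← Measure.map_prod_map _ _ measurable_id (hT.prodMap hT), Measure.map_id,
      Measure.map_prod_map _ _ hT hT]
  rw [collide, collide, h1, Measure.map_map hT (measurable_collide_map hL hR),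
    Measure.map_map (measurable_collide_map hL hR) (measurable_id.prodMap (hT.prodMap hT))]
  congr 1
  funext z
  simp

lemma isProbabilityMeasure_wild (hL : Measurable L) (hR : Measurable R) (m : Measure E)
    [IsProbabilityMeasure m] (n : ℕ) : IsProbabilityMeasure (wild P L R m n) := by
  induction n using Nat.strong_induction_on with
  | _ n ih =>
    cases n with
    | zero => rwa [wild_zero]
    | succ n =>
      constructor
      rw [wild_succ, Measure.smul_apply, Measure.finsetSum_apply, Finset.sum_congr rfl
        (g := fun _ => (1 : ENNReal))]
      · simp only [Finset.sum_const, Finset.Nat.card_antidiagonal, nsmul_eq_mul, mul_one,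
          smul_eq_mul]
        exact ENNReal.inv_mul_cancel (by simp) (by simp)
      · intro x hx
        have hx' := Finset.HasAntidiagonal.mem_antidiagonal.mp hx
        have := ih x.1 (by omega)
        have := ih x.2 (by omega)
        have := isProbabilityMeasure_collide (P := P) hL hR (wild P L R m x.1) (wild P L R m x.2)
        exact measure_univ

lemma map_wild (hL : Measurable L) (hR : Measurable R) (T : E →L[ℝ] G) (m : Measure E)
    [IsProbabilityMeasure m] (n : ℕ) :
    (wild P L R m n).map T = wild P L R (m.map T) n := by
  induction n using Nat.strong_induction_on with
  | _ n ih =>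
    cases n with
    | zero => simp
    | succ n =>
      have hT : Measurable T := T.continuous.measurable
      rw [wild_succ, wild_succ, Measure.map_smul, ← Measure.mapₗ_apply_of_measurable hT,
        map_sum]
      congr 1
      refine Finset.sum_congr rfl fun x hx => ?_
      have hx' := Finset.HasAntidiagonal.mem_antidiagonal.mp hx
      have := isProbabilityMeasure_wild (P := P) hL hR m x.1
      have := isProbabilityMeasure_wild (P := P) hL hR m x.2
      rw [Measure.mapₗ_apply_of_measurable hT, map_collide hL hR, ih _ (by omega),
        ih _ (by omega)]

lemma map_wildSum (hL : Measurable L) (hR : Measurable R) (T : E →L[ℝ] G) (m : Measure E)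
    [IsProbabilityMeasure m] (t : ℝ) :
    (wildSum P L R m t).map T = wildSum P L R (m.map T) t := by
  rw [wildSum, wildSum, Measure.map_sum T.continuous.measurable.aemeasurable]
  congr 1
  funext n
  rw [Measure.map_smul, map_wild hL hR]

/-- The antidiagonal of `n` has `n + 1` elements, which cancels the normalization of the recursion.
-/
lemma wild_eq_self (m : Measure E) (hm : collide P L R m m = m) (n : ℕ) :
    wild P L R m n = m := by
  induction n using Nat.strong_induction_on with
  | _ n ih =>
    cases n with
    | zero => simp
    | succ n =>
      rw [wild_succ, Finset.sum_congr rfl (g := fun _ => m)]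
      · simp only [Finset.sum_const, Finset.Nat.card_antidiagonal]
        rw [← Nat.cast_smul_eq_nsmul ENNReal, smul_smul,
          ENNReal.inv_mul_cancel (by simp) (by simp), one_smul]
      · intro x hx
        have hx' := Finset.HasAntidiagonal.mem_antidiagonal.mp hx
        rw [ih _ (by omega), ih _ (by omega), hm]

lemma lintegral_wildSum (m : Measure E) (t : ℝ) (f : E → ENNReal) :
    ∫⁻ x, f x ∂wildSum P L R m t =
      ∑' n, ENNReal.ofReal (wildWeight t n) * ∫⁻ x, f x ∂wild P L R m n := by
  simp [wildSum, lintegral_sum_measure]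

lemma isProbabilityMeasure_wildSum (hL : Measurable L) (hR : Measurable R) (m : Measure E)
    [IsProbabilityMeasure m] {t : ℝ} (ht : 0 ≤ t) :
    IsProbabilityMeasure (wildSum P L R m t) := by
  constructor
  have := isProbabilityMeasure_wild (P := P) hL hR m
  rw [← lintegral_one, lintegral_wildSum]
  simp only [lintegral_one, measure_univ, mul_one]
  rw [← ENNReal.ofReal_tsum_of_nonneg (wildWeight_nonneg ht) (hasSum_wildWeight ht).summable,
    (hasSum_wildWeight ht).tsum_eq, ENNReal.ofReal_one]

lemma wildSum_eq_self (m : Measure E) (hm : collide P L R m m = m) {t : ℝ} (ht : 0 ≤ t) :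
    wildSum P L R m t = m := by
  ext s hs
  rw [← lintegral_indicator_one hs, lintegral_wildSum, ← lintegral_indicator_one hs]
  simp only [wild_eq_self m hm]
  rw [ENNReal.tsum_mul_right,
    ← ENNReal.ofReal_tsum_of_nonneg (wildWeight_nonneg ht) (hasSum_wildWeight ht).summable,
    (hasSum_wildWeight ht).tsum_eq, ENNReal.ofReal_one, one_mul]

lemma integral_wildSum {F : Type*} [NormedAddCommGroup F] [NormedSpace ℝ F] (m : Measure E)
    {t : ℝ} (ht : 0 ≤ t) {f : E → F} (hf : Integrable f (wildSum P L R m t)) :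
    ∫ x, f x ∂wildSum P L R m t = ∑' n, wildWeight t n • ∫ x, f x ∂wild P L R m n := by
  rw [wildSum, integral_sum_measure hf]
  refine tsum_congr fun n => ?_
  rw [integral_smul_measure, ENNReal.toReal_ofReal (wildWeight_nonneg ht n)]

lemma integral_wild_succ {F : Type*} [NormedAddCommGroup F] [NormedSpace ℝ F]
    (m : Measure E) (n : ℕ) {f : E → F}
    (hf : ∀ x ∈ Finset.HasAntidiagonal.antidiagonal n,
      Integrable f (collide P L R (wild P L R m x.1) (wild P L R m x.2))) :
    ∫ z, f z ∂wild P L R m (n + 1) = ((n + 1 : ℝ))⁻¹ • ∑ x ∈ Finset.HasAntidiagonal.antidiagonal n,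
      ∫ z, f z ∂collide P L R (wild P L R m x.1) (wild P L R m x.2) := by
  rw [wild_succ, integral_smul_measure, integral_finsetSum_measure hf,
    ENNReal.toReal_inv, ENNReal.toReal_natCast]
  push_cast
  rfl

end Collide

/-! ### The Wild series is the unique solution -/

section Solution

variable {Ω : Type*} [MeasurableSpace Ω] {P : Measure Ω} [IsProbabilityMeasure P] {L R : Ω → ℝ}

lemma integrable_exp_mul_I (m : Measure ℝ) [IsFiniteMeasure m] (ξ : ℝ) :
    Integrable (fun x : ℝ => Complex.exp (ξ * x * Complex.I)) m := by
  refine Integrable.of_bound (by fun_prop) 1 (ae_of_all _ fun x => ?_)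
  rw [← Complex.ofReal_mul, Complex.norm_exp_ofReal_mul_I]

lemma charFun_collide (hL : Measurable L) (hR : Measurable R) (m₁ m₂ : Measure ℝ)
    [IsProbabilityMeasure m₁] [IsProbabilityMeasure m₂] (ξ : ℝ) :
    charFun (collide P L R m₁ m₂) ξ = Qhat P L R (charFun m₁) (charFun m₂) ξ := by
  have hm := measurable_collide_map (E := ℝ) hL hR
  have hint : Integrable (fun z : Ω × ℝ × ℝ =>
      Complex.exp (ξ * ((L z.1 • z.2.1 + R z.1 • z.2.2 : ℝ) : ℂ) * Complex.I))
      (P.prod (m₁.prod m₂)) := by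
    refine Integrable.of_bound (by fun_prop) 1 (ae_of_all _ fun x => ?_)
    rw [← Complex.ofReal_mul, Complex.norm_exp_ofReal_mul_I]
  rw [charFun_apply_real, collide, integral_map hm.aemeasurable (by fun_prop),
    integral_prod _ hint, Qhat]
  refine integral_congr_ae (ae_of_all _ fun ω => ?_)
  simp only [charFun_apply_real]
  rw [← integral_prod_mul]
  refine integral_congr_ae (ae_of_all _ fun z => ?_)
  simp only [smul_eq_mul]
  rw [← Complex.exp_add]
  congr 1
  push_cast
  ring

lemma charFun_wild_succ (hL : Measurable L) (hR : Measurable R) (m : Measure ℝ)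
    [IsProbabilityMeasure m] (n : ℕ) (ξ : ℝ) :
    (n + 1 : ℝ) • charFun (wild P L R m (n + 1)) ξ = ∑ x ∈ Finset.HasAntidiagonal.antidiagonal n,
      Qhat P L R (charFun (wild P L R m x.1)) (charFun (wild P L R m x.2)) ξ := by
  have hp := isProbabilityMeasure_wild (P := P) hL hR m
  rw [charFun_apply_real, integral_wild_succ, smul_smul, mul_inv_cancel₀ (by positivity), one_smul]
  · refine Finset.sum_congr rfl fun x _ => ?_
    rw [← charFun_collide hL hR, charFun_apply_real]
  · intro x _
    have := isProbabilityMeasure_collide (P := P) hL hR (wild P L R m x.1) (wild P L R m x.2)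
    exact integrable_exp_mul_I _ ξ

lemma charFun_wildSum (hL : Measurable L) (hR : Measurable R) (m : Measure ℝ)
    [IsProbabilityMeasure m] {t : ℝ} (ht : 0 ≤ t) (ξ : ℝ) :
    charFun (wildSum P L R m t) ξ = ∑' n, wildWeight t n • charFun (wild P L R m n) ξ := by
  have := isProbabilityMeasure_wildSum (P := P) hL hR m ht
  simp_rw [charFun_apply_real]
  exact integral_wildSum m ht (integrable_exp_mul_I _ ξ)

lemma wildSum_zero (m : Measure ℝ) : wildSum P L R m 0 = m := by
  ext s hs
  rw [← lintegral_indicator_one hs, lintegral_wildSum, tsum_eq_single 0]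
  · rw [wildWeight_zero, if_pos rfl, ENNReal.ofReal_one, one_mul, wild_zero,
      lintegral_indicator_one hs]
  · intro n hn
    simp [wildWeight_zero, hn]

/-- The series is differentiated rather than the characteristic function of `wildSum`: it has a
two-sided derivative even at `t = 0`, whereas for negative times the weights change sign and
`wildSum` clips them. Clearing denominators in the recursion turns the shifted series into a Cauchy
product, which is the collision term. -/
lemma hasDerivAt_charFun_wildSum (hL : Measurable L) (hR : Measurable R) (m : Measure ℝ)
    [IsProbabilityMeasure m] (ξ : ℝ) {t : ℝ} (ht : 0 ≤ t) :
    HasDerivAt (fun s => ∑' n, wildWeight s n • charFun (wild P L R m n) ξ)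
      (Qhat P L R (charFun (wildSum P L R m t)) (charFun (wildSum P L R m t)) ξ
        - charFun (wildSum P L R m t) ξ) t := by
  have hp := isProbabilityMeasure_wild (P := P) hL hR m
  have h1 : ∀ (η : ℝ) (n : ℕ), ‖charFun (wild P L R m n) η‖ ≤ 1 := fun η n =>
    norm_charFun_le_one η
  refine (hasDerivAt_tsum_wildWeight (h1 ξ) ht).congr_deriv ?_
  rw [charFun_wildSum hL hR m ht ξ]
  congr 1
  symm
  simp_rw [charFun_wild_succ hL hR m, Qhat, charFun_wildSum hL hR m ht]
  have hmeas : ∀ n, Measurable (charFun (wild P L R m n)) := fun n => measurable_charFun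
  have hintxy : ∀ i j : ℕ, Integrable (fun ω => charFun (wild P L R m i) (L ω * ξ) *
      charFun (wild P L R m j) (R ω * ξ)) P := by
    intro i j
    refine Integrable.of_bound (C := 1)
      (((hmeas i).comp (hL.mul_const ξ)).mul ((hmeas j).comp (hR.mul_const ξ))).aestronglyMeasurable
      (ae_of_all _ fun ω => ?_)
    rw [norm_mul]
    exact mul_le_one₀ (h1 _ _) (norm_nonneg _) (h1 _ _)
  simp_rw [← tsum_wildWeight_antidiagonal (h1 _) (h1 _) ht]
  rw [integral_smul]
  congr 1
  have hswap : ∀ n : ℕ, wildWeight t n • ∑ x ∈ Finset.HasAntidiagonal.antidiagonal n,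
      ∫ ω, charFun (wild P L R m x.1) (L ω * ξ) * charFun (wild P L R m x.2) (R ω * ξ) ∂P =
      ∫ ω, wildWeight t n • ∑ x ∈ Finset.HasAntidiagonal.antidiagonal n,
        charFun (wild P L R m x.1) (L ω * ξ) * charFun (wild P L R m x.2) (R ω * ξ) ∂P := by
    intro n
    rw [integral_smul, integral_finsetSum _ fun x _ => hintxy x.1 x.2]
  simp_rw [hswap]
  have hint : ∀ n : ℕ, Integrable (fun ω => wildWeight t n •
      ∑ x ∈ Finset.HasAntidiagonal.antidiagonal n, charFun (wild P L R m x.1) (L ω * ξ) *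
      charFun (wild P L R m x.2) (R ω * ξ)) P := fun n =>
    Integrable.smul (wildWeight t n) (integrable_finsetSum
      (Finset.HasAntidiagonal.antidiagonal n) fun (x : ℕ × ℕ) _ => hintxy x.1 x.2)
  -- The `n`-th integrand is bounded by `n + 1` times its weight, so sum and expectation may be
  -- exchanged.
  refine (integral_tsum_of_summable_integral_norm hint ?_).symm
  have hsum : Summable fun n : ℕ => wildWeight t n * (n + 1) := by
    simpa using summable_wildWeight_mul_succ ht (c := fun _ => 1) (B := 1) (by simp)
  refine Summable.of_nonneg_of_le (fun n => integral_nonneg fun _ => norm_nonneg _)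
    (fun n => ?_) hsum
  refine (integral_mono (hint n).norm (integrable_const (wildWeight t n * (n + 1)))
    fun ω => ?_).trans (by simp)
  simp only
  rw [norm_smul, Real.norm_of_nonneg (wildWeight_nonneg ht n)]
  refine mul_le_mul_of_nonneg_left ?_ (wildWeight_nonneg ht n)
  refine (norm_sum_le_of_le _ (f := fun x : ℕ × ℕ => charFun (wild P L R m x.1) (L ω * ξ) *
      charFun (wild P L R m x.2) (R ω * ξ)) (n := fun _ => (1 : ℝ)) fun x _ => ?_).trans (by simp)
  rw [norm_mul]
  exact mul_le_one₀ (h1 _ _) (norm_nonneg _) (h1 _ _)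

lemma isSolution_wildSum (hL : Measurable L) (hR : Measurable R) (m : Measure ℝ)
    [IsProbabilityMeasure m] : IsSolution P L R m (wildSum P L R m) where
  prob t ht := isProbabilityMeasure_wildSum hL hR m ht
  init := wildSum_zero m
  cont ξ := by
    refine ((hasDerivAt_charFun_wildSum (P := P) hL hR m ξ
      le_rfl).continuousAt.continuousWithinAt).congr_of_mem (fun t ht => ?_) self_mem_Ici
    exact charFun_wildSum hL hR m ht ξ
  deriv ξ t ht := by
    refine (hasDerivAt_charFun_wildSum hL hR m ξ ht.le).congr_of_eventuallyEq ?_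
    filter_upwards [lt_mem_nhds ht] with s hs
    exact charFun_wildSum hL hR m hs.le ξ

lemma norm_Qhat_sub_Qhat_le (hL : Measurable L) (hR : Measurable R) (m₁ m₂ : Measure ℝ)
    [IsProbabilityMeasure m₁] [IsProbabilityMeasure m₂] {b : ℝ}
    (hb : ∀ ξ, ‖charFun m₁ ξ - charFun m₂ ξ‖ ≤ b) (ξ : ℝ) :
    ‖Qhat P L R (charFun m₁) (charFun m₁) ξ - Qhat P L R (charFun m₂) (charFun m₂) ξ‖ ≤ 2 * b := by
  have hint : ∀ (m : Measure ℝ) [IsProbabilityMeasure m], Integrable (fun ω =>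
      charFun m (L ω * ξ) * charFun m (R ω * ξ)) P := by
    intro m _
    have hm : Measurable (charFun m) := measurable_charFun
    refine Integrable.of_bound (C := 1)
      ((hm.comp (hL.mul_const ξ)).mul (hm.comp (hR.mul_const ξ))).aestronglyMeasurable
      (ae_of_all _ fun ω => ?_)
    rw [norm_mul]
    exact mul_le_one₀ (norm_charFun_le_one _) (norm_nonneg _) (norm_charFun_le_one _)
  rw [Qhat, Qhat, ← integral_sub (hint m₁) (hint m₂)]
  refine (norm_integral_le_of_norm_le_const (C := 2 * b) (ae_of_all _ fun ω => ?_)).trans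
    (by simp)
  have e : charFun m₁ (L ω * ξ) * charFun m₁ (R ω * ξ) - charFun m₂ (L ω * ξ) * charFun m₂ (R ω * ξ)
      = charFun m₁ (L ω * ξ) * (charFun m₁ (R ω * ξ) - charFun m₂ (R ω * ξ)) +
        (charFun m₁ (L ω * ξ) - charFun m₂ (L ω * ξ)) * charFun m₂ (R ω * ξ) := by ring
  have hb0 : 0 ≤ b := (norm_nonneg _).trans (hb 0)
  rw [e, two_mul]
  refine (norm_add_le _ _).trans (add_le_add ?_ ?_)
  · rw [norm_mul]
    simpa using mul_le_mul (norm_charFun_le_one (μ := m₁) (L ω * ξ)) (hb (R ω * ξ))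
      (norm_nonneg _) zero_le_one
  · rw [norm_mul]
    simpa using mul_le_mul (hb (L ω * ξ)) (norm_charFun_le_one (μ := m₂) (R ω * ξ))
      (norm_nonneg _) hb0

/-- Uniqueness for the kinetic Cauchy problem. -/
lemma IsSolution.unique (hL : Measurable L) (hR : Measurable R) {m : Measure ℝ}
    {μ μ' : ℝ → Measure ℝ} (h : IsSolution P L R m μ) (h' : IsSolution P L R m μ') {t : ℝ}
    (ht : 0 ≤ t) : μ t = μ' t := by
  -- Picard iteration: the right-hand side of the equation is Lipschitz with constant `2 + 1 = 3` in
  -- the uniform norm of characteristic functions, and two of these differ by at most `2`.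
  have key : ∀ n : ℕ, ∀ t : ℝ, 0 ≤ t → ∀ ξ,
      ‖charFun (μ t) ξ - charFun (μ' t) ξ‖ ≤ 2 * ((3 * t) ^ n / n.factorial) := by
    intro n
    induction n with
    | zero =>
      intro t ht ξ
      have := h.prob t ht
      have := h'.prob t ht
      refine (norm_sub_le _ _).trans ?_
      have h1 := norm_charFun_le_one (μ := μ t) ξ
      have h2 := norm_charFun_le_one (μ := μ' t) ξ
      simp
      linarith
    | succ n ih =>
      intro t ht ξ
      set B : ℝ → ℝ := fun t => 2 * ((3 * t) ^ (n + 1) / (n + 1).factorial) with hB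
      have hBd : ∀ s, HasDerivAt B (3 * (2 * ((3 * s) ^ n / n.factorial))) s := by
        intro s
        have h1 := ((((hasDerivAt_id s).const_mul 3).pow (n + 1)).div_const
          ((n + 1).factorial : ℝ)).const_mul 2
        refine h1.congr_deriv ?_
        rw [Nat.factorial_succ]
        push_cast
        field_simp
        simp
      have hd : ∀ s, 0 < s → HasDerivAt (fun s => charFun (μ s) ξ - charFun (μ' s) ξ)
          ((Qhat P L R (charFun (μ s)) (charFun (μ s)) ξ - charFun (μ s) ξ) -
            (Qhat P L R (charFun (μ' s)) (charFun (μ' s)) ξ - charFun (μ' s) ξ)) s :=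
        fun s hs => (h.deriv ξ s hs).sub (h'.deriv ξ s hs)
      have hbound : ∀ s, 0 < s →
          ‖((Qhat P L R (charFun (μ s)) (charFun (μ s)) ξ - charFun (μ s) ξ) -
            (Qhat P L R (charFun (μ' s)) (charFun (μ' s)) ξ - charFun (μ' s) ξ))‖ ≤
            3 * (2 * ((3 * s) ^ n / n.factorial)) := by
        intro s hs
        have := h.prob s hs.le
        have := h'.prob s hs.le
        have h1 := norm_Qhat_sub_Qhat_le (P := P) hL hR (μ s) (μ' s) (ih s hs.le) ξ
        have h2 := ih s hs.le ξ
        rw [sub_sub_sub_comm]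
        refine (norm_sub_le _ _).trans ?_
        linarith
      rcases ht.eq_or_lt with rfl | ht
      · rw [h.init, h'.init]
        simp
      -- The equation holds only at positive times, so the estimate is made on `[a, t]`; then `a`
      -- tends to `0` by continuity at the initial time.
      have hseg : ∀ a ∈ Ioo 0 t, ‖(charFun (μ t) ξ - charFun (μ' t) ξ) -
          (charFun (μ a) ξ - charFun (μ' a) ξ)‖ ≤ B t - B a := by
        intro a ha
        have := image_norm_le_of_norm_deriv_right_le_deriv_boundary' (a := a) (b := t)
          (f := fun s => (charFun (μ s) ξ - charFun (μ' s) ξ) -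
            (charFun (μ a) ξ - charFun (μ' a) ξ)) (B := fun s => B s - B a)
          (fun s hs => ((hd s (ha.1.trans_le hs.1)).sub_const _).continuousAt.continuousWithinAt)
          (fun s hs => ((hd s (ha.1.trans_le hs.1)).sub_const _).hasDerivWithinAt)
          (by simp) (fun s _ => ((hBd s).sub_const _).continuousAt.continuousWithinAt)
          (fun s _ => ((hBd s).sub_const _).hasDerivWithinAt)
          (fun s hs => hbound s (ha.1.trans_le hs.1))
        exact this ⟨ha.2.le, le_rfl⟩
      have hc : Tendsto (fun a => charFun (μ a) ξ - charFun (μ' a) ξ) (𝓝[>] 0) (𝓝 0) := by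
        have := Tendsto.mono_left ((h.cont ξ).sub (h'.cont ξ))
          (nhdsWithin_mono _ Ioi_subset_Ici_self)
        simp only [h.init, h'.init, Pi.sub_apply, sub_self] at this
        exact this
      have hl : Tendsto (fun a => ‖(charFun (μ t) ξ - charFun (μ' t) ξ) -
          (charFun (μ a) ξ - charFun (μ' a) ξ)‖) (𝓝[>] 0)
          (𝓝 ‖(charFun (μ t) ξ - charFun (μ' t) ξ) - 0‖) := (hc.const_sub _).norm
      have hr : Tendsto (fun a => B t - B a) (𝓝[>] 0) (𝓝 (B t - B 0)) :=
        ((hBd 0).continuousAt.tendsto.mono_left nhdsWithin_le_nhds).const_sub _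
      have := le_of_tendsto_of_tendsto hl hr
        (by filter_upwards [Ioo_mem_nhdsGT ht] with a ha using hseg a ha)
      simpa [hB] using this
  have := h.prob t ht
  have := h'.prob t ht
  refine Measure.ext_of_charFun (funext fun ξ => ?_)
  have hlim : Tendsto (fun n : ℕ => 2 * ((3 * t) ^ n / n.factorial)) atTop (𝓝 (2 * 0)) :=
    (FloorSemiring.tendsto_pow_div_factorial_atTop _).const_mul 2
  have h0 := ge_of_tendsto' hlim fun n => key n t ht ξ
  rw [mul_zero] at h0
  exact sub_eq_zero.mp (norm_le_zero_iff.mp h0)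

lemma IsSolution.eq_wildSum (hL : Measurable L) (hR : Measurable R) {m : Measure ℝ}
    [IsProbabilityMeasure m] {μ : ℝ → Measure ℝ} (h : IsSolution P L R m μ) {t : ℝ}
    (ht : 0 ≤ t) : μ t = wildSum P L R m t :=
  h.unique hL hR (isSolution_wildSum hL hR m) ht

end Solution

/-! ### Second order expansion of a power of a sum -/

section PowerInequality

/-- The convex power lies above its tangent at `v`, evaluated at `1`. The proof is Bernoulli's
inequality at `v⁻¹ - 1`, multiplied by `v ^ q`. -/
lemma rpow_le_one_add_mul_rpow_sub_one {q : ℝ} (hq : 1 < q) {v : ℝ} (hv : 0 ≤ v) :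
    v ^ q ≤ 1 + q * v ^ (q - 1) * (v - 1) := by
  rcases hv.eq_or_lt with rfl | hv
  · rw [Real.zero_rpow (by linarith), Real.zero_rpow (by linarith)]
    norm_num
  have h := one_add_mul_self_le_rpow_one_add (s := v⁻¹ - 1) (by
    have := inv_pos.mpr hv
    linarith) hq.le
  rw [add_sub_cancel, Real.inv_rpow hv.le] at h
  have hvq : 0 < v ^ q := Real.rpow_pos_of_pos hv q
  have h' := mul_le_mul_of_nonneg_left h hvq.le
  rw [mul_inv_cancel₀ hvq.ne'] at h'
  have e : v ^ q * (1 + q * (v⁻¹ - 1)) = v ^ q - q * v ^ (q - 1) * (v - 1) := by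
    rw [Real.rpow_sub_one hv.ne']
    field_simp
    ring
  linarith

/-- The tangent bound gives `1 + p (1 + u)^{p-1} u`, and it remains to compare `(1 + u)^{p-1}` with
`1`. For `u ≥ 0` the tangent bound with exponent `p - 1` does this, with `(1 + u)^{p-2} ≤ 2^{p-2}`.
For `u ≤ 0` Bernoulli's inequality, multiplied by `u`, suffices. -/
lemma abs_one_add_rpow_le {p : ℝ} (hp : 2 < p) {u : ℝ} (hu : |u| ≤ 1) :
    |1 + u| ^ p ≤ 1 + p * u + p * (p - 1) * 2 ^ (p - 2) * u ^ 2 := by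
  obtain ⟨h1, h2⟩ := abs_le.mp hu
  have hv : 0 ≤ 1 + u := by linarith
  rw [abs_of_nonneg hv]
  have hA := rpow_le_one_add_mul_rpow_sub_one (q := p) (by linarith) hv
  have hpow : (1 : ℝ) ≤ 2 ^ (p - 2) := Real.one_le_rpow one_le_two (by linarith)
  have hB : ((1 + u) ^ (p - 1) - 1) * u ≤ (p - 1) * 2 ^ (p - 2) * u ^ 2 := by
    rcases le_total 0 u with hu0 | hu0
    · have h3 := rpow_le_one_add_mul_rpow_sub_one (q := p - 1) (by linarith) hv
      have h4 : (1 + u) ^ (p - 1 - 1) ≤ 2 ^ (p - 2) := by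
        rw [show p - 1 - 1 = p - 2 by ring]
        exact Real.rpow_le_rpow hv (by linarith) (by linarith)
      have h5 : (1 + u) ^ (p - 1) - 1 ≤ (p - 1) * 2 ^ (p - 2) * u := by
        have : (p - 1) * (1 + u) ^ (p - 1 - 1) * (1 + u - 1) ≤ (p - 1) * 2 ^ (p - 2) * u := by
          rw [add_sub_cancel_left]
          gcongr
          linarith
        linarith
      nlinarith
    · have h3 := one_add_mul_self_le_rpow_one_add (s := u) h1 (p := p - 1) (by linarith)
      have h4 : ((1 + u) ^ (p - 1) - 1) * u ≤ (p - 1) * u ^ 2 := by nlinarith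
      refine h4.trans ?_
      have : 0 ≤ (p - 1) * u ^ 2 := mul_nonneg (by linarith) (sq_nonneg u)
      nlinarith
  rw [add_sub_cancel_left] at hA
  have hC := mul_le_mul_of_nonneg_left hB (show 0 ≤ p by linarith)
  nlinarith

lemma abs_rpow_eq_sq_mul {p : ℝ} (hp : 2 < p) (a : ℝ) : |a| ^ p = a ^ 2 * |a| ^ (p - 2) := by
  rcases eq_or_ne a 0 with rfl | ha
  · simp [Real.zero_rpow (show p ≠ 0 by linarith)]
  · rw [← sq_abs, ← Real.rpow_natCast |a| 2, ← Real.rpow_add (abs_pos.mpr ha)]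
    congr 1
    push_cast
    ring

lemma abs_mul_abs_rpow_le {p : ℝ} {a b : ℝ} (h : |b| ≤ |a|) :
    |b| ^ (p - 2) * |b| * |a| ≤ a ^ 2 * |b| ^ (p - 2) := by
  have : |b| * |a| ≤ a ^ 2 := by
    rw [← sq_abs a]
    nlinarith [abs_nonneg a]
  have h0 : 0 ≤ |b| ^ (p - 2) := by positivity
  nlinarith

/-- Second order expansion of `|a + b|^p`, symmetric in `a` and `b`. -/
lemma exists_abs_add_rpow_le {p : ℝ} (hp : 2 < p) : ∃ C : ℝ, 0 ≤ C ∧ ∀ a b : ℝ,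
    |a + b| ^ p ≤ |a| ^ p + |b| ^ p + p * (a * |a| ^ (p - 2)) * b + p * (b * |b| ^ (p - 2)) * a +
      C * (|a| ^ (p - 2) * b ^ 2 + a ^ 2 * |b| ^ (p - 2)) := by
  set K := p * (p - 1) * 2 ^ (p - 2) with hK
  have hK0 : 0 ≤ K := by
    have : 0 ≤ p - 1 := by linarith
    positivity
  -- By symmetry `|b| ≤ |a|`, and by homogeneity the expansion is applied to `u = b / a`. It lacks
  -- the term `p b |b|^{p-2} a`; adding that term costs at most `p a² |b|^{p-2}`, whence the
  -- constant `K + p`.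
  have main : ∀ a b : ℝ, |b| ≤ |a| → |a + b| ^ p ≤ |a| ^ p + |b| ^ p + p * (a * |a| ^ (p - 2)) * b +
      p * (b * |b| ^ (p - 2)) * a + (K + p) * (|a| ^ (p - 2) * b ^ 2 + a ^ 2 * |b| ^ (p - 2)) := by
    intro a b hab
    have h0 : 0 ≤ |b| ^ p := by positivity
    have h1 : |a + b| ^ p ≤ |a| ^ p + p * (a * |a| ^ (p - 2)) * b +
        K * (|a| ^ (p - 2) * b ^ 2) := by
      rcases eq_or_ne a 0 with rfl | ha
      · have hb : b = 0 := by simpa using hab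
        subst hb
        simp
      · have hu : |b / a| ≤ 1 := by
          rw [abs_div]
          exact div_le_one_of_le₀ hab (abs_nonneg a)
        have h := abs_one_add_rpow_le hp hu
        have e : |a + b| ^ p = |a| ^ p * |1 + b / a| ^ p := by
          rw [← Real.mul_rpow (abs_nonneg _) (abs_nonneg _), ← abs_mul, mul_add, mul_one,
            mul_div_cancel₀ _ ha]
        rw [e]
        refine (mul_le_mul_of_nonneg_left h (by positivity)).trans (le_of_eq ?_)
        rw [abs_rpow_eq_sq_mul hp a, hK]
        field_simp
    have h2 : -(p * (a ^ 2 * |b| ^ (p - 2))) ≤ p * (b * |b| ^ (p - 2)) * a := by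
      have h3 := abs_mul_abs_rpow_le (p := p) hab
      have h4 : -(|b| ^ (p - 2) * |b| * |a|) ≤ b * |b| ^ (p - 2) * a := by
        have := neg_abs_le (b * |b| ^ (p - 2) * a)
        rw [abs_mul, abs_mul, abs_of_nonneg (show 0 ≤ |b| ^ (p - 2) by positivity)] at this
        linarith
      have hp0 : 0 ≤ p := by linarith
      nlinarith
    have h5 : 0 ≤ K * (a ^ 2 * |b| ^ (p - 2)) := by positivity
    have h6 : 0 ≤ p * (|a| ^ (p - 2) * b ^ 2) := by
      have : 0 ≤ p := by linarith
      positivity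
    nlinarith
  refine ⟨K + p, by linarith, fun a b => ?_⟩
  rcases le_total |b| |a| with h | h
  · exact main a b h
  · have := main b a h
    rw [add_comm b a] at this
    linarith

end PowerInequality

/-! ### Linear recursions and their generating functions -/

section Recursion

/-- Concavity of `x ↦ x ^ κ` along a Wild series. -/
lemma tsum_wildWeight_rpow_le {t : ℝ} (ht : 0 ≤ t) {m : ℕ → ℝ} (hm0 : ∀ n, 0 ≤ m n) {B : ℝ}
    (hm : ∀ n, m n ≤ B) {κ : ℝ} (hκ0 : 0 ≤ κ) (hκ1 : κ ≤ 1)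
    (hpos : 0 < ∑' n, wildWeight t n * m n) :
    ∑' n, wildWeight t n * m n ^ κ ≤ (∑' n, wildWeight t n * m n) ^ κ := by
  set y := ∑' n, wildWeight t n * m n with hy
  have hs1 : Summable fun n => wildWeight t n * m n :=
    summable_wildWeight_mul ht (B := B) fun n => by rw [abs_of_nonneg (hm0 n)]; exact hm n
  have hs2 : Summable fun n => wildWeight t n * m n ^ κ :=
    summable_wildWeight_mul ht (B := B ^ κ) fun n => by
      rw [abs_of_nonneg (Real.rpow_nonneg (hm0 n) κ)]
      exact Real.rpow_le_rpow (hm0 n) (hm n) hκ0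
  -- Jensen's inequality by weighted arithmetic and geometric means: `m^κ y^{1-κ} ≤ κ m + (1 - κ)
  -- y`, averaged with weights of total mass one. Division by `y^{1-κ}` needs `y` positive.
  have h1 : (∑' n, wildWeight t n * m n ^ κ) * y ^ (1 - κ) ≤ y := by
    rw [← tsum_mul_right]
    calc ∑' n, wildWeight t n * m n ^ κ * y ^ (1 - κ)
        ≤ ∑' n, (κ * (wildWeight t n * m n) + wildWeight t n * ((1 - κ) * y)) := by
          refine Summable.tsum_le_tsum (fun n => ?_) (hs2.mul_right _)
            ((hs1.mul_left _).add ((hasSum_wildWeight ht).summable.mul_right _))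
          have := Real.geom_mean_le_arith_mean2_weighted hκ0 (by linarith : 0 ≤ 1 - κ) (hm0 n)
            hpos.le (by ring)
          have h := mul_le_mul_of_nonneg_left this (wildWeight_nonneg ht n)
          linarith
      _ = κ * y + (1 - κ) * y := by
          rw [Summable.tsum_add (hs1.mul_left _) ((hasSum_wildWeight ht).summable.mul_right _),
            tsum_mul_left, tsum_mul_right, (hasSum_wildWeight ht).tsum_eq, one_mul]
      _ = y := by ring
  have h2 : y ^ κ * y ^ (1 - κ) = y := by
    rw [← Real.rpow_add hpos, add_sub_cancel, Real.rpow_one]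
  rw [← h2] at h1
  refine le_of_mul_le_mul_right ?_ (Real.rpow_pos_of_pos hpos (1 - κ))
  simpa [h2] using h1

lemma tsum_wildWeight_antidiagonal_mul {u v : ℕ → ℝ} {B D : ℝ} (hu : ∀ n, |u n| ≤ B)
    (hv : ∀ n, |v n| ≤ D) {t : ℝ} (ht : 0 ≤ t) :
    Real.exp (-t) * ∑' n : ℕ, wildWeight t n *
        ∑ x ∈ Finset.HasAntidiagonal.antidiagonal n, u x.1 * v x.2 =
      (∑' n, wildWeight t n * u n) * ∑' n, wildWeight t n * v n := by
  simpa only [smul_eq_mul] using tsum_wildWeight_antidiagonal (A := ℝ) hu hv ht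

lemma summable_wildWeight_antidiagonal {u v : ℕ → ℝ} {B D : ℝ} (hu : ∀ n, |u n| ≤ B)
    (hv : ∀ n, |v n| ≤ D) {t : ℝ} (ht : 0 ≤ t) :
    Summable fun n : ℕ => wildWeight t n *
        ∑ x ∈ Finset.HasAntidiagonal.antidiagonal n, u x.1 * v x.2 := by
  have hB : 0 ≤ B := (abs_nonneg _).trans (hu 0)
  refine (summable_wildWeight_mul_succ ht (B := B * D) (c := fun n : ℕ => ((n : ℝ) + 1)⁻¹ *
    ∑ x ∈ Finset.HasAntidiagonal.antidiagonal n, u x.1 * v x.2) fun n => ?_).congr fun n => ?_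
  · rw [abs_mul, abs_of_nonneg (show (0 : ℝ) ≤ ((n : ℝ) + 1)⁻¹ by positivity),
      inv_mul_le_iff₀ (by positivity)]
    refine (Finset.abs_sum_le_sum_abs _ _).trans ?_
    refine (Finset.sum_le_sum fun x _ => (abs_mul _ _).trans_le
      (mul_le_mul (hu x.1) (hv x.2) (abs_nonneg _) hB)).trans ?_
    simp
  · rw [mul_inv_cancel_left₀ (by positivity)]

/-- The generating function of a sequence with a linear Wild recursion decays exponentially. -/
lemma tsum_wildWeight_le_exp {a : ℕ → ℝ} {l r : ℝ} {B : ℝ} (ha : ∀ n, |a n| ≤ B)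
    (hrec : ∀ n : ℕ, (n + 1) * a (n + 1) ≤ ∑ x ∈ Finset.HasAntidiagonal.antidiagonal n,
      (l * a x.1 + r * a x.2)) {t : ℝ} (ht : 0 ≤ t) :
    ∑' n, wildWeight t n * a n ≤ a 0 * Real.exp ((l + r - 1) * t) := by
  set A : ℝ → ℝ := fun s => ∑' n, wildWeight s n * a n with hA
  set A' : ℝ → ℝ := fun s => Real.exp (-s) * ∑' n : ℕ, wildWeight s n * ((n + 1) * a (n + 1)) -
    A s with hA'
  have hd : ∀ s, 0 ≤ s → HasDerivAt A (A' s) s := fun s hs =>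
    hasDerivAt_tsum_wildWeight ha hs
  have hbd : ∀ s, 0 ≤ s → A' s ≤ (l + r - 1) * A s := by
    intro s hs
    -- Pairing with the constant sequence `1`, whose Wild series is `1`, writes each linear sum as a
    -- Cauchy product.
    have h1 : ∀ n : ℕ, |(fun _ => (1 : ℝ)) n| ≤ 1 := fun n => by simp
    have hsum1 := summable_wildWeight_antidiagonal ha h1 hs
    have hsum2 := summable_wildWeight_antidiagonal h1 ha hs
    have hle : ∑' n : ℕ, wildWeight s n * ((n + 1) * a (n + 1)) ≤
        l * ∑' n : ℕ, wildWeight s n *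
          ∑ x ∈ Finset.HasAntidiagonal.antidiagonal n, a x.1 * 1 +
        r * ∑' n : ℕ, wildWeight s n *
          ∑ x ∈ Finset.HasAntidiagonal.antidiagonal n, 1 * a x.2 := by
      rw [← tsum_mul_left, ← tsum_mul_left,
        ← Summable.tsum_add (hsum1.mul_left _) (hsum2.mul_left _)]
      refine Summable.tsum_le_tsum (fun n => ?_)
        (summable_wildWeight_mul_succ hs fun n => ha (n + 1))
        ((hsum1.mul_left _).add (hsum2.mul_left _))
      refine (mul_le_mul_of_nonneg_left (hrec n) (wildWeight_nonneg hs n)).trans (le_of_eq ?_)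
      rw [Finset.sum_add_distrib, ← Finset.mul_sum, ← Finset.mul_sum]
      simp only [mul_one, one_mul]
      ring
    have e1 := tsum_wildWeight_antidiagonal_mul ha h1 hs
    have e2 := tsum_wildWeight_antidiagonal_mul h1 ha hs
    simp only [mul_one, (hasSum_wildWeight hs).tsum_eq] at e1
    simp only [mul_one, one_mul, (hasSum_wildWeight hs).tsum_eq] at e2
    have := mul_le_mul_of_nonneg_left hle (Real.exp_pos (-s)).le
    simp only [mul_one, one_mul] at this
    rw [mul_add, mul_left_comm _ l, mul_left_comm _ r, e1, e2] at this
    simp only [hA', hA]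
    linarith
  have hE : ∀ s, HasDerivAt (fun s => Real.exp (-((l + r - 1) * s)))
      (Real.exp (-((l + r - 1) * s)) * -((l + r - 1) * 1)) s := fun s =>
    (((hasDerivAt_id s).const_mul (l + r - 1)).neg).exp
  -- Grönwall's argument: after multiplication by the integrating factor the function is
  -- nonincreasing.
  have key := image_le_of_deriv_right_le_deriv_boundary (a := 0) (b := t)
    (f := fun s => A s * Real.exp (-((l + r - 1) * s)))
    (B := fun _ => a 0) (B' := fun _ => 0)
    (fun s hs => ((hd s hs.1).mul (hE s)).continuousAt.continuousWithinAt)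
    (fun s hs => ((hd s hs.1).mul (hE s)).hasDerivWithinAt)
    (by simp [hA, wildWeight_zero]) continuousOn_const
    (fun s _ => hasDerivWithinAt_const _ _ _)
    (fun s hs => by
      have h1 := mul_le_mul_of_nonneg_right (hbd s hs.1) (Real.exp_pos (-((l + r - 1) * s))).le
      linarith) ⟨ht, le_rfl⟩
  rw [Real.exp_neg, ← div_eq_mul_inv, div_le_iff₀ (Real.exp_pos _)] at key
  exact key

end Recursion

/-! ### Sublinear recursions, comparison and supersolutions -/

section Recursion

/-- Each of the `n + 1` summands is at most `a 0` by induction, since `l + r ≤ 1`. -/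
lemma le_of_linear_wild_recursion {a : ℕ → ℝ} {l r : ℝ} (hl : 0 ≤ l) (hr : 0 ≤ r)
    (hlr : l + r ≤ 1) (ha0 : ∀ n, 0 ≤ a n)
    (hrec : ∀ n : ℕ, (n + 1) * a (n + 1) ≤ ∑ x ∈ Finset.HasAntidiagonal.antidiagonal n,
      (l * a x.1 + r * a x.2)) (n : ℕ) : a n ≤ a 0 := by
  induction n using Nat.strong_induction_on with
  | _ n ih =>
    cases n with
    | zero => exact le_rfl
    | succ n =>
      have h1 : ∑ x ∈ Finset.HasAntidiagonal.antidiagonal n, (l * a x.1 + r * a x.2) ≤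
          ∑ x ∈ Finset.HasAntidiagonal.antidiagonal n, a 0 := by
        refine Finset.sum_le_sum fun x hx => ?_
        have hx' := Finset.HasAntidiagonal.mem_antidiagonal.mp hx
        have h1 := ih x.1 (by omega)
        have h2 := ih x.2 (by omega)
        have h3 := ha0 0
        nlinarith
      have h2 := (hrec n).trans h1
      simp only [Finset.sum_const, Finset.Nat.card_antidiagonal, nsmul_eq_mul] at h2
      push_cast at h2
      exact le_of_mul_le_mul_left h2 (by positivity)

/-- A crude uniform bound, needed only so that the series may be summed and differentiated. For
large `B` the sublinear term, of order `B ^ κ`, fits into the gap `(1 - (l + r)) B`, and the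
induction closes. -/
lemma exists_bound_of_sublinear_wild_recursion {m a : ℕ → ℝ} {l r C A κ : ℝ} (hl : 0 ≤ l)
    (hr : 0 ≤ r) (hlr : l + r < 1) (hC : 0 ≤ C) (hκ0 : 0 ≤ κ) (hκ1 : κ < 1)
    (hm0 : ∀ n, 0 ≤ m n) (ha0 : ∀ n, 0 ≤ a n) (haA : ∀ n, a n ≤ A)
    (hrec : ∀ n : ℕ, (n + 1) * m (n + 1) ≤ ∑ x ∈ Finset.HasAntidiagonal.antidiagonal n,
      (l * m x.1 + r * m x.2 + C * (m x.1 ^ κ * a x.2 + a x.1 * m x.2 ^ κ))) :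
    ∃ B, ∀ n, m n ≤ B := by
  have hA : 0 ≤ A := (ha0 0).trans (haA 0)
  obtain ⟨B, hB, hB1, hBm⟩ : ∃ B : ℝ, 2 * C * A / (1 - (l + r)) ≤ B ^ (1 - κ) ∧ 1 ≤ B ∧ m 0 ≤ B :=
    (((tendsto_rpow_atTop (by linarith : 0 < 1 - κ)).eventually_ge_atTop
      (2 * C * A / (1 - (l + r)))).and
      ((eventually_ge_atTop 1).and (eventually_ge_atTop (m 0)))).exists
  have hB0 : 0 < B := by linarith
  have hkey : 2 * C * A * B ^ κ ≤ (1 - (l + r)) * B := by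
    rw [div_le_iff₀ (by linarith)] at hB
    have h1 := mul_le_mul_of_nonneg_right hB (Real.rpow_nonneg hB0.le κ)
    have h2 : B ^ (1 - κ) * B ^ κ = B := by
      rw [← Real.rpow_add hB0, sub_add_cancel, Real.rpow_one]
    calc 2 * C * A * B ^ κ ≤ B ^ (1 - κ) * (1 - (l + r)) * B ^ κ := h1
      _ = (1 - (l + r)) * (B ^ (1 - κ) * B ^ κ) := by ring
      _ = _ := by rw [h2]
  refine ⟨B, fun n => ?_⟩
  induction n using Nat.strong_induction_on with
  | _ n ih =>
    cases n with
    | zero => exact hBm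
    | succ n =>
      have h1 : ∑ x ∈ Finset.HasAntidiagonal.antidiagonal n,
          (l * m x.1 + r * m x.2 + C * (m x.1 ^ κ * a x.2 + a x.1 * m x.2 ^ κ)) ≤
          ∑ x ∈ Finset.HasAntidiagonal.antidiagonal n, B := by
        refine Finset.sum_le_sum fun x hx => ?_
        have hx' := Finset.HasAntidiagonal.mem_antidiagonal.mp hx
        have h1 := ih x.1 (by omega)
        have h2 := ih x.2 (by omega)
        have h3 : m x.1 ^ κ * a x.2 ≤ B ^ κ * A :=
          mul_le_mul (Real.rpow_le_rpow (hm0 _) h1 hκ0) (haA _) (ha0 _) (by positivity)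
        have h4 : a x.1 * m x.2 ^ κ ≤ A * B ^ κ :=
          mul_le_mul (haA _) (Real.rpow_le_rpow (hm0 _) h2 hκ0) (Real.rpow_nonneg (hm0 _) _) hA
        have h5 := mul_le_mul_of_nonneg_left (add_le_add h3 h4) hC
        have h6 := mul_le_mul_of_nonneg_left h1 hl
        have h7 := mul_le_mul_of_nonneg_left h2 hr
        linarith
      have h2 := (hrec n).trans h1
      simp only [Finset.sum_const, Finset.Nat.card_antidiagonal, nsmul_eq_mul] at h2
      push_cast at h2
      exact le_of_mul_le_mul_left h2 (by positivity)

/-- Comparison principle for the generating function of a sequence with a sublinear Wild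
recursion. -/
lemma tsum_wildWeight_le_rpow {m a : ℕ → ℝ} {l r C k q c : ℝ} (hC : 0 ≤ C) (hq : 1 < q) (hk : k = (q - 1) / q)
    (hm0 : ∀ n, 0 ≤ m n) (ha0 : ∀ n, 0 ≤ a n) {B : ℝ} (hmB : ∀ n, m n ≤ B) {D : ℝ}
    (haD : ∀ n, a n ≤ D)
    (hrec : ∀ n : ℕ, (n + 1) * m (n + 1) ≤ ∑ x ∈ Finset.HasAntidiagonal.antidiagonal n,
      (l * m x.1 + r * m x.2 + C * (m x.1 ^ k * a x.2 + a x.1 * m x.2 ^ k)))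
    (hA : ∀ t, 0 ≤ t → ∑' n, wildWeight t n * a n ≤ a 0 * Real.exp (c * t))
    {w w' : ℝ → ℝ} (hw : ∀ t, HasDerivAt w (w' t) t) (hwpos : ∀ t, 0 ≤ t → 0 < w t)
    (hw0 : m 0 ≤ w 0 ^ q)
    (hww : ∀ t, 0 ≤ t → (l + r - 1) / q * w t + (2 * C * a 0 + 1) / q * Real.exp (c * t) ≤ w' t)
    {t : ℝ} (ht : 0 ≤ t) :
    ∑' n, wildWeight t n * m n ≤ w t ^ q := by
  have hq0 : 0 < q := by linarith
  have hk0 : 0 ≤ k := by rw [hk]; exact div_nonneg (by linarith) hq0.le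
  have hk1 : k ≤ 1 := by rw [hk, div_le_one hq0]; linarith
  have hm : ∀ n, |m n| ≤ B := fun n => by rw [abs_of_nonneg (hm0 n)]; exact hmB n
  have ha : ∀ n, |a n| ≤ D := fun n => by rw [abs_of_nonneg (ha0 n)]; exact haD n
  have hg : ∀ n, |(fun n => m n ^ k) n| ≤ B ^ k := fun n => by
    rw [abs_of_nonneg (Real.rpow_nonneg (hm0 n) k)]
    exact Real.rpow_le_rpow (hm0 n) (hmB n) hk0
  have h1 : ∀ n : ℕ, |(fun _ => (1 : ℝ)) n| ≤ 1 := fun n => by simp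
  set f : ℝ → ℝ := fun s => ∑' n, wildWeight s n * m n with hf
  set f' : ℝ → ℝ := fun s => Real.exp (-s) * ∑' n : ℕ, wildWeight s n * ((n + 1) * m (n + 1)) -
    f s with hf'
  have hd : ∀ s, 0 ≤ s → HasDerivAt f (f' s) s := fun s hs => hasDerivAt_tsum_wildWeight hm hs
  have hbd : ∀ s, 0 ≤ s → 0 < f s →
      f' s ≤ (l + r - 1) * f s + 2 * C * (a 0 * Real.exp (c * s)) * f s ^ k := by
    intro s hs hfs
    have s1 := summable_wildWeight_antidiagonal hm h1 hs
    have s2 := summable_wildWeight_antidiagonal h1 hm hs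
    have s3 := summable_wildWeight_antidiagonal hg ha hs
    have s4 := summable_wildWeight_antidiagonal ha hg hs
    have hle : ∑' n : ℕ, wildWeight s n * ((n + 1) * m (n + 1)) ≤
        l * ∑' n : ℕ, wildWeight s n *
          ∑ x ∈ Finset.HasAntidiagonal.antidiagonal n, m x.1 * 1 +
        r * ∑' n : ℕ, wildWeight s n *
          ∑ x ∈ Finset.HasAntidiagonal.antidiagonal n, 1 * m x.2 +
        (C * ∑' n : ℕ, wildWeight s n *
          ∑ x ∈ Finset.HasAntidiagonal.antidiagonal n, m x.1 ^ k * a x.2 +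
        C * ∑' n : ℕ, wildWeight s n *
          ∑ x ∈ Finset.HasAntidiagonal.antidiagonal n, a x.1 * m x.2 ^ k) := by
      rw [← tsum_mul_left, ← tsum_mul_left, ← tsum_mul_left, ← tsum_mul_left,
        ← Summable.tsum_add (s1.mul_left _) (s2.mul_left _),
        ← Summable.tsum_add (s3.mul_left _) (s4.mul_left _),
        ← Summable.tsum_add ((s1.mul_left _).add (s2.mul_left _))
          ((s3.mul_left _).add (s4.mul_left _))]
      refine Summable.tsum_le_tsum (fun n => ?_)
        (summable_wildWeight_mul_succ hs fun n => hm (n + 1))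
        (((s1.mul_left _).add (s2.mul_left _)).add ((s3.mul_left _).add (s4.mul_left _)))
      refine (mul_le_mul_of_nonneg_left (hrec n) (wildWeight_nonneg hs n)).trans (le_of_eq ?_)
      simp only [mul_add, mul_one, one_mul, Finset.sum_add_distrib, ← Finset.mul_sum]
      ring
    have e1 := tsum_wildWeight_antidiagonal_mul hm h1 hs
    have e2 := tsum_wildWeight_antidiagonal_mul h1 hm hs
    have e3 := tsum_wildWeight_antidiagonal_mul hg ha hs
    have e4 := tsum_wildWeight_antidiagonal_mul ha hg hs
    simp only [mul_one, (hasSum_wildWeight hs).tsum_eq] at e1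
    simp only [mul_one, one_mul, (hasSum_wildWeight hs).tsum_eq] at e2
    have := mul_le_mul_of_nonneg_left hle (Real.exp_pos (-s)).le
    simp only [mul_one, one_mul] at this
    rw [mul_add, mul_add, mul_add, mul_left_comm _ l, mul_left_comm _ r, mul_left_comm _ C,
      mul_left_comm _ C, e1, e2, e3, e4] at this
    have hG := tsum_wildWeight_rpow_le hs hm0 hmB hk0 hk1 hfs
    have hG0 : 0 ≤ ∑' n, wildWeight s n * m n ^ k :=
      tsum_nonneg fun n => mul_nonneg (wildWeight_nonneg hs n) (Real.rpow_nonneg (hm0 n) k)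
    have hGA := mul_le_mul_of_nonneg_left
      (mul_le_mul (hA s hs) hG hG0 (mul_nonneg (ha0 0) (Real.exp_pos _).le)) hC
    simp only [hf', hf]
    linarith
  have hwq : ∀ s, 0 ≤ s → HasDerivAt (fun s => w s ^ q) (w' s * q * w s ^ (q - 1)) s :=
    fun s hs => (hw s).rpow_const (Or.inl (hwpos s hs).ne')
  -- The derivatives need comparing only at contact times, where `f = w^q`. There `f` is positive,
  -- so concavity applies, and `f^k = w^{q-1}` factors out of both sides.
  refine image_le_of_deriv_right_lt_deriv_boundary' (a := 0) (b := t) (f := f)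
    (B := fun s => w s ^ q)
    (fun s hs => (hd s hs.1).continuousAt.continuousWithinAt)
    (fun s hs => (hd s hs.1).hasDerivWithinAt)
    ?_ (fun s hs => (hwq s hs.1).continuousAt.continuousWithinAt)
    (fun s hs => (hwq s hs.1).hasDerivWithinAt) (fun s hs heq => ?_) ⟨ht, le_rfl⟩
  · have : f 0 = m 0 := by
      simp [hf, wildWeight_zero]
    rw [this]
    exact hw0
  · have hws := hwpos s hs.1
    have hfs : 0 < f s := by
      rw [heq]
      exact Real.rpow_pos_of_pos hws q
    have h2 := hbd s hs.1 hfs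
    have hfk : f s ^ k = w s ^ (q - 1) := by
      rw [heq, ← Real.rpow_mul hws.le, hk, mul_div_cancel₀ _ hq0.ne']
    have hfw : f s = w s * w s ^ (q - 1) := by
      rw [heq, Real.rpow_sub_one hws.ne', mul_div_cancel₀ _ hws.ne']
    have h3 := mul_le_mul_of_nonneg_left (hww s hs.1) hq0.le
    have hx : q * ((l + r - 1) / q * w s + (2 * C * a 0 + 1) / q * Real.exp (c * s)) =
        (l + r - 1) * w s + (2 * C * a 0 + 1) * Real.exp (c * s) := by
      field_simp
    rw [hx] at h3
    have hwp : 0 < w s ^ (q - 1) := Real.rpow_pos_of_pos hws _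
    have h4 := mul_le_mul_of_nonneg_right h3 hwp.le
    -- The extra `1` in the source coefficient makes the comparison strict.
    have h5 : 0 < Real.exp (c * s) * w s ^ (q - 1) := mul_pos (Real.exp_pos _) hwp
    rw [hfk, hfw] at h2
    refine h2.trans_lt ?_
    linarith

/-- Explicit supersolutions of `w' = b w + D e^{c t}` with the expected growth. -/
lemma exists_supersolution_of_ne {b c D M : ℝ} (hD : 0 ≤ D) (hM : 0 < M) (hbc : b ≠ c) :
    ∃ (w w' : ℝ → ℝ) (K : ℝ), 0 ≤ K ∧ (∀ t, HasDerivAt w (w' t) t) ∧ (∀ t, 0 ≤ t → 0 < w t) ∧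
      M ≤ w 0 ∧ (∀ t, 0 ≤ t → b * w t + D * Real.exp (c * t) ≤ w' t) ∧
      ∀ t, 0 ≤ t → w t ≤ K * Real.exp (max b c * t) := by
  have hexp : ∀ d t : ℝ, HasDerivAt (fun t => Real.exp (d * t)) (Real.exp (d * t) * (d * 1)) t :=
    fun d t => ((hasDerivAt_id t).const_mul d).exp
  rcases lt_or_gt_of_ne hbc with h | h
  · have hdc : 0 < c - b := by linarith
    -- The source dominates: `K e^{ct}` is a supersolution once `(c - b) K ≥ D`.
    set K := M + D / (c - b) with hK
    have hKD : D ≤ (c - b) * K := by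
      rw [hK, mul_add, mul_div_cancel₀ _ hdc.ne']
      nlinarith
    have hK0 : 0 < K := by positivity
    refine ⟨fun t => K * Real.exp (c * t), _, K, hK0.le, fun t => (hexp c t).const_mul K,
      fun t _ => by positivity, ?_, fun t _ => ?_, fun t _ => ?_⟩
    · simp only [mul_zero, Real.exp_zero, mul_one]
      have : 0 ≤ D / (c - b) := by positivity
      linarith
    · have := mul_le_mul_of_nonneg_right hKD (Real.exp_pos (c * t)).le
      linarith
    · rw [max_eq_right h.le]
  · have hdc : 0 < b - c := by linarith
    -- The homogeneous solution dominates: `w' - b w = K (b - c) e^{ct}` for `w = K (2 e^{bt} -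
    -- e^{ct})`. The factor `2` keeps `w` positive and makes `w 0 = K`.
    set K := M + D / (b - c) with hK
    have hKD : D ≤ (b - c) * K := by
      rw [hK, mul_add, mul_div_cancel₀ _ hdc.ne']
      nlinarith
    have hK0 : 0 < K := by positivity
    refine ⟨fun t => K * (2 * Real.exp (b * t) - Real.exp (c * t)), _, 2 * K, by positivity,
      fun t => (((hexp b t).const_mul 2).sub (hexp c t)).const_mul K,
      fun t ht => ?_, ?_, fun t _ => ?_, fun t _ => ?_⟩
    · have h1 : Real.exp (c * t) ≤ Real.exp (b * t) :=
        Real.exp_le_exp.mpr (mul_le_mul_of_nonneg_right h.le ht)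
      have h2 := Real.exp_pos (b * t)
      exact mul_pos hK0 (by linarith)
    · simp only [mul_zero, Real.exp_zero, mul_one]
      have : 0 ≤ D / (b - c) := by positivity
      linarith
    · have := mul_le_mul_of_nonneg_right hKD (Real.exp_pos (c * t)).le
      linarith
    · rw [max_eq_left h.le]
      have := mul_pos hK0 (Real.exp_pos (c * t))
      linarith

/-- Resonance: `(M + D t) e^{bt}` solves the equation exactly, which is the origin of the factor
`max 1 t`. -/
lemma exists_supersolution_of_eq {b D M : ℝ} (hD : 0 ≤ D) (hM : 0 < M) :
    ∃ (w w' : ℝ → ℝ) (K : ℝ), 0 ≤ K ∧ (∀ t, HasDerivAt w (w' t) t) ∧ (∀ t, 0 ≤ t → 0 < w t) ∧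
      M ≤ w 0 ∧ (∀ t, 0 ≤ t → b * w t + D * Real.exp (b * t) ≤ w' t) ∧
      ∀ t, 0 ≤ t → w t ≤ K * max 1 t * Real.exp (b * t) := by
  have hexp : ∀ d t : ℝ, HasDerivAt (fun t => Real.exp (d * t)) (Real.exp (d * t) * (d * 1)) t :=
    fun d t => ((hasDerivAt_id t).const_mul d).exp
  refine ⟨fun t => (M + D * t) * Real.exp (b * t), _, M + D, by positivity,
    fun t => (((hasDerivAt_id t).const_mul D).const_add M).mul (hexp b t),
    fun t ht => by positivity, by simp, fun t _ => ?_, fun t ht => ?_⟩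
  · simp only [id]
    linarith
  · refine mul_le_mul_of_nonneg_right ?_ (Real.exp_pos _).le
    have h1 := mul_le_mul_of_nonneg_left (le_max_left 1 t) hM.le
    have h2 := mul_le_mul_of_nonneg_left (le_max_right 1 t) hD
    linarith

end Recursion

/-! ### Moments of one collision between centered laws -/

section Moments

lemma rpow_le_one_add_rpow {x q p : ℝ} (hx : 0 ≤ x) (hq : 0 ≤ q) (hqp : q ≤ p) :
    x ^ q ≤ 1 + x ^ p := by
  have hxp : 0 ≤ x ^ p := Real.rpow_nonneg hx p
  rcases le_total x 1 with h | h
  · have := Real.rpow_le_one hx h hq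
    linarith
  · have := Real.rpow_le_rpow_of_exponent_le h hqp
    linarith

lemma rpow_mul_rpow_le {x y r s : ℝ} (hx : 0 ≤ x) (hy : 0 ≤ y) (hr : 0 < r) (hs : 0 < s) :
    x ^ r * y ^ s ≤ x ^ (r + s) + y ^ (r + s) := by
  have hrs : r + s ≠ 0 := by positivity
  have hx' : 0 ≤ x ^ (r + s) := Real.rpow_nonneg hx _
  have hy' : 0 ≤ y ^ (r + s) := Real.rpow_nonneg hy _
  rcases le_total x y with h | h
  · calc x ^ r * y ^ s ≤ y ^ r * y ^ s := by gcongr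
      _ = y ^ (r + s) := (Real.rpow_add' hy hrs).symm
      _ ≤ _ := by linarith
  · calc x ^ r * y ^ s ≤ x ^ r * x ^ s := by gcongr
      _ = x ^ (r + s) := (Real.rpow_add' hx hrs).symm
      _ ≤ _ := by linarith

lemma integrable_abs_rpow {α : Type*} [MeasurableSpace α] {m : Measure α} [IsFiniteMeasure m]
    {f : α → ℝ} (hf : Measurable f) {p q : ℝ} (h : Integrable (fun x => |f x| ^ p) m) (hq : 0 ≤ q)
    (hqp : q ≤ p) : Integrable (fun x => |f x| ^ q) m := by
  refine ((integrable_const 1).add h).mono' (by fun_prop) (ae_of_all _ fun x => ?_)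
  rw [Real.norm_of_nonneg (by positivity)]
  exact rpow_le_one_add_rpow (abs_nonneg _) hq hqp

lemma integrable_abs_rpow_mul {α : Type*} [MeasurableSpace α] {m : Measure α} {f g : α → ℝ}
    (hf : Measurable f) (hg : Measurable g) {p r s : ℝ} (hfp : Integrable (fun x => |f x| ^ p) m)
    (hgp : Integrable (fun x => |g x| ^ p) m) (hr : 0 < r) (hs : 0 < s) (hrs : r + s = p) :
    Integrable (fun x => |f x| ^ r * |g x| ^ s) m := by
  refine (hfp.add hgp).mono' (by fun_prop) (ae_of_all _ fun x => ?_)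
  rw [Real.norm_of_nonneg (by positivity), ← hrs]
  exact rpow_mul_rpow_le (abs_nonneg _) (abs_nonneg _) hr hs

/-- Centered probability measures on `ℝ` with finite `p`-th absolute moment. -/
structure IsCenteredWithMoment (p : ℝ) (m : Measure ℝ) : Prop where
  prob : IsProbabilityMeasure m
  integrable_rpow : Integrable (fun x : ℝ => |x| ^ p) m
  mean : ∫ x, x ∂m = 0

namespace IsCenteredWithMoment

variable {p : ℝ} {m : Measure ℝ}

lemma integrable_rpow_of_le (h : IsCenteredWithMoment p m) {q : ℝ} (hq : 0 ≤ q) (hqp : q ≤ p) :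
    Integrable (fun x : ℝ => |x| ^ q) m :=
  have := h.prob
  integrable_abs_rpow measurable_id h.integrable_rpow hq hqp

lemma integrable_id (h : IsCenteredWithMoment p m) (hp : 2 < p) : Integrable (fun x : ℝ => x) m :=
  (h.integrable_rpow_of_le zero_le_one (by linarith)).mono' (by fun_prop)
    (ae_of_all _ fun x => by simp)

lemma integrable_sq (h : IsCenteredWithMoment p m) (hp : 2 < p) :
    Integrable (fun x : ℝ => x ^ 2) m :=
  (h.integrable_rpow_of_le zero_le_two hp.le).congr (ae_of_all _ fun x => by simp)

lemma integrable_mul_rpow (h : IsCenteredWithMoment p m) (hp : 2 < p) :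
    Integrable (fun x : ℝ => x * |x| ^ (p - 2)) m := by
  refine (h.integrable_rpow_of_le (q := p - 1) (by linarith) (by linarith)).mono' (by fun_prop)
    (ae_of_all _ fun x => ?_)
  rw [norm_mul, Real.norm_eq_abs, Real.norm_of_nonneg (by positivity),
    show p - 1 = 1 + (p - 2) by ring, Real.rpow_add' (abs_nonneg x) (by linarith), Real.rpow_one]

/-- Jensen's inequality for the concave power `(p - 2) / p`. It closes the moment inequality in
terms of the `p`-th and second moments alone. -/
lemma integral_rpow_sub_two_le (h : IsCenteredWithMoment p m) (hp : 2 < p) :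
    ∫ x, |x| ^ (p - 2) ∂m ≤ (∫ x, |x| ^ p ∂m) ^ ((p - 2) / p) := by
  have := h.prob
  have hp0 : 0 < p := by linarith
  have hk0 : 0 ≤ (p - 2) / p := div_nonneg (by linarith) hp0.le
  have hk1 : (p - 2) / p ≤ 1 := by rw [div_le_one hp0]; linarith
  have e : ∀ x : ℝ, (|x| ^ p) ^ ((p - 2) / p) = |x| ^ (p - 2) := fun x => by
    rw [← Real.rpow_mul (abs_nonneg x), mul_div_cancel₀ _ hp0.ne']
  have := (Real.concaveOn_rpow hk0 hk1).le_map_integral (μ := m) (f := fun x : ℝ => |x| ^ p)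
    (continuousOn_id.rpow_const fun _ _ => Or.inr hk0) isClosed_Ici
    (ae_of_all _ fun x => by simp only [mem_Ici]; positivity) h.integrable_rpow
    (by simpa only [Function.comp_def, e] using
      h.integrable_rpow_of_le (by linarith) (by linarith))
  simpa only [e] using this

end IsCenteredWithMoment

section CollideMoments

variable {Ω : Type*} [MeasurableSpace Ω] {P : Measure Ω} [IsProbabilityMeasure P] {L R : Ω → ℝ}
  {p : ℝ} {m₁ m₂ : Measure ℝ}

lemma integrable_prod_triple [SFinite m₁] [SFinite m₂] {f : Ω → ℝ} {g h : ℝ → ℝ}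
    (hf : Integrable f P) (hg : Integrable g m₁) (hh : Integrable h m₂) :
    Integrable (fun z : Ω × ℝ × ℝ => f z.1 * (g z.2.1 * h z.2.2)) (P.prod (m₁.prod m₂)) :=
  hf.mul_prod (hg.mul_prod hh)

lemma integral_prod_triple [SFinite m₁] [SFinite m₂] (f : Ω → ℝ) (g h : ℝ → ℝ) :
    ∫ z : Ω × ℝ × ℝ, f z.1 * (g z.2.1 * h z.2.2) ∂(P.prod (m₁.prod m₂)) =
      (∫ ω, f ω ∂P) * ((∫ x, g x ∂m₁) * ∫ x, h x ∂m₂) := by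
  rw [integral_prod_mul f fun y : ℝ × ℝ => g y.1 * h y.2, integral_prod_mul]

lemma integral_collide (hL : Measurable L) (hR : Measurable R) {f : ℝ → ℝ} (hf : Measurable f) :
    ∫ x, f x ∂collide P L R m₁ m₂ =
      ∫ z : Ω × ℝ × ℝ, f (L z.1 * z.2.1 + R z.1 * z.2.2) ∂(P.prod (m₁.prod m₂)) := by
  rw [collide, integral_map (measurable_collide_map hL hR).aemeasurable hf.aestronglyMeasurable]
  rfl

lemma integrable_collide (hL : Measurable L) (hR : Measurable R) {f : ℝ → ℝ} (hf : Measurable f)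
    (h : Integrable (fun z : Ω × ℝ × ℝ => f (L z.1 * z.2.1 + R z.1 * z.2.2))
      (P.prod (m₁.prod m₂))) : Integrable f (collide P L R m₁ m₂) := by
  rw [collide, integrable_map_measure hf.aestronglyMeasurable
    (measurable_collide_map hL hR).aemeasurable]
  exact h

lemma IsCenteredWithMoment.collide_mean
    (hp : 2 < p) (hL : Measurable L) (hR : Measurable R)
    (hLp : Integrable (fun ω => |L ω| ^ p) P) (hRp : Integrable (fun ω => |R ω| ^ p) P)
    (h₁ : IsCenteredWithMoment p m₁) (h₂ : IsCenteredWithMoment p m₂) : ∫ x, x ∂collide P L R m₁ m₂ = 0 := by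
  have := h₁.prob
  have := h₂.prob
  have hL1 : Integrable L P := (integrable_norm_iff hL.aestronglyMeasurable).mp
    ((integrable_abs_rpow hL hLp zero_le_one (by linarith)).congr (ae_of_all _ fun x => by simp))
  have hR1 : Integrable R P := (integrable_norm_iff hR.aestronglyMeasurable).mp
    ((integrable_abs_rpow hR hRp zero_le_one (by linarith)).congr (ae_of_all _ fun x => by simp))
  have i1 := integrable_prod_triple hL1 (h₁.integrable_id hp) (integrable_const (μ := m₂) (1 : ℝ))
  have i2 := integrable_prod_triple hR1 (integrable_const (μ := m₁) (1 : ℝ)) (h₂.integrable_id hp)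
  have e1 := integral_prod_triple (P := P) (m₁ := m₁) (m₂ := m₂) L (fun x => x) (fun _ => 1)
  have e2 := integral_prod_triple (P := P) (m₁ := m₁) (m₂ := m₂) R (fun _ => 1) (fun x => x)
  simp only [mul_one, one_mul] at i1 i2 e1 e2
  rw [integral_collide hL hR measurable_id', integral_add i1 i2, e1, e2, h₁.mean, h₂.mean]
  simp

/-- The cross term is a multiple of the product of the two means, hence zero. -/
lemma IsCenteredWithMoment.collide_sq
    (hp : 2 < p) (hL : Measurable L) (hR : Measurable R)
    (hLp : Integrable (fun ω => |L ω| ^ p) P) (hRp : Integrable (fun ω => |R ω| ^ p) P)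
    (h₁ : IsCenteredWithMoment p m₁) (h₂ : IsCenteredWithMoment p m₂) : ∫ x, x ^ 2 ∂collide P L R m₁ m₂ =
    (∫ ω, L ω ^ 2 ∂P) * ∫ x, x ^ 2 ∂m₁ + (∫ ω, R ω ^ 2 ∂P) * ∫ x, x ^ 2 ∂m₂ := by
  have := h₁.prob
  have := h₂.prob
  have hL2 : Integrable (fun ω => L ω ^ 2) P :=
    (integrable_abs_rpow hL hLp zero_le_two hp.le).congr (ae_of_all _ fun x => by simp)
  have hR2 : Integrable (fun ω => R ω ^ 2) P :=
    (integrable_abs_rpow hR hRp zero_le_two hp.le).congr (ae_of_all _ fun x => by simp)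
  have hLR : Integrable (fun ω => 2 * (L ω * R ω)) P := by
    refine (hL2.add hR2).mono' (by fun_prop) (ae_of_all _ fun x => ?_)
    rw [Real.norm_eq_abs, abs_le, Pi.add_apply]
    constructor <;> nlinarith [sq_nonneg (L x + R x), sq_nonneg (L x - R x)]
  have i1 := integrable_prod_triple hL2 (h₁.integrable_sq hp) (integrable_const (μ := m₂) (1 : ℝ))
  have i2 := integrable_prod_triple hR2 (integrable_const (μ := m₁) (1 : ℝ)) (h₂.integrable_sq hp)
  have i3 := integrable_prod_triple hLR (h₁.integrable_id hp) (h₂.integrable_id hp)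
  have e1 := integral_prod_triple (P := P) (m₁ := m₁) (m₂ := m₂) (fun ω => L ω ^ 2)
    (fun x => x ^ 2) (fun _ => 1)
  have e2 := integral_prod_triple (P := P) (m₁ := m₁) (m₂ := m₂) (fun ω => R ω ^ 2)
    (fun _ => 1) (fun x => x ^ 2)
  have e3 := integral_prod_triple (P := P) (m₁ := m₁) (m₂ := m₂) (fun ω => 2 * (L ω * R ω))
    (fun x => x) (fun x => x)
  simp only [mul_one, one_mul] at i1 i2 e1 e2
  have e : ∀ z : Ω × ℝ × ℝ, (L z.1 * z.2.1 + R z.1 * z.2.2) ^ 2 =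
      L z.1 ^ 2 * z.2.1 ^ 2 + R z.1 ^ 2 * z.2.2 ^ 2 + 2 * (L z.1 * R z.1) * (z.2.1 * z.2.2) :=
    fun z => by ring
  rw [integral_collide hL hR (by fun_prop)]
  simp only [e]
  rw [integral_add (f := fun z : Ω × ℝ × ℝ => L z.1 ^ 2 * z.2.1 ^ 2 + R z.1 ^ 2 * z.2.2 ^ 2)
    (i1.add i2) i3, integral_add i1 i2, e1, e2, e3, h₁.mean]
  simp

/-- Each term of the expansion at `a = L x`, `b = R y` is a function of `(L, R)` times a function of
`x` times a function of `y`. The two odd terms carry the mean of one of the laws and vanish;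
Jensen's inequality bounds the moments of order `p - 2` in the remainder. Independence of `L` and
`R` plays no role: their mixed moments are bounded by `E|L|^p + E|R|^p`. -/
lemma IsCenteredWithMoment.collide_rpow
    (hp : 2 < p) (hL : Measurable L) (hR : Measurable R)
    (hLp : Integrable (fun ω => |L ω| ^ p) P) (hRp : Integrable (fun ω => |R ω| ^ p) P)
    (h₁ : IsCenteredWithMoment p m₁) (h₂ : IsCenteredWithMoment p m₂)
    {C : ℝ} (hC : 0 ≤ C) (hCab : ∀ a b : ℝ, |a + b| ^ p ≤
      |a| ^ p + |b| ^ p + p * (a * |a| ^ (p - 2)) * b + p * (b * |b| ^ (p - 2)) * a +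
      C * (|a| ^ (p - 2) * b ^ 2 + a ^ 2 * |b| ^ (p - 2))) :
    Integrable (fun x : ℝ => |x| ^ p) (collide P L R m₁ m₂) ∧
    ∫ x, |x| ^ p ∂collide P L R m₁ m₂ ≤
      (∫ ω, |L ω| ^ p ∂P) * ∫ x, |x| ^ p ∂m₁ + (∫ ω, |R ω| ^ p ∂P) * ∫ x, |x| ^ p ∂m₂ +
      C * (∫ ω, |L ω| ^ p ∂P + ∫ ω, |R ω| ^ p ∂P) *
        ((∫ x, |x| ^ p ∂m₁) ^ ((p - 2) / p) * ∫ x, x ^ 2 ∂m₂ +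
          (∫ x, x ^ 2 ∂m₁) * (∫ x, |x| ^ p ∂m₂) ^ ((p - 2) / p)) := by
  have := h₁.prob
  have := h₂.prob
  have hp2 : 0 < p - 2 := by linarith
  -- Integrability of the odd coefficients, required before the odd terms can be integrated to zero.
  have sgn : ∀ {f g : Ω → ℝ}, Measurable f → Measurable g → Integrable (fun ω => |f ω| ^ p) P →
      Integrable (fun ω => |g ω| ^ p) P →
      Integrable (fun ω => p * (f ω * |f ω| ^ (p - 2)) * g ω) P := by
    intro f g hf hg hfp hgp
    refine ((integrable_abs_rpow_mul hf hg hfp hgp (r := p - 1) (s := 1) (by linarith)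
      one_pos (by ring)).const_mul p).mono' (by fun_prop) (ae_of_all _ fun ω => ?_)
    rw [norm_mul, norm_mul, norm_mul, Real.norm_of_nonneg (show 0 ≤ p by linarith),
      Real.norm_of_nonneg (show 0 ≤ |f ω| ^ (p - 2) by positivity), Real.norm_eq_abs,
      Real.norm_eq_abs, Real.rpow_one, show p - 1 = 1 + (p - 2) by ring,
      Real.rpow_add' (abs_nonneg _) (by linarith), Real.rpow_one, mul_assoc]
  have mix : ∀ {f g : Ω → ℝ}, Measurable f → Measurable g → Integrable (fun ω => |f ω| ^ p) P →
      Integrable (fun ω => |g ω| ^ p) P →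
      Integrable (fun ω => |f ω| ^ (p - 2) * g ω ^ 2) P ∧
      ∫ ω, |f ω| ^ (p - 2) * g ω ^ 2 ∂P ≤ ∫ ω, |f ω| ^ p ∂P + ∫ ω, |g ω| ^ p ∂P := by
    intro f g hf hg hfp hgp
    have i : Integrable (fun ω => |f ω| ^ (p - 2) * g ω ^ 2) P :=
      (integrable_abs_rpow_mul hf hg hfp hgp hp2 two_pos (by ring)).congr
        (ae_of_all _ fun ω => by simp)
    refine ⟨i, ?_⟩
    rw [← integral_add hfp hgp]
    refine integral_mono i (hfp.add hgp) fun ω => ?_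
    have := rpow_mul_rpow_le (abs_nonneg (f ω)) (abs_nonneg (g ω)) hp2 two_pos
    simpa using this
  obtain ⟨jLR, bLR⟩ := mix hL hR hLp hRp
  obtain ⟨jRL, bRL⟩ := mix hR hL hRp hLp
  have c1 : ∀ (m : Measure ℝ) [IsProbabilityMeasure m], Integrable (fun _ : ℝ => (1 : ℝ)) m :=
    fun m _ => integrable_const 1
  have q₁ := h₁.integrable_rpow_of_le (q := p - 2) hp2.le (by linarith)
  have q₂ := h₂.integrable_rpow_of_le (q := p - 2) hp2.le (by linarith)
  have i1 := integrable_prod_triple hLp h₁.integrable_rpow (c1 m₂)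
  have i2 := integrable_prod_triple hRp (c1 m₁) h₂.integrable_rpow
  have i3 := integrable_prod_triple (sgn hL hR hLp hRp) (h₁.integrable_mul_rpow hp)
    (h₂.integrable_id hp)
  have i4 := integrable_prod_triple (sgn hR hL hRp hLp) (h₁.integrable_id hp)
    (h₂.integrable_mul_rpow hp)
  have i5 := integrable_prod_triple (jLR.const_mul C) q₁ (h₂.integrable_sq hp)
  have i6 := integrable_prod_triple (jRL.const_mul C) (h₁.integrable_sq hp) q₂
  have I := (((i1.add i2).add (i3.add i4)).add (i5.add i6))
  have hle : ∀ z : Ω × ℝ × ℝ, |L z.1 * z.2.1 + R z.1 * z.2.2| ^ p ≤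
      |L z.1| ^ p * (|z.2.1| ^ p * 1) + |R z.1| ^ p * (1 * |z.2.2| ^ p) +
      (p * (L z.1 * |L z.1| ^ (p - 2)) * R z.1 * (z.2.1 * |z.2.1| ^ (p - 2) * z.2.2) +
        p * (R z.1 * |R z.1| ^ (p - 2)) * L z.1 * (z.2.1 * (z.2.2 * |z.2.2| ^ (p - 2)))) +
      (C * (|L z.1| ^ (p - 2) * R z.1 ^ 2) * (|z.2.1| ^ (p - 2) * z.2.2 ^ 2) +
        C * (|R z.1| ^ (p - 2) * L z.1 ^ 2) * (z.2.1 ^ 2 * |z.2.2| ^ (p - 2))) := by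
    intro z
    refine (hCab _ _).trans (le_of_eq ?_)
    simp only [abs_mul, Real.mul_rpow (abs_nonneg _) (abs_nonneg _)]
    ring
  have hint : Integrable (fun z : Ω × ℝ × ℝ => |L z.1 * z.2.1 + R z.1 * z.2.2| ^ p)
      (P.prod (m₁.prod m₂)) := by
    refine I.mono' (Measurable.aestronglyMeasurable (by fun_prop)) (ae_of_all _ fun z => ?_)
    rw [Real.norm_of_nonneg (by positivity)]
    exact hle z
  refine ⟨integrable_collide (f := fun x => |x| ^ p) hL hR (by fun_prop) hint, ?_⟩
  rw [integral_collide (f := fun x => |x| ^ p) hL hR (by fun_prop)]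
  refine (integral_mono hint I hle).trans ?_
  rw [integral_add' ((i1.add i2).add (i3.add i4)) (i5.add i6),
    integral_add' (i1.add i2) (i3.add i4), integral_add' i1 i2, integral_add' i3 i4,
    integral_add' i5 i6]
  rw [integral_prod_triple (fun ω => |L ω| ^ p) (fun x => |x| ^ p) (fun _ => 1),
    integral_prod_triple (fun ω => |R ω| ^ p) (fun _ => 1) (fun x => |x| ^ p),
    integral_prod_triple (fun ω => p * (L ω * |L ω| ^ (p - 2)) * R ω)
      (fun x => x * |x| ^ (p - 2)) (fun x => x),
    integral_prod_triple (fun ω => p * (R ω * |R ω| ^ (p - 2)) * L ω) (fun x => x)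
      (fun x => x * |x| ^ (p - 2)),
    integral_prod_triple (fun ω => C * (|L ω| ^ (p - 2) * R ω ^ 2)) (fun x => |x| ^ (p - 2))
      (fun x => x ^ 2),
    integral_prod_triple (fun ω => C * (|R ω| ^ (p - 2) * L ω ^ 2)) (fun x => x ^ 2)
      (fun x => |x| ^ (p - 2)), h₁.mean, h₂.mean, integral_const_mul, integral_const_mul]
  have hq1 := h₁.integral_rpow_sub_two_le hp
  have hq2 := h₂.integral_rpow_sub_two_le hp
  have ha1 : 0 ≤ ∫ x, x ^ 2 ∂m₁ := integral_nonneg fun x => sq_nonneg x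
  have ha2 : 0 ≤ ∫ x, x ^ 2 ∂m₂ := integral_nonneg fun x => sq_nonneg x
  have hb1 : 0 ≤ ∫ x, |x| ^ (p - 2) ∂m₁ := integral_nonneg fun x => by positivity
  have hb2 : 0 ≤ ∫ x, |x| ^ (p - 2) ∂m₂ := integral_nonneg fun x => by positivity
  have hS : 0 ≤ ∫ ω, |L ω| ^ p ∂P + ∫ ω, |R ω| ^ p ∂P :=
    add_nonneg (integral_nonneg fun x => by positivity) (integral_nonneg fun x => by positivity)
  have k1 := mul_le_mul (mul_le_mul_of_nonneg_left bLR hC)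
    (mul_le_mul_of_nonneg_right hq1 ha2) (mul_nonneg hb1 ha2) (mul_nonneg hC hS)
  rw [add_comm (∫ ω, |R ω| ^ p ∂P)] at bRL
  have k2 := mul_le_mul (mul_le_mul_of_nonneg_left bRL hC)
    (mul_le_mul_of_nonneg_left hq2 ha1) (mul_nonneg ha1 hb2) (mul_nonneg hC hS)
  simp only [integral_const, probReal_univ, smul_eq_mul, mul_one, one_mul, mul_zero, zero_mul,
    add_zero]
  linarith

end CollideMoments

end Moments

/-! ### Moments along the Wild series -/

section WildMoments

variable {Ω : Type*} [MeasurableSpace Ω] {P : Measure Ω} [IsProbabilityMeasure P] {L R : Ω → ℝ}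
  {p : ℝ} {ρ : Measure ℝ}

lemma IsCenteredWithMoment.of_wild (hp : 2 < p) (hL : Measurable L) (hR : Measurable R)
    (hLp : Integrable (fun ω => |L ω| ^ p) P) (hRp : Integrable (fun ω => |R ω| ^ p) P)
    (h : IsCenteredWithMoment p ρ) (n : ℕ) : IsCenteredWithMoment p (wild P L R ρ n) := by
  obtain ⟨C, hC, hCab⟩ := exists_abs_add_rpow_le hp
  have := h.prob
  induction n using Nat.strong_induction_on with
  | _ n ih =>
    cases n with
    | zero => rwa [wild_zero]
    | succ n =>
      have hc : ∀ x ∈ Finset.HasAntidiagonal.antidiagonal n,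
          IsCenteredWithMoment p (wild P L R ρ x.1) ∧
          IsCenteredWithMoment p (wild P L R ρ x.2) := by
        intro x hx
        have hx' := Finset.HasAntidiagonal.mem_antidiagonal.mp hx
        exact ⟨ih _ (by omega), ih _ (by omega)⟩
      have hi : ∀ x ∈ Finset.HasAntidiagonal.antidiagonal n, Integrable (fun z : ℝ => |z| ^ p)
          (collide P L R (wild P L R ρ x.1) (wild P L R ρ x.2)) := fun x hx =>
        ((hc x hx).1.collide_rpow hp hL hR hLp hRp (hc x hx).2 hC hCab).1
      refine ⟨isProbabilityMeasure_wild hL hR ρ _, ?_, ?_⟩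
      · rw [wild_succ]
        exact (integrable_finsetSum_measure.mpr hi).smul_measure (by simp)
      · rw [integral_wild_succ, Finset.sum_eq_zero, smul_zero]
        · exact fun x hx => (hc x hx).1.collide_mean hp hL hR hLp hRp (hc x hx).2
        · intro x hx
          have := (hc x hx).1.prob
          have := (hc x hx).2.prob
          have := isProbabilityMeasure_collide (P := P) hL hR (wild P L R ρ x.1) (wild P L R ρ x.2)
          exact IsCenteredWithMoment.integrable_id (p := p) ⟨this, hi x hx,
            (hc x hx).1.collide_mean hp hL hR hLp hRp (hc x hx).2⟩ hp

/-- Any supersolution of the moment equation controls the `p`-th moment of the Wild sum. -/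
lemma lintegral_wildSum_rpow_le (hp : 2 < p) (hL : Measurable L) (hR : Measurable R)
    (hLp : Integrable (fun ω => |L ω| ^ p) P) (hRp : Integrable (fun ω => |R ω| ^ p) P)
    (hsp : ∫ ω, |L ω| ^ p ∂P + ∫ ω, |R ω| ^ p ∂P < 1)
    (hs2 : ∫ ω, L ω ^ 2 ∂P + ∫ ω, R ω ^ 2 ∂P ≤ 1) (h : IsCenteredWithMoment p ρ) :
    ∃ D M : ℝ, 0 ≤ D ∧ 0 < M ∧ ∀ w w' : ℝ → ℝ, (∀ t, HasDerivAt w (w' t) t) →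
      (∀ t, 0 ≤ t → 0 < w t) → M ≤ w 0 →
      (∀ t, 0 ≤ t → (∫ ω, |L ω| ^ p ∂P + ∫ ω, |R ω| ^ p ∂P - 1) / (p / 2) * w t +
        D * Real.exp ((∫ ω, L ω ^ 2 ∂P + ∫ ω, R ω ^ 2 ∂P - 1) * t) ≤ w' t) →
      ∀ t, 0 ≤ t → ∫⁻ x, ENNReal.ofReal (|x| ^ p) ∂wildSum P L R ρ t ≤
        ENNReal.ofReal (w t ^ (p / 2)) := by
  obtain ⟨C, hC, hCab⟩ := exists_abs_add_rpow_le hp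
  have hp0 : 0 < p := by linarith
  have hw := h.of_wild (P := P) hp hL hR hLp hRp
  set lp := ∫ ω, |L ω| ^ p ∂P
  set rp := ∫ ω, |R ω| ^ p ∂P
  set l2 := ∫ ω, L ω ^ 2 ∂P
  set r2 := ∫ ω, R ω ^ 2 ∂P
  have hlp : 0 ≤ lp := integral_nonneg fun x => by positivity
  have hrp : 0 ≤ rp := integral_nonneg fun x => by positivity
  have hl2 : 0 ≤ l2 := integral_nonneg fun x => by positivity
  have hr2 : 0 ≤ r2 := integral_nonneg fun x => by positivity
  set m : ℕ → ℝ := fun n => ∫ x, |x| ^ p ∂wild P L R ρ n with hm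
  set a : ℕ → ℝ := fun n => ∫ x, x ^ 2 ∂wild P L R ρ n with ha
  have hm0 : ∀ n, 0 ≤ m n := fun n => integral_nonneg fun x => by positivity
  have ha0 : ∀ n, 0 ≤ a n := fun n => integral_nonneg fun x => by positivity
  set C' := C * (lp + rp) with hC'
  have hC'0 : 0 ≤ C' := mul_nonneg hC (by linarith)
  have hcol : ∀ x : ℕ × ℕ, IsCenteredWithMoment p
      (collide P L R (wild P L R ρ x.1) (wild P L R ρ x.2)) := by
    intro x
    have := (hw x.1).prob
    have := (hw x.2).prob
    exact ⟨isProbabilityMeasure_collide hL hR _ _,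
      ((hw x.1).collide_rpow hp hL hR hLp hRp (hw x.2) hC hCab).1,
      (hw x.1).collide_mean hp hL hR hLp hRp (hw x.2)⟩
  have harec : ∀ n : ℕ, (n + 1) * a (n + 1) ≤ ∑ x ∈ Finset.HasAntidiagonal.antidiagonal n,
      (l2 * a x.1 + r2 * a x.2) := by
    intro n
    simp only [ha]
    rw [integral_wild_succ _ _ fun x _ => (hcol x).integrable_sq hp, smul_eq_mul,
      mul_inv_cancel_left₀ (by positivity)]
    exact le_of_eq (Finset.sum_congr rfl fun x _ =>
      (hw x.1).collide_sq hp hL hR hLp hRp (hw x.2))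
  have hmrec : ∀ n : ℕ, (n + 1) * m (n + 1) ≤ ∑ x ∈ Finset.HasAntidiagonal.antidiagonal n,
      (lp * m x.1 + rp * m x.2 + C' * (m x.1 ^ ((p - 2) / p) * a x.2 +
        a x.1 * m x.2 ^ ((p - 2) / p))) := by
    intro n
    simp only [hm]
    rw [integral_wild_succ _ _ fun x _ => (hcol x).integrable_rpow, smul_eq_mul,
      mul_inv_cancel_left₀ (by positivity)]
    exact Finset.sum_le_sum fun x _ =>
      ((hw x.1).collide_rpow hp hL hR hLp hRp (hw x.2) hC hCab).2
  have haD := le_of_linear_wild_recursion hl2 hr2 hs2 ha0 harec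
  obtain ⟨B, hB⟩ := exists_bound_of_sublinear_wild_recursion hlp hrp hsp hC'0
    (div_nonneg (by linarith) hp0.le) (by rw [div_lt_one hp0]; linarith) hm0 ha0 haD hmrec
  have hA : ∀ t, 0 ≤ t → ∑' n, wildWeight t n * a n ≤ a 0 * Real.exp ((l2 + r2 - 1) * t) :=
    fun t ht => tsum_wildWeight_le_exp
      (fun n => by rw [abs_of_nonneg (ha0 n)]; exact haD n) harec ht
  -- The comparison principle is used with `q = p / 2`, for which the substitution `f = w ^ q`
  -- linearizes the inequality.
  have hq : (p - 2) / p = (p / 2 - 1) / (p / 2) := by field_simp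
  -- `M` is chosen so that `w 0 ≥ M` forces `w 0 ^ (p / 2) ≥ m 0`; the added `1` makes it positive.
  refine ⟨(2 * C' * a 0 + 1) / (p / 2), m 0 ^ (2 / p) + 1,
    div_nonneg (by have := ha0 0; positivity) (by positivity),
    by have := Real.rpow_nonneg (hm0 0) (2 / p); linarith, ?_⟩
  intro w w' hwd hwpos hwM hww t ht
  have hkey := tsum_wildWeight_le_rpow (m := m) (a := a) hC'0 (by linarith : 1 < p / 2) hq hm0 ha0
    hB haD hmrec hA hwd hwpos ?_ hww ht
  · rw [lintegral_wildSum]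
    refine le_trans (le_of_eq ?_) (ENNReal.ofReal_le_ofReal hkey)
    rw [ENNReal.ofReal_tsum_of_nonneg
      (fun n => mul_nonneg (wildWeight_nonneg ht n) (hm0 n))
      (summable_wildWeight_mul ht fun n => by rw [abs_of_nonneg (hm0 n)]; exact hB n)]
    refine tsum_congr fun n => ?_
    rw [ENNReal.ofReal_mul (wildWeight_nonneg ht n),
      ofReal_integral_eq_lintegral_ofReal (hw n).integrable_rpow
        (ae_of_all _ fun x => by positivity)]
  · have h1 : m 0 ^ (2 / p) ≤ w 0 := by linarith
    have h2 := Real.rpow_le_rpow (Real.rpow_nonneg (hm0 0) _) h1 (by positivity : 0 ≤ p / 2)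
    rwa [← Real.rpow_mul (hm0 0), show 2 / p * (p / 2) = 1 by field_simp, Real.rpow_one] at h2

end WildMoments

/-! ### Stationarity of the mixtures and their sine transform -/

section SteadyState

variable {Ω : Type*} [MeasurableSpace Ω] {P : Measure Ω} [IsProbabilityMeasure P] {L R : Ω → ℝ}
  {α : ℝ} {ν : Measure ℝ}

lemma IsMixingLaw.collide_eq (hL : Measurable L) (hR : Measurable R) (hν : IsMixingLaw P L R α ν) :
    collide P (fun ω => L ω ^ α) (fun ω => R ω ^ α) ν ν = ν := by
  have hLa : Measurable fun ω => L ω ^ α := by fun_prop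
  have hRa : Measurable fun ω => R ω ^ α := by fun_prop
  have := hν.prob
  have := isProbabilityMeasure_collide (P := P) hLa hRa ν ν
  refine Measure.ext_of_charFun (funext fun ξ => ?_)
  rw [charFun_collide hLa hRa, ← hν.fixed ξ]

lemma IsMixingLaw.ae_nonneg (hν : IsMixingLaw P L R α ν) : ∀ᵐ v ∂ν, 0 ≤ v := by
  rw [ae_iff]
  simp only [not_le]
  exact hν.supp

lemma IsMixingLaw.integrable_id (hν : IsMixingLaw P L R α ν) : Integrable (fun v : ℝ => v) ν := by
  by_contra h
  have := hν.mean
  rw [integral_undef h] at this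
  exact zero_ne_one this

lemma norm_exp_real_mul_le_one {v : ℝ} (hv : 0 ≤ v) {z : ℂ} (hz : z.re ≤ 0) :
    ‖Complex.exp (v * z)‖ ≤ 1 := by
  rw [Complex.norm_exp, Complex.re_ofReal_mul, Real.exp_le_one_iff]
  exact mul_nonpos_of_nonneg_of_nonpos hv hz

/-- The fixed point equation of the mixing law, extended to its Laplace transform. -/
lemma IsMixingLaw.laplace_fixed (hL : Measurable L) (hR : Measurable R)
    (hL0 : ∀ᵐ ω ∂P, 0 ≤ L ω) (hR0 : ∀ᵐ ω ∂P, 0 ≤ R ω) (hν : IsMixingLaw P L R α ν) {z : ℂ}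
    (hz : z.re ≤ 0) :
    ∫ v : ℝ, Complex.exp (v * z) ∂ν = ∫ ω, (∫ v : ℝ, Complex.exp (v * (((L ω ^ α : ℝ) : ℂ) * z)) ∂ν) *
      ∫ v : ℝ, Complex.exp (v * (((R ω ^ α : ℝ) : ℂ) * z)) ∂ν ∂P := by
  have hLa : Measurable fun ω => L ω ^ α := by fun_prop
  have hRa : Measurable fun ω => R ω ^ α := by fun_prop
  have hm := measurable_collide_map (E := ℝ) hLa hRa
  have := hν.prob
  have hint : Integrable (fun y : Ω × ℝ × ℝ =>
      Complex.exp (((L y.1 ^ α • y.2.1 + R y.1 ^ α • y.2.2 : ℝ) : ℂ) * z))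
      (P.prod (ν.prod ν)) := by
    refine Integrable.of_bound (Measurable.aestronglyMeasurable (by fun_prop)) 1 ?_
    have h1 : ∀ᵐ y ∂(P.prod (ν.prod ν)), 0 ≤ L y.1 ∧ 0 ≤ R y.1 := by
      have := Measure.quasiMeasurePreserving_fst (μ := P) (ν := ν.prod ν)
      exact this.ae (hL0.and hR0)
    have h2 : ∀ᵐ y ∂(P.prod (ν.prod ν)), 0 ≤ y.2.1 := by
      have := (Measure.quasiMeasurePreserving_fst (μ := ν) (ν := ν)).comp
        (Measure.quasiMeasurePreserving_snd (μ := P) (ν := ν.prod ν))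
      exact this.ae hν.ae_nonneg
    have h3 : ∀ᵐ y ∂(P.prod (ν.prod ν)), 0 ≤ y.2.2 := by
      have := (Measure.quasiMeasurePreserving_snd (μ := ν) (ν := ν)).comp
        (Measure.quasiMeasurePreserving_snd (μ := P) (ν := ν.prod ν))
      exact this.ae hν.ae_nonneg
    filter_upwards [h1, h2, h3] with y hy1 hy2 hy3
    refine norm_exp_real_mul_le_one ?_ hz
    simp only [smul_eq_mul]
    exact add_nonneg (mul_nonneg (Real.rpow_nonneg hy1.1 _) hy2)
      (mul_nonneg (Real.rpow_nonneg hy1.2 _) hy3)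
  -- The hypothesis on characteristic functions has become an identity of laws, so it may be tested
  -- against `exp (v z)`. This is bounded for `Re z ≤ 0` because all the variables are almost surely
  -- nonnegative.
  conv_lhs => rw [← hν.collide_eq hL hR]
  rw [collide, integral_map hm.aemeasurable (by fun_prop), integral_prod _ hint]
  refine integral_congr_ae (ae_of_all _ fun ω => ?_)
  simp only
  rw [← integral_prod_mul]
  refine integral_congr_ae (ae_of_all _ fun y => ?_)
  simp only [smul_eq_mul]
  rw [← Complex.exp_add]
  congr 1
  push_cast
  ring

/-- A probability measure whose characteristic function is a mixture of exponentials of a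
homogeneous exponent. -/
structure IsMixtureOfExp (α : ℝ) (ν μ : Measure ℝ) (η : ℝ → ℂ) : Prop where
  prob : IsProbabilityMeasure μ
  re_nonpos : ∀ ξ, (η ξ).re ≤ 0
  homogeneous : ∀ l ξ : ℝ, 0 ≤ l → η (l * ξ) = ((l ^ α : ℝ) : ℂ) * η ξ
  charFun_eq : ∀ ξ, charFun μ ξ = ∫ v : ℝ, Complex.exp (v * η ξ) ∂ν

/-- Homogeneity turns scaling of `ξ` by `L` into multiplication of the exponent by `L ^ α`. The
fixed point equation of `μ` at `ξ` is therefore the Laplace equation of `ν` at `η ξ`. -/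
lemma IsMixtureOfExp.collide_eq {μ : Measure ℝ} {η : ℝ → ℂ} (h : IsMixtureOfExp α ν μ η)
    (hL : Measurable L) (hR : Measurable R) (hL0 : ∀ᵐ ω ∂P, 0 ≤ L ω) (hR0 : ∀ᵐ ω ∂P, 0 ≤ R ω)
    (hν : IsMixingLaw P L R α ν) : collide P L R μ μ = μ := by
  have := h.prob
  have := isProbabilityMeasure_collide (P := P) hL hR μ μ
  refine Measure.ext_of_charFun (funext fun ξ => ?_)
  rw [charFun_collide hL hR, h.charFun_eq ξ, hν.laplace_fixed hL hR hL0 hR0 (h.re_nonpos ξ), Qhat]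
  refine integral_congr_ae ?_
  filter_upwards [hL0, hR0] with ω hl hr
  rw [h.charFun_eq, h.charFun_eq, h.homogeneous _ _ hl, h.homogeneous _ _ hr]

lemma IsCauchySteadyState.isMixtureOfExp {c₀ γ₀ : ℝ} {μ : Measure ℝ} (hc : 0 ≤ c₀)
    (h : IsCauchySteadyState c₀ γ₀ ν μ) : IsMixtureOfExp 1 ν μ fun ξ =>
      Complex.I * ((γ₀ * ξ : ℝ) : ℂ) - ((c₀ * Real.pi * |ξ| : ℝ) : ℂ) where
  prob := h.prob
  re_nonpos ξ := by
    have : 0 ≤ c₀ * Real.pi * |ξ| := by positivity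
    simp only [Complex.sub_re, Complex.I_mul_re, Complex.ofReal_im, Complex.ofReal_re]
    linarith
  homogeneous l ξ hl := by
    rw [Real.rpow_one, abs_mul, abs_of_nonneg hl]
    push_cast
    ring
  charFun_eq := h.charFun_eq

lemma StableDatum.nonneg {μ₀ : Measure ℝ} {cp cm : ℝ} (h : StableDatum α μ₀ cp cm) :
    0 ≤ cp ∧ 0 ≤ cm := by
  constructor
  · refine ge_of_tendsto h.right ?_
    filter_upwards [eventually_ge_atTop 0] with x hx
    exact mul_nonneg (Real.rpow_nonneg hx _) (by linarith [cdf_le_one μ₀ x])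
  · refine ge_of_tendsto h.left (Eventually.of_forall fun x => ?_)
    exact mul_nonneg (Real.rpow_nonneg (abs_nonneg x) _) (cdf_nonneg μ₀ x)

lemma stableScale_nonneg {cp cm : ℝ} (h1 : 1 ≤ α) (h2 : α < 2) (hcp : 0 ≤ cp) (hcm : 0 ≤ cm) :
    0 ≤ stableScale α cp cm := by
  have hΓ : 0 < Real.Gamma α := Real.Gamma_pos_of_pos (by linarith)
  have hs : 0 < Real.sin (Real.pi * α / 2) := by
    have := Real.pi_pos
    refine Real.sin_pos_of_pos_of_lt_pi (by positivity) ?_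
    nlinarith
  rw [stableScale]
  positivity

lemma IsStableSteadyState.isMixtureOfExp {cp cm : ℝ} {μ : Measure ℝ} (hα : 0 < α)
    (hs : 0 ≤ stableScale α cp cm) (h : IsStableSteadyState α cp cm ν μ) :
    IsMixtureOfExp α ν μ fun ξ => ((-(stableScale α cp cm * |ξ| ^ α) : ℝ) : ℂ) *
      (1 - Complex.I *
        ((stableSkew cp cm * Real.tan (α * (Real.pi / 2)) * Real.sign ξ : ℝ) : ℂ)) where
  prob := h.prob
  re_nonpos ξ := by
    have : 0 ≤ stableScale α cp cm * |ξ| ^ α := by positivity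
    rw [Complex.re_ofReal_mul]
    simp only [Complex.sub_re, Complex.one_re, Complex.I_mul_re, Complex.ofReal_im]
    linarith
  homogeneous l ξ hl := by
    rcases hl.eq_or_lt with rfl | hl
    · simp [Real.zero_rpow hα.ne']
    · have : Real.sign (l * ξ) = Real.sign ξ := by
        rcases lt_trichotomy ξ 0 with h | rfl | h
        · rw [Real.sign_of_neg h, Real.sign_of_neg (mul_neg_of_pos_of_neg hl h)]
        · simp
        · rw [Real.sign_of_pos h, Real.sign_of_pos (mul_pos hl h)]
      rw [this, abs_mul, abs_of_pos hl, Real.mul_rpow hl.le (abs_nonneg _)]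
      push_cast
      ring
  charFun_eq ξ := by
    rw [h.charFun_eq ξ]
    refine integral_congr_ae (ae_of_all _ fun v => ?_)
    simp only
    congr 1
    push_cast
    ring

/-- The imaginary part of the characteristic function is `∫ sin(ξ x) dμ`. -/
lemma charFun_im (μ : Measure ℝ) [IsProbabilityMeasure μ] (ξ : ℝ) :
    (charFun μ ξ).im = ∫ x, Real.sin (ξ * x) ∂μ := by
  rw [charFun_apply_real, ← RCLike.im_eq_complex_im, ← integral_im (integrable_exp_mul_I μ ξ)]
  refine integral_congr_ae (ae_of_all _ fun x => ?_)
  simp only [RCLike.im_eq_complex_im]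
  rw [← Complex.ofReal_mul, Complex.exp_ofReal_mul_I_im]

lemma IsMixtureOfExp.integral_sin {μ : Measure ℝ} {η : ℝ → ℂ} (h : IsMixtureOfExp α ν μ η)
    (hν : IsMixingLaw P L R α ν) (ξ : ℝ) :
    ∫ x, Real.sin (ξ * x) ∂μ = ∫ v, Real.exp (v * (η ξ).re) * Real.sin (v * (η ξ).im) ∂ν := by
  have := h.prob
  have := hν.prob
  have hint : Integrable (fun v : ℝ => Complex.exp (v * η ξ)) ν := by
    refine Integrable.of_bound (by fun_prop) 1 ?_
    filter_upwards [hν.ae_nonneg] with v hv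
    exact norm_exp_real_mul_le_one hv (h.re_nonpos ξ)
  rw [← charFun_im, h.charFun_eq, ← RCLike.im_eq_complex_im, ← integral_im hint]
  refine integral_congr_ae (ae_of_all _ fun x => ?_)
  simp only [RCLike.im_eq_complex_im]
  rw [Complex.exp_im, Complex.re_ofReal_mul, Complex.im_ofReal_mul]

lemma IsMixtureOfExp.norm_sin_integrand_le {μ : Measure ℝ} {η : ℝ → ℂ}
    (h : IsMixtureOfExp α ν μ η) {v : ℝ} (hv : 0 ≤ v) (ξ : ℝ) :
    ‖Real.exp (v * (η ξ).re) * Real.sin (v * (η ξ).im)‖ ≤ v * |(η ξ).im| := by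
  rw [norm_mul, Real.norm_of_nonneg (Real.exp_pos _).le]
  have h1 : Real.exp (v * (η ξ).re) ≤ 1 :=
    Real.exp_le_one_iff.mpr (mul_nonpos_of_nonneg_of_nonpos hv (h.re_nonpos ξ))
  have h2 : ‖Real.sin (v * (η ξ).im)‖ ≤ v * |(η ξ).im| := by
    rw [Real.norm_eq_abs]
    refine Real.abs_sin_le_abs.trans (le_of_eq ?_)
    rw [abs_mul, abs_of_nonneg hv]
  calc _ ≤ 1 * (v * |(η ξ).im|) := mul_le_mul h1 h2 (norm_nonneg _) zero_le_one
    _ = _ := one_mul _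

/-- The integrand is at most `v |Im η(ξ)|`, and `ν` has mean one. -/
lemma IsMixtureOfExp.abs_integral_sin_le {μ : Measure ℝ} {η : ℝ → ℂ} (h : IsMixtureOfExp α ν μ η)
    (hν : IsMixingLaw P L R α ν) (ξ : ℝ) : |∫ x, Real.sin (ξ * x) ∂μ| ≤ |(η ξ).im| := by
  rw [h.integral_sin hν, ← Real.norm_eq_abs]
  refine (norm_integral_le_of_norm_le (hν.integrable_id.mul_const |(η ξ).im|) ?_).trans ?_
  · filter_upwards [hν.ae_nonneg] with v hv
    exact h.norm_sin_integrand_le hv ξ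
  · rw [integral_mul_const, hν.mean, one_mul]

end SteadyState

/-! ### Centering of the difference; the case `α > 1` -/

section MeanDifference

/-- If Lipschitz truncations of the identity have the same limiting mean under both marginals of a
coupling, then the difference of the coordinates is centered. -/
lemma integral_sub_eq_zero_of_tendsto {m : Measure (ℝ × ℝ)} [IsProbabilityMeasure m]
    (hint : Integrable (fun z : ℝ × ℝ => z.1 - z.2) m) {h : ℝ → ℝ → ℝ}
    (hmeas : ∀ ε, Measurable (h ε)) (hbdd : ∀ ε, 0 < ε → ∃ C, ∀ x, |h ε x| ≤ C)
    (hlip : ∀ ε, 0 < ε → ∀ x y, |h ε x - h ε y| ≤ |x - y|)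
    (hlim : ∀ x, Tendsto (fun ε => h ε x) (𝓝[>] 0) (𝓝 x)) {γ : ℝ}
    (h₁ : Tendsto (fun ε => ∫ x, h ε x ∂m.map Prod.fst) (𝓝[>] 0) (𝓝 γ))
    (h₂ : Tendsto (fun ε => ∫ x, h ε x ∂m.map Prod.snd) (𝓝[>] 0) (𝓝 γ)) :
    ∫ z, (z.1 - z.2) ∂m = 0 := by
  -- The Lipschitz bound makes `|z.1 - z.2|` a dominating function, although neither coordinate need
  -- be integrable.
  have hA : Tendsto (fun ε => ∫ z, (h ε z.1 - h ε z.2) ∂m) (𝓝[>] 0) (𝓝 (∫ z, (z.1 - z.2) ∂m)) := by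
    refine tendsto_integral_filter_of_dominated_convergence (fun z => |z.1 - z.2|)
      (Eventually.of_forall fun ε => ?_) ?_ hint.abs (ae_of_all _ fun z => ?_)
    · exact (((hmeas ε).comp measurable_fst).sub
        ((hmeas ε).comp measurable_snd)).aestronglyMeasurable
    · filter_upwards [self_mem_nhdsWithin] with ε hε
      exact ae_of_all _ fun z => hlip ε hε z.1 z.2
    · exact (hlim z.1).sub (hlim z.2)
  -- For fixed `ε` the truncation is bounded, so the integral splits over the marginals.
  have hB : Tendsto (fun ε => ∫ z, (h ε z.1 - h ε z.2) ∂m) (𝓝[>] 0) (𝓝 0) := by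
    have := h₁.sub h₂
    rw [sub_self] at this
    refine this.congr' ?_
    filter_upwards [self_mem_nhdsWithin] with ε hε
    obtain ⟨C, hC⟩ := hbdd ε hε
    rw [integral_map measurable_fst.aemeasurable (hmeas ε).aestronglyMeasurable,
      integral_map measurable_snd.aemeasurable (hmeas ε).aestronglyMeasurable, ← integral_sub]
    · exact Integrable.of_bound ((hmeas ε).comp measurable_fst).aestronglyMeasurable C
        (ae_of_all _ fun z => hC z.1)
    · exact Integrable.of_bound ((hmeas ε).comp measurable_snd).aestronglyMeasurable C
        (ae_of_all _ fun z => hC z.2)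
  exact tendsto_nhds_unique hA hB

lemma tendsto_sin_mul_div (x : ℝ) :
    Tendsto (fun ε : ℝ => Real.sin (ε * x) / ε) (𝓝[>] 0) (𝓝 x) := by
  have h : HasDerivAt (fun ε : ℝ => Real.sin (ε * x)) x 0 := by
    simpa using ((hasDerivAt_id (0 : ℝ)).mul_const x).sin
  have := h.tendsto_slope_zero_right
  refine this.congr' ?_
  filter_upwards with ε
  simp [div_eq_inv_mul]

lemma abs_sin_mul_div_sub_le {ε : ℝ} (hε : 0 < ε) (x y : ℝ) :
    |Real.sin (ε * x) / ε - Real.sin (ε * y) / ε| ≤ |x - y| := by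
  rw [← sub_div, abs_div, abs_of_pos hε, div_le_iff₀ hε]
  have : |Real.sin (ε * x) - Real.sin (ε * y)| ≤ |ε * x - ε * y| := by
    have := Real.lipschitzWith_sin.dist_le_mul (ε * x) (ε * y)
    simpa [Real.dist_eq] using this
  rw [← mul_sub, abs_mul, abs_of_pos hε] at this
  linarith

variable {Ω : Type*} [MeasurableSpace Ω] {P : Measure Ω} [IsProbabilityMeasure P] {L R : Ω → ℝ}
  {α : ℝ} {ν μ₀ μinf : Measure ℝ} {η : ℝ → ℂ}

/-- The truncation is `sin (ε x) / ε`. Its integral tends to the mean under `μ₀` by dominated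
convergence, and under `μinf` it is at most `ε^{α-1} |Im η(1)|`, which vanishes in the limit because
`α > 1`. -/
lemma IsMixtureOfExp.integral_coupling_eq_zero (hα : 1 < α) (h : IsMixtureOfExp α ν μinf η)
    (hν : IsMixingLaw P L R α ν) (hi : Integrable (fun v : ℝ => v) μ₀) (h0 : ∫ v, v ∂μ₀ = 0)
    {m : Measure (ℝ × ℝ)} [IsProbabilityMeasure m] (hm₁ : m.map Prod.fst = μ₀)
    (hm₂ : m.map Prod.snd = μinf) (hint : Integrable (fun z : ℝ × ℝ => z.1 - z.2) m) :
    ∫ z, (z.1 - z.2) ∂m = 0 := by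
  refine integral_sub_eq_zero_of_tendsto hint (h := fun ε x => Real.sin (ε * x) / ε) (γ := 0)
    (fun ε => by fun_prop) (fun ε hε => ⟨1 / ε, fun x => ?_⟩)
    (fun ε hε => abs_sin_mul_div_sub_le hε) tendsto_sin_mul_div ?_ ?_
  · rw [abs_div, abs_of_pos hε]
    gcongr
    exact Real.abs_sin_le_one _
  · rw [hm₁]
    conv => enter [3]; rw [← h0]
    refine tendsto_integral_filter_of_dominated_convergence (fun x => |x|)
      (Eventually.of_forall fun ε => by fun_prop) ?_ hi.abs
      (ae_of_all _ fun x => tendsto_sin_mul_div x)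
    filter_upwards [self_mem_nhdsWithin] with ε hε
    refine ae_of_all _ fun x => ?_
    rw [Real.norm_eq_abs]
    simpa only [mul_zero, Real.sin_zero, zero_div, sub_zero] using abs_sin_mul_div_sub_le hε x 0
  · rw [hm₂]
    have hlim : Tendsto (fun ε : ℝ => ε ^ (α - 1) * |(η 1).im|) (𝓝[>] 0) (𝓝 0) := by
      have h1 : Tendsto (fun ε : ℝ => ε ^ (α - 1)) (𝓝[>] 0) (𝓝 0) := by
        have := (Real.continuousAt_rpow_const 0 (α - 1) (Or.inr (by linarith))).tendsto
        rw [Real.zero_rpow (by linarith)] at this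
        exact this.mono_left nhdsWithin_le_nhds
      simpa using h1.mul_const |(η 1).im|
    refine squeeze_zero_norm' ?_ hlim
    filter_upwards [self_mem_nhdsWithin] with ε (hε : 0 < ε)
    rw [integral_div, norm_div, Real.norm_of_nonneg hε.le, Real.norm_eq_abs, div_le_iff₀ hε]
    refine (h.abs_integral_sin_le hν ε).trans (le_of_eq ?_)
    have := h.homogeneous ε 1 hε.le
    rw [mul_one] at this
    rw [this, Complex.im_ofReal_mul, abs_mul, abs_of_pos (Real.rpow_pos_of_pos hε α),
      Real.rpow_sub_one hε.ne']
    field_simp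

end MeanDifference

/-! ### The rational truncation as a superposition of hard truncations -/

section RationalTruncation

/-- The density of the representation of `x / (1 + x ^ 2)` as a mixture of truncations. -/
def truncWeight (a : ℝ) : ℝ := 2 * a * (3 - a ^ 2) / (1 + a ^ 2) ^ 3

lemma continuous_truncWeight : Continuous truncWeight := by
  unfold truncWeight
  exact (by fun_prop : Continuous fun a : ℝ => 2 * a * (3 - a ^ 2)).div (by fun_prop)
    fun a => by positivity

lemma abs_three_sub_sq_le (a : ℝ) : |3 - a ^ 2| ≤ 3 * (1 + a ^ 2) := by
  rw [abs_le]
  constructor <;> nlinarith [sq_nonneg a]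

lemma abs_truncWeight_le (a : ℝ) : |truncWeight a| ≤ 6 * (1 + a ^ 2)⁻¹ := by
  have h0 : 0 < 1 + a ^ 2 := by positivity
  have h1 : |a| ≤ 1 + a ^ 2 := by
    rw [← sq_abs]
    nlinarith [sq_nonneg (|a| - 1), abs_nonneg a]
  have h2 := abs_three_sub_sq_le a
  rw [truncWeight, abs_div, abs_of_pos (by positivity : 0 < (1 + a ^ 2) ^ 3),
    div_le_iff₀ (by positivity), abs_mul, abs_mul, abs_two]
  have h3 := mul_le_mul h1 h2 (abs_nonneg _) h0.le
  have e : 6 * (1 + a ^ 2)⁻¹ * (1 + a ^ 2) ^ 3 = 2 * ((1 + a ^ 2) * (3 * (1 + a ^ 2))) := by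
    field_simp
    ring
  rw [e]
  linarith

lemma abs_mul_truncWeight_le (a : ℝ) : |a * truncWeight a| ≤ 6 * (1 + a ^ 2)⁻¹ := by
  have h0 : 0 < 1 + a ^ 2 := by positivity
  have h2 := abs_three_sub_sq_le a
  have h1 : |a| * |a| ≤ 1 + a ^ 2 := by
    rw [abs_mul_abs_self]
    nlinarith
  rw [truncWeight, abs_mul, abs_div, abs_of_pos (by positivity : 0 < (1 + a ^ 2) ^ 3),
    ← mul_div_assoc, div_le_iff₀ (by positivity), abs_mul, abs_mul, abs_two]
  have h3 := mul_le_mul h1 h2 (abs_nonneg _) h0.le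
  have e : 6 * (1 + a ^ 2)⁻¹ * (1 + a ^ 2) ^ 3 = 2 * ((1 + a ^ 2) * (3 * (1 + a ^ 2))) := by
    field_simp
    ring
  rw [e]
  linarith

lemma integrable_truncWeight : Integrable truncWeight :=
  (integrable_inv_one_add_sq.const_mul 6).mono' continuous_truncWeight.aestronglyMeasurable
    (ae_of_all _ abs_truncWeight_le)

lemma integrable_mul_truncWeight : Integrable fun a => a * truncWeight a :=
  (integrable_inv_one_add_sq.const_mul 6).mono'
    (continuous_id.mul continuous_truncWeight).aestronglyMeasurable
    (ae_of_all _ abs_mul_truncWeight_le)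

/-- The weight is minus the second derivative of `x / (1 + x²)`, so its tail integral is the first
derivative; in particular its total mass on the half-line is `1`. -/
lemma integral_Ioi_truncWeight (x : ℝ) :
    ∫ a in Ioi x, truncWeight a = (1 - x ^ 2) / (1 + x ^ 2) ^ 2 := by
  have hd : ∀ a : ℝ, HasDerivAt (fun a : ℝ => -((1 - a ^ 2) / (1 + a ^ 2) ^ 2))
      (truncWeight a) a := by
    intro a
    have h1 : HasDerivAt (fun a : ℝ => 1 - a ^ 2) (-(2 * a)) a := by
      simpa using (hasDerivAt_pow 2 a).const_sub 1
    have h2 : HasDerivAt (fun a : ℝ => (1 + a ^ 2) ^ 2) (2 * (1 + a ^ 2) * (2 * a)) a := by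
      simpa using ((hasDerivAt_pow 2 a).const_add 1).fun_pow 2
    refine (h1.div h2 (by positivity)).neg.congr_deriv ?_
    rw [truncWeight]
    field_simp
    ring
  have hlim : Tendsto (fun a : ℝ => -((1 - a ^ 2) / (1 + a ^ 2) ^ 2)) atTop (𝓝 0) := by
    have hz : Tendsto (fun a : ℝ => (1 + a ^ 2)⁻¹) atTop (𝓝 0) :=
      (tendsto_atTop_add_const_left _ _ (tendsto_pow_atTop two_ne_zero)).inv_tendsto_atTop
    refine squeeze_zero_norm (fun a => ?_) hz
    rw [norm_neg, norm_div, Real.norm_eq_abs, Real.norm_eq_abs,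
      abs_of_pos (by positivity : 0 < (1 + a ^ 2) ^ 2), div_le_iff₀ (by positivity)]
    have e : (1 + a ^ 2)⁻¹ * (1 + a ^ 2) ^ 2 = 1 + a ^ 2 := by field_simp
    rw [e, abs_le]
    constructor <;> nlinarith [sq_nonneg a]
  rw [integral_Ioi_of_hasDerivAt_of_tendsto' (fun a _ => hd a)
    integrable_truncWeight.integrableOn hlim]
  ring

/-- Truncation of `x` to `[-a, a]`. -/
def trunc (a x : ℝ) : ℝ := max (-a) (min x a)

lemma trunc_neg (a x : ℝ) (ha : 0 ≤ a) : trunc a (-x) = -trunc a x := by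
  unfold trunc
  rcases le_total x a with h1 | h1 <;> rcases le_total (-x) a with h2 | h2 <;>
    simp only [min_eq_left, min_eq_right, h1, h2]
  · rw [max_eq_right (by linarith), max_eq_right (by linarith)]
  · rw [max_eq_right (by linarith), max_eq_left (by linarith)]
    ring
  · rw [max_eq_left (by linarith), max_eq_right (by linarith)]
  · obtain rfl : a = 0 := by linarith
    simp

lemma abs_trunc_le {a : ℝ} (ha : 0 ≤ a) (x : ℝ) : |trunc a x| ≤ a :=
  abs_le.mpr ⟨le_max_left _ _, max_le (by linarith) (min_le_right _ _)⟩

lemma continuous_trunc : Continuous fun z : ℝ × ℝ => trunc z.1 z.2 := by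
  unfold trunc
  fun_prop

lemma integrableOn_trunc_mul_truncWeight (x : ℝ) :
    IntegrableOn (fun a => trunc a x * truncWeight a) (Ioi 0) := by
  refine integrable_mul_truncWeight.abs.integrableOn.mono'
    ((continuous_trunc.comp (by fun_prop : Continuous fun a : ℝ => (a, x))).mul
      continuous_truncWeight).aestronglyMeasurable ?_
  filter_upwards [self_mem_ae_restrict measurableSet_Ioi] with a (ha : 0 < a)
  rw [norm_mul, abs_mul, Real.norm_eq_abs, Real.norm_eq_abs, abs_of_pos ha]
  exact mul_le_mul_of_nonneg_right (abs_trunc_le ha.le x) (abs_nonneg _)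

/-- For `x ≥ 0` the truncation is `a` below `x` and `x` above it, and both pieces have explicit
antiderivatives; negative `x` follows by oddness. The weight is absolutely integrable, unlike the
weight `sin a` that would represent the sine truncation. -/
lemma integral_trunc_mul_truncWeight (x : ℝ) :
    ∫ a in Ioi 0, trunc a x * truncWeight a = x / (1 + x ^ 2) := by
  have main : ∀ x : ℝ, 0 ≤ x → ∫ a in Ioi 0, trunc a x * truncWeight a = x / (1 + x ^ 2) := by
    intro x hx
    have hI := integrableOn_trunc_mul_truncWeight x
    rw [← Ioc_union_Ioi_eq_Ioi hx, setIntegral_union (Ioc_disjoint_Ioi le_rfl) measurableSet_Ioi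
      (hI.mono_set Ioc_subset_Ioi_self) (hI.mono_set (Ioi_subset_Ioi hx))]
    have e1 : ∫ a in Ioc 0 x, trunc a x * truncWeight a = ∫ a in (0 : ℝ)..x, a * truncWeight a := by
      rw [intervalIntegral.integral_of_le hx]
      refine setIntegral_congr_fun measurableSet_Ioc fun a ha => ?_
      simp only [trunc, min_eq_right ha.2]
      rw [max_eq_right (by linarith [ha.1])]
    have e2 : ∫ a in Ioi x, trunc a x * truncWeight a = ∫ a in Ioi x, x * truncWeight a := by
      refine setIntegral_congr_fun measurableSet_Ioi fun a (ha : x < a) => ?_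
      simp only [trunc, min_eq_left ha.le]
      rw [max_eq_right (by linarith)]
    have hd : ∀ a : ℝ, HasDerivAt (fun a : ℝ => 2 * a ^ 3 / (1 + a ^ 2) ^ 2)
        (a * truncWeight a) a := by
      intro a
      have h1 : HasDerivAt (fun a : ℝ => 2 * a ^ 3) (2 * (3 * a ^ 2)) a := by
        simpa using (hasDerivAt_pow 3 a).const_mul 2
      have h2 : HasDerivAt (fun a : ℝ => (1 + a ^ 2) ^ 2) (2 * (1 + a ^ 2) * (2 * a)) a := by
        simpa using ((hasDerivAt_pow 2 a).const_add 1).fun_pow 2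
      refine (h1.div h2 (by positivity)).congr_deriv ?_
      rw [truncWeight]
      field_simp
      ring
    rw [e1, e2, integral_const_mul, integral_Ioi_truncWeight,
      intervalIntegral.integral_eq_sub_of_hasDerivAt (fun a _ => hd a)
        ((continuous_id.mul continuous_truncWeight).intervalIntegrable 0 x)]
    field_simp
    ring
  rcases le_total 0 x with hx | hx
  · exact main x hx
  · have h := main (-x) (by linarith)
    have : ∫ a in Ioi 0, trunc a (-x) * truncWeight a =
        -∫ a in Ioi 0, trunc a x * truncWeight a := by
      rw [← integral_neg]
      refine setIntegral_congr_fun measurableSet_Ioi fun a (ha : 0 < a) => ?_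
      rw [trunc_neg a x ha.le, neg_mul]
    rw [this, neg_sq, neg_div] at h
    exact neg_injective h

end RationalTruncation

/-! ### Truncated means of the initial datum for `α = 1` -/

section PrincipalValue

variable {μ₀ : Measure ℝ} [IsProbabilityMeasure μ₀]

lemma trunc_eq_indicator {b : ℝ} (hb : 0 < b) (x : ℝ) :
    trunc b x = (Ioo (-b) b).indicator (fun x => x) x + (Ici b).indicator (fun _ => b) x -
      (Iic (-b)).indicator (fun _ => b) x := by
  unfold trunc
  rcases lt_or_ge x b with h1 | h1
  · rcases lt_or_ge (-b) x with h2 | h2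
    · rw [indicator_of_mem (show x ∈ Ioo (-b) b from ⟨h2, h1⟩),
        indicator_of_notMem (show x ∉ Ici b from not_le.mpr h1),
        indicator_of_notMem (show x ∉ Iic (-b) from not_le.mpr h2), min_eq_left h1.le,
        max_eq_right h2.le]
      ring
    · rw [indicator_of_notMem (show x ∉ Ioo (-b) b from fun h => absurd h.1 (not_lt.mpr h2)),
        indicator_of_notMem (show x ∉ Ici b from not_le.mpr h1),
        indicator_of_mem (show x ∈ Iic (-b) from h2), min_eq_left h1.le, max_eq_left h2]
      ring
  · rw [indicator_of_notMem (show x ∉ Ioo (-b) b from fun h => absurd h.2 (not_lt.mpr h1)),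
      indicator_of_mem (show x ∈ Ici b from h1),
      indicator_of_notMem (show x ∉ Iic (-b) from fun h => by
        have : x ≤ -b := h
        linarith), min_eq_right h1, max_eq_right (by linarith)]
    ring

lemma integral_trunc_eq {b : ℝ} (hb : 0 < b) : ∫ x, trunc b x ∂μ₀ =
    ∫ x in Ioo (-b) b, x ∂μ₀ + b * μ₀.real (Ici b) - b * μ₀.real (Iic (-b)) := by
  have i1 : Integrable ((Ioo (-b) b).indicator fun x : ℝ => x) μ₀ := by
    refine Integrable.of_bound (measurable_id.indicator measurableSet_Ioo).aestronglyMeasurable b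
      (ae_of_all _ fun x => ?_)
    by_cases h : x ∈ Ioo (-b) b
    · rw [indicator_of_mem h, Real.norm_eq_abs]
      exact (abs_lt.mpr h).le
    · rw [indicator_of_notMem h, norm_zero]
      exact hb.le
  have i2 : Integrable ((Ici b).indicator fun _ : ℝ => b) μ₀ :=
    (integrable_const b).indicator measurableSet_Ici
  have i3 : Integrable ((Iic (-b)).indicator fun _ : ℝ => b) μ₀ :=
    (integrable_const b).indicator measurableSet_Iic
  simp_rw [trunc_eq_indicator hb]
  rw [integral_sub (f := fun x => (Ioo (-b) b).indicator (fun x => x) x +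
      (Ici b).indicator (fun _ => b) x) (i1.add i2) i3, integral_add i1 i2, integral_indicator measurableSet_Ioo,
    integral_indicator measurableSet_Ici, integral_indicator measurableSet_Iic, setIntegral_const,
    setIntegral_const]
  simp only [smul_eq_mul]
  ring

/-- The hard truncation adds to the principal value the boundary terms `b μ₀[b, ∞)` and `-b μ₀(-∞,
-b]`, whose limits `c₀` and `-c₀` cancel. -/
lemma CauchyDatum.tendsto_integral_trunc {c₀ γ₀ : ℝ} (h : CauchyDatum μ₀ c₀ γ₀) :
    Tendsto (fun b => ∫ x, trunc b x ∂μ₀) atTop (𝓝 γ₀) := by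
  have hIic : Tendsto (fun b : ℝ => b * μ₀.real (Iic (-b))) atTop (𝓝 c₀) := by
    refine (h.left.comp tendsto_neg_atTop_atBot).congr' ?_
    filter_upwards [eventually_ge_atTop 0] with b hb
    simp only [Function.comp, abs_neg, abs_of_nonneg hb, cdf_eq_real]
  have hIoi : ∀ b : ℝ, μ₀.real (Ioi b) = 1 - cdf μ₀ b := fun b => by
    rw [cdf_eq_real, ← compl_Iic, probReal_compl_eq_one_sub measurableSet_Iic]
  have hz : Tendsto (fun b : ℝ => 1 - cdf μ₀ b) atTop (𝓝 0) := by
    simpa using (tendsto_cdf_atTop μ₀).const_sub 1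
  -- The hypothesis concerns the open tail. A possible atom at `b` is handled by squeezing the
  -- closed tail between the open tails at `b` and `b - 1`.
  have hIci : Tendsto (fun b : ℝ => b * μ₀.real (Ici b)) atTop (𝓝 c₀) := by
    have hup : Tendsto (fun b : ℝ => (b - 1) * (1 - cdf μ₀ (b - 1)) + (1 - cdf μ₀ (b - 1)))
        atTop (𝓝 c₀) := by
      have ht : Tendsto (fun b : ℝ => b - 1) atTop atTop := tendsto_atTop_add_const_right _ _ tendsto_id
      simpa using (h.right.comp ht).add (hz.comp ht)
    refine tendsto_of_tendsto_of_tendsto_of_le_of_le' h.right hup ?_ ?_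
    · filter_upwards [eventually_ge_atTop 0] with b hb
      rw [← hIoi]
      exact mul_le_mul_of_nonneg_left (measureReal_mono Ioi_subset_Ici_self) hb
    · filter_upwards [eventually_ge_atTop 0] with b hb
      have := mul_le_mul_of_nonneg_left (measureReal_mono (μ := μ₀)
        (show Ici b ⊆ Ioi (b - 1) from fun x (hx : b ≤ x) => by
          simp only [mem_Ioi]
          linarith)) hb
      rw [hIoi] at this
      linarith
  have := (h.principal.add hIci).sub hIic
  rw [add_sub_cancel_right] at this
  refine this.congr' ?_
  filter_upwards [eventually_gt_atTop 0] with b hb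
  exact (integral_trunc_eq hb).symm

/-- The rational truncation `x / (1 + (ε x) ^ 2)` of the identity. -/
def ratTrunc (ε x : ℝ) : ℝ := x / (1 + (ε * x) ^ 2)

lemma measurable_ratTrunc (ε : ℝ) : Measurable (ratTrunc ε) := by
  unfold ratTrunc
  fun_prop

lemma abs_ratTrunc_le {ε : ℝ} (hε : 0 < ε) (x : ℝ) : |ratTrunc ε x| ≤ 1 / ε := by
  rw [ratTrunc, abs_div, abs_of_pos (by positivity : 0 < 1 + (ε * x) ^ 2),
    div_le_div_iff₀ (by positivity) hε, one_mul, ← sq_abs, abs_mul, abs_of_pos hε]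
  nlinarith [sq_nonneg (ε * |x| - 1), mul_nonneg hε.le (abs_nonneg x)]

lemma abs_ratTrunc_sub_le (ε x y : ℝ) : |ratTrunc ε x - ratTrunc ε y| ≤ |x - y| := by
  have hx : 0 < 1 + (ε * x) ^ 2 := by positivity
  have hy : 0 < 1 + (ε * y) ^ 2 := by positivity
  have e : ratTrunc ε x - ratTrunc ε y =
      (x - y) * ((1 - (ε * x) * (ε * y)) / ((1 + (ε * x) ^ 2) * (1 + (ε * y) ^ 2))) := by
    unfold ratTrunc
    field_simp
    ring
  rw [e, abs_mul]
  refine mul_le_of_le_one_right (abs_nonneg _) ?_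
  rw [abs_div, abs_of_pos (mul_pos hx hy), div_le_one (mul_pos hx hy), abs_le]
  constructor <;> nlinarith [sq_nonneg (ε * x), sq_nonneg (ε * y), sq_nonneg (ε * x - ε * y),
    sq_nonneg (ε * x + ε * y), mul_nonneg (sq_nonneg (ε * x)) (sq_nonneg (ε * y))]

lemma tendsto_ratTrunc (x : ℝ) : Tendsto (fun ε => ratTrunc ε x) (𝓝[>] 0) (𝓝 x) := by
  have : Continuous fun ε => ratTrunc ε x := by
    unfold ratTrunc
    exact continuous_const.div (by fun_prop) fun ε => by positivity
  have h := this.tendsto 0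
  simp only [ratTrunc, zero_mul, ne_eq, OfNat.ofNat_ne_zero, not_false_eq_true, zero_pow, add_zero,
    div_one] at h
  exact h.mono_left nhdsWithin_le_nhds

lemma CauchyDatum.tendsto_integral_ratTrunc {c₀ γ₀ : ℝ} (h : CauchyDatum μ₀ c₀ γ₀) :
    Tendsto (fun ε => ∫ x, ratTrunc ε x ∂μ₀) (𝓝[>] 0) (𝓝 γ₀) := by
  set G : ℝ → ℝ := fun b => ∫ x, trunc b x ∂μ₀ with hG
  have hGb : ∀ b, 0 ≤ b → |G b| ≤ b := by
    intro b hb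
    have := norm_integral_le_of_norm_le_const (μ := μ₀) (f := fun x => trunc b x) (C := b)
      (ae_of_all _ fun x => abs_trunc_le hb x)
    simpa using this
  have hGm : StronglyMeasurable G := by
    have : StronglyMeasurable fun z : ℝ × ℝ => trunc z.1 z.2 := continuous_trunc.stronglyMeasurable
    exact this.integral_prod_right
  -- The truncated means are uniformly bounded: by `b` itself for small `b`, by convergence for
  -- large `b`. This provides the dominating function for the superposition.
  obtain ⟨K, hK⟩ : ∃ K, ∀ b, 0 ≤ b → |G b| ≤ K := by
    have hev : ∀ᶠ b in atTop, |G b| < |γ₀| + 1 :=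
      h.tendsto_integral_trunc.abs.eventually_lt_const (by linarith)
    obtain ⟨N, hN⟩ := eventually_atTop.mp hev
    refine ⟨max N (|γ₀| + 1), fun b hb => ?_⟩
    rcases le_total N b with h | h
    · exact (hN b h).le.trans (le_max_right _ _)
    · exact ((hGb b hb).trans h).trans (le_max_left _ _)
  have hrep : ∀ ε : ℝ, 0 < ε → ∫ x, ratTrunc ε x ∂μ₀ =
      ∫ a in Ioi 0, G (a / ε) * truncWeight a := by
    intro ε hε
    have hsc : ∀ a x : ℝ, trunc a (ε * x) = ε * trunc (a / ε) x := by
      intro a x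
      unfold trunc
      rw [mul_max_of_nonneg _ _ hε.le, mul_min_of_nonneg _ _ hε.le, mul_neg,
        mul_div_cancel₀ _ hε.ne']
    have h1 : ∀ x : ℝ, ratTrunc ε x = ∫ a in Ioi 0, trunc (a / ε) x * truncWeight a := by
      intro x
      have := integral_trunc_mul_truncWeight (ε * x)
      simp only [hsc, mul_assoc] at this
      rw [integral_const_mul, mul_div_assoc] at this
      exact (mul_left_cancel₀ hε.ne' this).symm
    simp_rw [h1]
    rw [integral_integral_swap]
    · refine integral_congr_ae (ae_of_all _ fun a => ?_)
      simp only [hG]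
      rw [integral_mul_const]
    · have hc : Continuous fun z : ℝ × ℝ => trunc (z.2 / ε) z.1 * truncWeight z.2 :=
        (continuous_trunc.comp (by fun_prop : Continuous fun z : ℝ × ℝ => (z.2 / ε, z.1))).mul
          (continuous_truncWeight.comp continuous_snd)
      have hbi : Integrable (fun z : ℝ × ℝ => 1 * |z.2 * truncWeight z.2 / ε|)
          (μ₀.prod (volume.restrict (Ioi 0))) :=
        (integrable_const (1 : ℝ)).mul_prod
          ((integrable_mul_truncWeight.div_const ε).abs.restrict (s := Ioi 0))
      refine hbi.mono' hc.aestronglyMeasurable ?_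
      have hq := (Measure.quasiMeasurePreserving_snd (μ := μ₀)
        (ν := (volume : Measure ℝ).restrict (Ioi 0))).ae
          (self_mem_ae_restrict measurableSet_Ioi)
      filter_upwards [hq] with z (hz : 0 < z.2)
      change ‖trunc (z.2 / ε) z.1 * truncWeight z.2‖ ≤ _
      rw [one_mul, norm_mul, mul_div_right_comm, abs_mul, Real.norm_eq_abs, Real.norm_eq_abs,
        abs_of_pos (div_pos hz hε)]
      exact mul_le_mul_of_nonneg_right (abs_trunc_le (div_pos hz hε).le _) (abs_nonneg _)
  have hlim : Tendsto (fun ε : ℝ => ∫ a in Ioi 0, G (a / ε) * truncWeight a) (𝓝[>] 0)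
      (𝓝 (∫ a in Ioi 0, γ₀ * truncWeight a)) := by
    refine tendsto_integral_filter_of_dominated_convergence (fun a => K * |truncWeight a|)
      (Eventually.of_forall fun ε => ?_) ?_ (integrable_truncWeight.abs.const_mul K).restrict ?_
    · exact ((hGm.comp_measurable (measurable_id.div_const ε)).mul
        continuous_truncWeight.stronglyMeasurable).aestronglyMeasurable
    · filter_upwards [self_mem_nhdsWithin] with ε (hε : 0 < ε)
      filter_upwards [self_mem_ae_restrict measurableSet_Ioi] with a (ha : 0 < a)
      rw [norm_mul]
      exact mul_le_mul_of_nonneg_right (hK _ (div_pos ha hε).le) (abs_nonneg _)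
    · filter_upwards [self_mem_ae_restrict measurableSet_Ioi] with a (ha : 0 < a)
      refine Tendsto.mul_const _ (h.tendsto_integral_trunc.comp ?_)
      exact (tendsto_inv_nhdsGT_zero.const_mul_atTop ha).congr fun ε => (div_eq_mul_inv _ _).symm
  -- The weight has total mass one, so the limit is `γ₀`.
  rw [integral_const_mul, integral_Ioi_truncWeight] at hlim
  norm_num at hlim
  refine hlim.congr' ?_
  filter_upwards [self_mem_nhdsWithin] with ε hε
  exact (hrep ε hε).symm

end PrincipalValue

/-! ### Truncated means of the steady state for `α = 1` -/

section CauchyMean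

/-- Imaginary part of the Laplace integral of `e^{(-1 + iy) s}`. -/
lemma integral_exp_neg_mul_sin (y : ℝ) :
    ∫ s in Ioi (0 : ℝ), Real.exp (-s) * Real.sin (s * y) = y / (1 + y ^ 2) := by
  have ha : ((-1 + y * Complex.I : ℂ)).re < 0 := by simp
  have hint := integrableOn_exp_mul_complex_Ioi ha 0
  have h := integral_exp_mul_complex_Ioi ha 0
  have him : ∀ s : ℝ, (Complex.exp ((-1 + y * Complex.I) * s)).im =
      Real.exp (-s) * Real.sin (s * y) := by
    intro s
    rw [Complex.exp_im]
    simp [mul_comm]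
  have h2 := integral_im hint
  simp only [RCLike.im_eq_complex_im, him] at h2
  rw [h2, h]
  simp only [Complex.ofReal_zero, mul_zero, Complex.exp_zero, Complex.div_im, Complex.neg_im,
    Complex.neg_re, Complex.one_im, Complex.one_re, Complex.add_re, Complex.add_im,
    Complex.mul_re, Complex.mul_im, Complex.ofReal_re, Complex.ofReal_im, Complex.I_re,
    Complex.I_im, Complex.normSq_apply]
  have : (1 + y ^ 2) ≠ 0 := by positivity
  field_simp
  ring

lemma integrableOn_exp_neg_mul : IntegrableOn (fun s : ℝ => Real.exp (-s) * s) (Ioi 0) := by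
  have := Real.GammaIntegral_convergent (s := 2) two_pos
  refine this.congr_fun (fun s _ => ?_) measurableSet_Ioi
  norm_num

lemma integral_exp_neg_mul : ∫ s in Ioi (0 : ℝ), Real.exp (-s) * s = 1 := by
  have := Real.Gamma_eq_integral (s := 2) two_pos
  rw [Real.Gamma_two] at this
  rw [this]
  refine setIntegral_congr_fun measurableSet_Ioi fun s _ => ?_
  norm_num

/-- Fubini's theorem expresses the rational truncation through sine transforms, that is, through the
imaginary part of the characteristic function. -/
lemma integral_ratTrunc_eq (μ : Measure ℝ) [IsProbabilityMeasure μ] {ε : ℝ} (hε : 0 < ε) :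
    ∫ x, ratTrunc ε x ∂μ =
      ∫ s in Ioi (0 : ℝ), Real.exp (-s) * ((∫ x, Real.sin (s * ε * x) ∂μ) / ε) := by
  have h1 : ∀ x : ℝ, ratTrunc ε x =
      ∫ s in Ioi (0 : ℝ), Real.exp (-s) * (Real.sin (s * ε * x) / ε) := by
    intro x
    have := integral_exp_neg_mul_sin (ε * x)
    simp only [← mul_div_assoc]
    rw [integral_div]
    simp only [← mul_assoc] at this
    rw [this, ratTrunc]
    field_simp
  simp_rw [h1]
  rw [integral_integral_swap]
  · refine integral_congr_ae (ae_of_all _ fun s => ?_)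
    simp only
    rw [integral_const_mul, integral_div]
  · have hbi : Integrable (fun z : ℝ × ℝ => 1 * (Real.exp (-z.2) * (1 / ε)))
        (μ.prod (volume.restrict (Ioi 0))) :=
      (integrable_const (1 : ℝ)).mul_prod ((integrableOn_exp_neg_Ioi 0).mul_const (1 / ε))
    refine hbi.mono' (Continuous.aestronglyMeasurable (by
      simp only [Function.uncurry_def]
      fun_prop)) (ae_of_all _ fun z => ?_)
    change ‖Real.exp (-z.2) * (Real.sin (z.2 * ε * z.1) / ε)‖ ≤ _
    rw [one_mul, norm_mul, Real.norm_of_nonneg (Real.exp_pos _).le, norm_div,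
      Real.norm_of_nonneg hε.le]
    gcongr
    exact Real.abs_sin_le_one _

variable {Ω : Type*} [MeasurableSpace Ω] {P : Measure Ω} [IsProbabilityMeasure P] {L R : Ω → ℝ}
  {ν μ₀ μinf : Measure ℝ} {η : ℝ → ℂ}

/-- Since `η` is linear on the half-line and `ν` has mean one, the sine transform at `s ε`, divided
by `ε`, tends to `s Im η(1)` and is dominated by `s |Im η(1)|`. Averaging against `e^{-s}` leaves
`Im η(1)`, because `∫ s e^{-s} ds = 1`. -/
lemma IsMixtureOfExp.tendsto_integral_ratTrunc (h : IsMixtureOfExp 1 ν μinf η)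
    (hν : IsMixingLaw P L R 1 ν) :
    Tendsto (fun ε => ∫ x, ratTrunc ε x ∂μinf) (𝓝[>] 0) (𝓝 (η 1).im) := by
  have := h.prob
  have hη : ∀ s : ℝ, 0 ≤ s → η s = s * η 1 := by
    intro s hs
    simpa using h.homogeneous s 1 hs
  have hψ : ∀ s : ℝ, 0 < s →
      Tendsto (fun ε => (∫ x, Real.sin (s * ε * x) ∂μinf) / ε) (𝓝[>] 0) (𝓝 (s * (η 1).im)) := by
    intro s hs
    have e : s * (η 1).im = ∫ v, v * (s * (η 1).im) ∂ν := by
      rw [integral_mul_const, hν.mean, one_mul]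
    rw [e]
    have h1 : ∀ ε : ℝ, (∫ x, Real.sin (s * ε * x) ∂μinf) / ε =
        ∫ v, Real.exp (v * (η (s * ε)).re) * Real.sin (v * (η (s * ε)).im) / ε ∂ν := fun ε => by
      rw [h.integral_sin hν, integral_div]
    simp_rw [h1]
    refine tendsto_integral_filter_of_dominated_convergence (fun v => v * (s * |(η 1).im|))
      (Eventually.of_forall fun ε => Continuous.aestronglyMeasurable (by fun_prop)) ?_
      (hν.integrable_id.mul_const _) (ae_of_all _ fun v => ?_)
    · filter_upwards [self_mem_nhdsWithin] with ε (hε : 0 < ε)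
      filter_upwards [hν.ae_nonneg] with v hv
      rw [norm_div, Real.norm_of_nonneg hε.le, div_le_iff₀ hε]
      refine (h.norm_sin_integrand_le hv _).trans (le_of_eq ?_)
      rw [hη _ (mul_pos hs hε).le, Complex.im_ofReal_mul, abs_mul, abs_of_pos (mul_pos hs hε)]
      ring
    · have h2 : Tendsto (fun ε : ℝ => Real.exp (v * (s * ε * (η 1).re)) *
          (Real.sin (ε * (v * (s * (η 1).im))) / ε)) (𝓝[>] 0)
          (𝓝 (1 * (v * (s * (η 1).im)))) := by
        refine Tendsto.mul ?_ (tendsto_sin_mul_div _)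
        have : Continuous fun ε : ℝ => Real.exp (v * (s * ε * (η 1).re)) := by fun_prop
        have := this.tendsto 0
        simp only [mul_zero, zero_mul, Real.exp_zero] at this
        exact this.mono_left nhdsWithin_le_nhds
      rw [one_mul] at h2
      refine h2.congr' ?_
      filter_upwards [self_mem_nhdsWithin] with ε (hε : 0 < ε)
      rw [hη _ (mul_pos hs hε).le, Complex.im_ofReal_mul, Complex.re_ofReal_mul, mul_div_assoc]
      congr 3
      ring
  have hlim : Tendsto (fun ε => ∫ s in Ioi (0 : ℝ),
      Real.exp (-s) * ((∫ x, Real.sin (s * ε * x) ∂μinf) / ε)) (𝓝[>] 0)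
      (𝓝 (∫ s in Ioi (0 : ℝ), Real.exp (-s) * (s * (η 1).im))) := by
    refine tendsto_integral_filter_of_dominated_convergence
      (fun s => Real.exp (-s) * s * |(η 1).im|) (Eventually.of_forall fun ε => ?_) ?_
      (integrableOn_exp_neg_mul.mul_const _) ?_
    · have hc : StronglyMeasurable fun z : ℝ × ℝ => Real.sin (z.1 * ε * z.2) :=
        Continuous.stronglyMeasurable (by fun_prop)
      exact ((by fun_prop : Measurable fun s : ℝ => Real.exp (-s)).mul
        ((hc.integral_prod_right (ν := μinf)).measurable.div_const ε)).aestronglyMeasurable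
    · filter_upwards [self_mem_nhdsWithin] with ε (hε : 0 < ε)
      filter_upwards [self_mem_ae_restrict measurableSet_Ioi] with s (hs : 0 < s)
      rw [norm_mul, norm_div, Real.norm_of_nonneg (Real.exp_pos _).le, Real.norm_of_nonneg hε.le,
        mul_assoc]
      refine mul_le_mul_of_nonneg_left ?_ (Real.exp_pos _).le
      rw [div_le_iff₀ hε]
      refine (h.abs_integral_sin_le hν _).trans (le_of_eq ?_)
      rw [hη _ (mul_pos hs hε).le, Complex.im_ofReal_mul, abs_mul, abs_of_pos (mul_pos hs hε)]
      ring
    · filter_upwards [self_mem_ae_restrict measurableSet_Ioi] with s (hs : 0 < s)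
      exact (hψ s hs).const_mul _
  simp only [← mul_assoc] at hlim
  rw [integral_mul_const, integral_exp_neg_mul, one_mul] at hlim
  refine hlim.congr' ?_
  filter_upwards [self_mem_nhdsWithin] with ε hε
  exact (integral_ratTrunc_eq μinf hε).symm

lemma CauchyDatum.integral_coupling_eq_zero {c₀ γ₀ : ℝ} [IsProbabilityMeasure μ₀]
    (h0 : CauchyDatum μ₀ c₀ γ₀) (h : IsMixtureOfExp 1 ν μinf η) (hγ : (η 1).im = γ₀)
    (hν : IsMixingLaw P L R 1 ν) {m : Measure (ℝ × ℝ)} [IsProbabilityMeasure m]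
    (hm₁ : m.map Prod.fst = μ₀) (hm₂ : m.map Prod.snd = μinf)
    (hint : Integrable (fun z : ℝ × ℝ => z.1 - z.2) m) : ∫ z, (z.1 - z.2) ∂m = 0 := by
  refine integral_sub_eq_zero_of_tendsto hint (h := ratTrunc) (γ := γ₀) measurable_ratTrunc
    (fun ε hε => ⟨1 / ε, abs_ratTrunc_le hε⟩) (fun ε _ => abs_ratTrunc_sub_le ε)
    tendsto_ratTrunc ?_ ?_
  · rw [hm₁]
    exact h0.tendsto_integral_ratTrunc
  · rw [hm₂, ← hγ]
    exact h.tendsto_integral_ratTrunc hν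

end CauchyMean

/-! ### Real moments and the spectral function -/

section Rates

variable {Ω : Type*} [MeasurableSpace Ω] {P : Measure Ω} [IsProbabilityMeasure P] {L R : Ω → ℝ}
  {α p : ℝ}

lemma integrable_abs_rpow_of_lintegral_ne_top {X : Ω → ℝ} (hX : Measurable X)
    (hX0 : ∀ᵐ ω ∂P, 0 ≤ X ω) {s : ℝ} (h : ∫⁻ ω, ENNReal.ofReal (X ω ^ s) ∂P ≠ ⊤) :
    Integrable (fun ω => |X ω| ^ s) P ∧
      ∫⁻ ω, ENNReal.ofReal (X ω ^ s) ∂P = ENNReal.ofReal (∫ ω, |X ω| ^ s ∂P) := by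
  have he : (fun ω => X ω ^ s) =ᵐ[P] fun ω => |X ω| ^ s := by
    filter_upwards [hX0] with ω hω
    rw [abs_of_nonneg hω]
  have hi : Integrable (fun ω => X ω ^ s) P := by
    refine (lintegral_ofReal_ne_top_iff_integrable
      (Measurable.aestronglyMeasurable (by fun_prop)) ?_).mp h
    filter_upwards [hX0] with ω hω using Real.rpow_nonneg hω s
  refine ⟨hi.congr he, ?_⟩
  rw [← integral_congr_ae he, ofReal_integral_eq_lintegral_ofReal hi]
  filter_upwards [hX0] with ω hω using Real.rpow_nonneg hω s

namespace AssumptionH0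

lemma momentSum_eq_add (h : AssumptionH0 P L R α p) (s : ℝ) : momentSum P L R s =
    ∫⁻ ω, ENNReal.ofReal (L ω ^ s) ∂P + ∫⁻ ω, ENNReal.ofReal (R ω ^ s) ∂P := by
  have := h.measurable_L
  rw [momentSum, lintegral_add_left (by fun_prop)]

lemma moments_of_ne_top (h : AssumptionH0 P L R α p) {s : ℝ} (hs : momentSum P L R s ≠ ⊤) :
    Integrable (fun ω => |L ω| ^ s) P ∧ Integrable (fun ω => |R ω| ^ s) P ∧
      momentSum P L R s = ENNReal.ofReal (∫ ω, |L ω| ^ s ∂P + ∫ ω, |R ω| ^ s ∂P) := by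
  rw [h.momentSum_eq_add] at hs ⊢
  obtain ⟨h1, h2⟩ := ENNReal.add_ne_top.mp hs
  obtain ⟨i1, e1⟩ := integrable_abs_rpow_of_lintegral_ne_top h.measurable_L h.nonneg_L h1
  obtain ⟨i2, e2⟩ := integrable_abs_rpow_of_lintegral_ne_top h.measurable_R h.nonneg_R h2
  refine ⟨i1, i2, ?_⟩
  rw [e1, e2, ENNReal.ofReal_add (integral_nonneg fun _ => by positivity)
    (integral_nonneg fun _ => by positivity)]

lemma integrable_L (h : AssumptionH0 P L R α p) : Integrable (fun ω => |L ω| ^ p) P :=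
  (h.moments_of_ne_top h.moment_p.ne_top).1

lemma integrable_R (h : AssumptionH0 P L R α p) : Integrable (fun ω => |R ω| ^ p) P :=
  (h.moments_of_ne_top h.moment_p.ne_top).2.1

lemma momentSum_p (h : AssumptionH0 P L R α p) :
    momentSum P L R p = ENNReal.ofReal (∫ ω, |L ω| ^ p ∂P + ∫ ω, |R ω| ^ p ∂P) :=
  (h.moments_of_ne_top h.moment_p.ne_top).2.2

lemma moment_p_lt_one (h : AssumptionH0 P L R α p) :
    ∫ ω, |L ω| ^ p ∂P + ∫ ω, |R ω| ^ p ∂P < 1 := by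
  have := h.moment_p
  rwa [h.momentSum_p, ENNReal.ofReal_lt_one] at this

lemma moment_alpha_eq_one (h : AssumptionH0 P L R α p) :
    ∫ ω, |L ω| ^ α ∂P + ∫ ω, |R ω| ^ α ∂P = 1 := by
  have := (h.moments_of_ne_top (s := α) (by simp [h.moment_alpha])).2.2
  rw [h.moment_alpha, eq_comm, ENNReal.ofReal_eq_one] at this
  exact this

lemma momentSum_two (h : AssumptionH0 P L R α p) (hp : 2 < p) :
    momentSum P L R 2 = ENNReal.ofReal (∫ ω, L ω ^ 2 ∂P + ∫ ω, R ω ^ 2 ∂P) := by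
  have iL := integrable_abs_rpow h.measurable_L h.integrable_L zero_le_two hp.le
  have iR := integrable_abs_rpow h.measurable_R h.integrable_R zero_le_two hp.le
  simp only [Real.rpow_two, sq_abs] at iL iR
  rw [h.momentSum_eq_add, ENNReal.ofReal_add (integral_nonneg fun _ => by positivity)
    (integral_nonneg fun _ => by positivity),
    ofReal_integral_eq_lintegral_ofReal iL (ae_of_all _ fun _ => by positivity),
    ofReal_integral_eq_lintegral_ofReal iR (ae_of_all _ fun _ => by positivity)]
  simp only [Real.rpow_two]

/-- The moment is a convex function of its exponent. Here `2 = θ α + (1 - θ) p` with `θ < 1`, and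
the moment sum is `1` at `α` and less than `1` at `p`. -/
lemma moment_two_lt_one (h : AssumptionH0 P L R α p) (hα : α < 2) (hp : 2 < p) :
    ∫ ω, L ω ^ 2 ∂P + ∫ ω, R ω ^ 2 ∂P < 1 := by
  obtain ⟨aL, aR, -⟩ := h.moments_of_ne_top (s := α) (by simp [h.moment_alpha])
  set θ := (p - 2) / (p - α) with hθ
  have hpα : 0 < p - α := by linarith
  have hθ0 : 0 ≤ θ := div_nonneg (by linarith) hpα.le
  have hθ1 : θ < 1 := by rw [hθ, div_lt_one hpα]; linarith
  have hθ2 : α * θ + p * (1 - θ) = 2 := by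
    rw [hθ]
    field_simp
    ring
  have hpt : ∀ x : ℝ, x ^ 2 ≤ θ * |x| ^ α + (1 - θ) * |x| ^ p := by
    intro x
    have h0 := abs_nonneg x
    have := Real.geom_mean_le_arith_mean2_weighted hθ0 (by linarith : 0 ≤ 1 - θ)
      (Real.rpow_nonneg h0 α) (Real.rpow_nonneg h0 p) (by ring)
    rwa [← Real.rpow_mul h0, ← Real.rpow_mul h0, ← Real.rpow_add' h0 (by rw [hθ2]; norm_num),
      hθ2, Real.rpow_two, sq_abs] at this
  have key : ∀ X : Ω → ℝ, Measurable X → Integrable (fun ω => |X ω| ^ α) P →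
      Integrable (fun ω => |X ω| ^ p) P →
      ∫ ω, X ω ^ 2 ∂P ≤ θ * ∫ ω, |X ω| ^ α ∂P + (1 - θ) * ∫ ω, |X ω| ^ p ∂P := by
    intro X hX hXα hXp
    have i2 := integrable_abs_rpow hX hXp zero_le_two hp.le
    simp only [Real.rpow_two, sq_abs] at i2
    rw [← integral_const_mul, ← integral_const_mul, ← integral_add (hXα.const_mul _)
      (hXp.const_mul _)]
    exact integral_mono i2 ((hXα.const_mul _).add (hXp.const_mul _)) fun ω => hpt (X ω)
  have h1 := key L h.measurable_L aL h.integrable_L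
  have h2 := key R h.measurable_R aR h.integrable_R
  have h3 := h.moment_p_lt_one
  have h4 := h.moment_alpha_eq_one
  have h5 : (1 - θ) * (∫ ω, |L ω| ^ p ∂P + ∫ ω, |R ω| ^ p ∂P) < (1 - θ) * 1 :=
    mul_lt_mul_of_pos_left h3 (by linarith)
  have h6 : θ * (∫ ω, |L ω| ^ α ∂P + ∫ ω, |R ω| ^ α ∂P) = θ := by rw [h4, mul_one]
  linarith

end AssumptionH0

lemma spectral_eq_coe {S q : ℝ} (hS : 0 ≤ S) (h : momentSum P L R q = ENNReal.ofReal S) :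
    spectral P L R q = (((S - 1) / q : ℝ) : EReal) := by
  rw [spectral, convexS, h, EReal.coe_ennreal_ofReal, max_eq_left hS, EReal.coe_div,
    EReal.coe_sub, EReal.coe_one]

end Rates

/-! ### From a coupling to the Wild series of the difference -/

section Coupling

/-- A coupling of finite cost is enough; optimality is never needed, as the cost only enters the
constant. -/
lemma exists_coupling_of_wasserstein_lt_top {p : ℝ} (hp : 1 < p) {μ₁ μ₂ : Measure ℝ}
    (h : wasserstein p μ₁ μ₂ < ⊤) :
    ∃ m ∈ couplings μ₁ μ₂, ∫⁻ z, ENNReal.ofReal (|z.1 - z.2| ^ p) ∂m < ⊤ := by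
  rw [wasserstein, iInf_lt_iff] at h
  obtain ⟨m, h⟩ := h
  rw [iInf_lt_iff] at h
  obtain ⟨hm, h⟩ := h
  refine ⟨m, hm, ?_⟩
  have hmin : 0 < min 1 (1 / p) := by
    have : 0 < p := by linarith
    positivity
  exact (ENNReal.rpow_lt_top_iff_of_pos hmin).mp h

variable {Ω : Type*} [MeasurableSpace Ω] {P : Measure Ω} [IsProbabilityMeasure P] {L R : Ω → ℝ}
  {p : ℝ}

/-- The difference of the coordinates of `ℝ × ℝ`, as a continuous linear map. -/
def diffMap : ℝ × ℝ →L[ℝ] ℝ := ContinuousLinearMap.fst ℝ ℝ ℝ - ContinuousLinearMap.snd ℝ ℝ ℝ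

/-- Evolving a coupling of the initial datum with a stationary law couples the solution with that
law. -/
lemma wasserstein_solution_le (hp : 1 ≤ p) (hL : Measurable L) (hR : Measurable R)
    {μ₀ μinf : Measure ℝ} [IsProbabilityMeasure μ₀] (hinf : collide P L R μinf μinf = μinf)
    {m : Measure (ℝ × ℝ)} (hm : m ∈ couplings μ₀ μinf) {μ : ℝ → Measure ℝ}
    (hμ : IsSolution P L R μ₀ μ) {t : ℝ} (ht : 0 ≤ t) :
    wasserstein p (μ t) μinf ≤
      (∫⁻ x, ENNReal.ofReal (|x| ^ p) ∂wildSum P L R (m.map diffMap) t) ^ (1 / p) := by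
  obtain ⟨hmp, hm₁, hm₂⟩ := hm
  -- The evolved coupling is the Wild series on the plane, with the same `(L, R)` acting on both
  -- coordinates; the projections are linear, and the second marginal is stationary.
  have hmem : wildSum P L R m t ∈ couplings (μ t) μinf := by
    refine ⟨isProbabilityMeasure_wildSum hL hR m ht, ?_, ?_⟩
    · rw [hμ.eq_wildSum hL hR ht, ← hm₁]
      exact map_wildSum hL hR (ContinuousLinearMap.fst ℝ ℝ ℝ) m t
    · conv_rhs => rw [← wildSum_eq_self (P := P) (L := L) (R := R) μinf hinf ht, ← hm₂]
      exact map_wildSum hL hR (ContinuousLinearMap.snd ℝ ℝ ℝ) m t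
  refine (iInf₂_le _ hmem).trans (le_of_eq ?_)
  have hp0 : 0 < p := by linarith
  rw [min_eq_right (by rw [div_le_one hp0]; exact hp), ← map_wildSum hL hR diffMap m t,
    lintegral_map (Measurable.ennreal_ofReal (by fun_prop)) diffMap.continuous.measurable]
  rfl

/-- The finite `p`-cost makes the difference integrable, which is why the centering hypothesis may
be conditional on integrability. -/
lemma isCenteredWithMoment_map_diffMap (hp : 1 < p) {m : Measure (ℝ × ℝ)} [IsProbabilityMeasure m]
    (hm : ∫⁻ z, ENNReal.ofReal (|z.1 - z.2| ^ p) ∂m < ⊤)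
    (h0 : Integrable (fun z : ℝ × ℝ => z.1 - z.2) m → ∫ z, (z.1 - z.2) ∂m = 0) :
    IsCenteredWithMoment p (m.map diffMap) := by
  have hd : Measurable diffMap := diffMap.continuous.measurable
  have hi : Integrable (fun z : ℝ × ℝ => |z.1 - z.2| ^ p) m :=
    (lintegral_ofReal_ne_top_iff_integrable (Measurable.aestronglyMeasurable (by fun_prop))
      (ae_of_all _ fun z => by positivity)).mp hm.ne
  have hi1 : Integrable (fun z : ℝ × ℝ => z.1 - z.2) m := by
    refine (integrable_abs_rpow (by fun_prop) hi zero_le_one hp.le).mono' (by fun_prop)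
      (ae_of_all _ fun z => ?_)
    simp
  refine ⟨Measure.isProbabilityMeasure_map hd.aemeasurable, ?_, ?_⟩
  · rw [integrable_map_measure (Measurable.aestronglyMeasurable (by fun_prop)) hd.aemeasurable]
    exact hi
  · rw [integral_map hd.aemeasurable (by fun_prop)]
    exact h0 hi1

end Coupling

end

end KineticEq

/-! ### The convergence rate -/

theorem theorem3p4 {Ω : Type*} [MeasurableSpace Ω] (P : Measure Ω) [IsProbabilityMeasure P]
    (L R : Ω → ℝ) (α p : ℝ) (hH0 : AssumptionH0 P L R α p)
    (hα₁ : 1 ≤ α) (hα₂ : α < 2) (hp : 2 < p)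
    (μ₀ : Measure ℝ) [IsProbabilityMeasure μ₀]
    (ν μinf : Measure ℝ) (hν : IsMixingLaw P L R α ν)
    (hcase :
      (α = 1 ∧ ∃ c₀ γ₀ : ℝ, CauchyDatum μ₀ c₀ γ₀ ∧ IsCauchySteadyState c₀ γ₀ ν μinf) ∨
      (1 < α ∧ ∃ cp cm : ℝ, StableDatum α μ₀ cp cm ∧ IsStableSteadyState α cp cm ν μinf))
    (hd : wasserstein p μ₀ μinf < ⊤) :
    ∃ C : ℝ, ∀ μ : ℝ → Measure ℝ, IsSolution P L R μ₀ μ → ∀ t : ℝ, 0 ≤ t →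
      (spectral P L R p ≠ spectral P L R 2 →
        wasserstein p (μ t) μinf ≤
          ENNReal.ofReal (C * Real.exp (-(t * |(rateK2 P L R p).toReal|)))) ∧
      (spectral P L R p = spectral P L R 2 →
        wasserstein p (μ t) μinf ≤
          ENNReal.ofReal (C * max 1 t * Real.exp (-(t * |(rateK2 P L R p).toReal|)))) := by
  have hL := hH0.measurable_L
  have hR := hH0.measurable_R
  have hp0 : 0 < p := by linarith
  obtain ⟨hinf, hmean⟩ : collide P L R μinf μinf = μinf ∧
      ∀ m : Measure (ℝ × ℝ), IsProbabilityMeasure m → m.map Prod.fst = μ₀ →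
        m.map Prod.snd = μinf → Integrable (fun z : ℝ × ℝ => z.1 - z.2) m →
        ∫ z, (z.1 - z.2) ∂m = 0 := by
    rcases hcase with ⟨rfl, c₀, γ₀, h0, hs⟩ | ⟨hα, cp, cm, h0, hs⟩
    · have h := hs.isMixtureOfExp h0.nonneg
      exact ⟨h.collide_eq hL hR hH0.nonneg_L hH0.nonneg_R hν, fun m _ hm₁ hm₂ hi =>
        h0.integral_coupling_eq_zero h (by simp) hν hm₁ hm₂ hi⟩
    · have h := hs.isMixtureOfExp hH0.alpha_pos
        (stableScale_nonneg hα₁ hα₂ h0.nonneg.1 h0.nonneg.2)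
      exact ⟨h.collide_eq hL hR hH0.nonneg_L hH0.nonneg_R hν, fun m _ hm₁ hm₂ hi =>
        h.integral_coupling_eq_zero hα hν (h0.centered hα).1 (h0.centered hα).2 hm₁ hm₂ hi⟩
  -- The coupling is fixed before the solution and the time, so the constant depends only on the
  -- data.
  obtain ⟨m, hm, hcost⟩ := exists_coupling_of_wasserstein_lt_top (by linarith) hd
  have := hm.1
  have hρ := isCenteredWithMoment_map_diffMap (by linarith) hcost (hmean m hm.1 hm.2.1 hm.2.2)
  have hsp := hH0.moment_p_lt_one
  have hs2 := hH0.moment_two_lt_one hα₂ hp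
  have hspec := spectral_eq_coe (P := P) (L := L) (R := R)
    (add_nonneg (integral_nonneg fun _ => by positivity) (integral_nonneg fun _ => by positivity))
    hH0.momentSum_p
  have hspec2 := spectral_eq_coe (P := P) (L := L) (R := R)
    (add_nonneg (integral_nonneg fun _ => by positivity) (integral_nonneg fun _ => by positivity))
    (hH0.momentSum_two hp)
  obtain ⟨D, M, hD, hM, hbound⟩ := lintegral_wildSum_rpow_le hp hL hR hH0.integrable_L
    hH0.integrable_R hsp hs2.le hρ
  set sp := ∫ ω, |L ω| ^ p ∂P + ∫ ω, |R ω| ^ p ∂P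
  set s2 := ∫ ω, L ω ^ 2 ∂P + ∫ ω, R ω ^ 2 ∂P
  set K := max ((s2 - 1) / 2) ((sp - 1) / p) with hK
  have hrate : (rateK2 P L R p).toReal = K := by
    rw [rateK2, hspec, hspec2, ← EReal.coe_strictMono.monotone.map_max, EReal.toReal_coe]
  have hKneg : K < 0 := max_lt (by linarith) (div_neg_of_neg_of_pos (by linarith) hp0)
  have hexp : ∀ t : ℝ, Real.exp (-(t * |K|)) = Real.exp (K * t) := fun t => by
    rw [abs_of_neg hKneg]
    congr 1
    ring
  have hb : (sp - 1) / (p / 2) = 2 * ((sp - 1) / p) := by field_simp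
  have hc : s2 - 1 = 2 * ((s2 - 1) / 2) := by ring
  -- Both exponents for `w` are twice values of the spectral function, because `w` controls the
  -- square of the distance.
  have hmax : max ((sp - 1) / (p / 2)) (s2 - 1) = 2 * K := by
    rw [hb, hK, max_comm, mul_max_of_nonneg _ _ zero_le_two, ← hc]
  have hsqrt : ∀ t, √(Real.exp (2 * K * t)) = Real.exp (K * t) := fun t => by
    rw [show 2 * K * t = K * t + K * t by ring, Real.exp_add,
      Real.sqrt_mul_self (Real.exp_pos _).le]
  have hfin : ∀ μ : ℝ → Measure ℝ, IsSolution P L R μ₀ μ → ∀ t : ℝ, 0 ≤ t → ∀ y : ℝ, 0 ≤ y →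
      ∫⁻ x, ENNReal.ofReal (|x| ^ p) ∂wildSum P L R (m.map diffMap) t ≤
        ENNReal.ofReal (y ^ (p / 2)) → wasserstein p (μ t) μinf ≤ ENNReal.ofReal (√y) := by
    intro μ hμ t ht y hy hle
    refine (wasserstein_solution_le (by linarith) hL hR hinf hm hμ ht).trans ?_
    refine (ENNReal.rpow_le_rpow hle (by positivity)).trans (le_of_eq ?_)
    rw [ENNReal.ofReal_rpow_of_nonneg (by positivity) (by positivity), ← Real.rpow_mul hy,
      show p / 2 * (1 / p) = 1 / 2 by field_simp, ← Real.sqrt_eq_rpow]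
  rw [hrate, hspec, hspec2]
  by_cases heq : (sp - 1) / p = (s2 - 1) / 2
  -- Resonant case: the two exponents of the linear inequality coincide.
  · have hcb : s2 - 1 = (sp - 1) / (p / 2) := by rw [hb, heq, ← hc]
    obtain ⟨w, w', C, hC, hw, hwpos, hwM, hww, hwC⟩ :=
      exists_supersolution_of_eq (b := (sp - 1) / (p / 2)) hD hM
    rw [← hmax, hcb, max_self] at hsqrt
    refine ⟨√C, fun μ hμ t ht => ⟨fun hne => absurd (by rw [heq]) hne, fun _ => ?_⟩⟩
    refine (hfin μ hμ t ht (w t) (hwpos t ht).le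
      (hbound w w' hw hwpos hwM (by rwa [hcb]) t ht)).trans (ENNReal.ofReal_le_ofReal ?_)
    refine (Real.sqrt_le_sqrt (hwC t ht)).trans ?_
    have h1 : 1 ≤ max 1 t := le_max_left _ _
    rw [hexp, Real.sqrt_mul (by positivity), Real.sqrt_mul hC, hsqrt]
    -- The argument gives the factor `√(max 1 t)`, which is weakened to `max 1 t`.
    have h2 : √(max 1 t) ≤ max 1 t :=
      Real.sqrt_le_iff.mpr ⟨by linarith, le_self_pow₀ h1 two_ne_zero⟩
    gcongr
  · have hne : (sp - 1) / (p / 2) ≠ s2 - 1 := fun h => heq (by linarith)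
    obtain ⟨w, w', C, hC, hw, hwpos, hwM, hww, hwC⟩ := exists_supersolution_of_ne hD hM hne
    refine ⟨√C, fun μ hμ t ht => ⟨fun _ => ?_, fun h => absurd (EReal.coe_injective h) heq⟩⟩
    refine (hfin μ hμ t ht (w t) (hwpos t ht).le
      (hbound w w' hw hwpos hwM hww t ht)).trans (ENNReal.ofReal_le_ofReal ?_)
    refine (Real.sqrt_le_sqrt (hwC t ht)).trans ?_
    rw [hexp, Real.sqrt_mul hC, hmax, hsqrt]
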